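/- Let $\mathcal N\subset\mathbb R^3$ be a compact smooth (embedded, boundaryless) hypersurface with continuous unit normal field $\nu$, and let $\alpha>0$. For $h>0$ and a grid function $u=(u_j)_{j\in\mathbb Z^2}$ with values in $\mathbb R^3$ let $D_{+k}u_j=(u_{j+e_k}-u_j)/h$, $D_{-k}u_j=(u_j-u_{j-e_k})/h$ for $k=1,2$, and $\Delta^h=\sum_{k}D_{+k}D_{-k}$. For $S\subset\mathbb R^2$ put $$E^h[u;S]=\tfrac12h^2\sum_{j:\,jh\in S}\tfrac12\sum_{k=1}^2\big(|D_{+k}u_j|^2+|D_{-k}u_j|^2\big),\qquad E^h[u]=E^h[u;\mathbb R^2],$$ $$\|D^2u\|_{L^2_h(S)}=\Big(h^2\sum_{j:\,jh\in S}|D^2u_j|^2\Big)^{1/2},$$ where $D^2u_j$ is the vector of all second differences $D_{+1}^{a_1}D_{-1}^{b_1}D_{+2}^{a_2}D_{-2}^{b_2}u_j$ with $a_1+b_1+a_2+b_2=2$. A solution $u^h$ of the discrete Landau--Lifshitz--Gilbert system with mesh size $h$ is a function $u^h=(u^h_j(t))_{j\in\mathbb Z^2,\,t\ge0}$ with values in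 $\mathcal N$ and $$\frac{d}{dt}u^h_j=\nu_j\wedge\Delta^hu^h_j+\alpha\big(\Delta^hu^h_j+\lambda^h_j\nu_j\big),\qquad \nu_j=\nu(u^h_j),\quad \lambda^h_j=-\Delta^hu^h_j\cdot\nu_j,$$ for all $t\ge0$ and $j\in\mathbb Z^2$. There is $\varepsilon_0>0$, depending only on $\mathcal N$, $\nu$ and $\alpha$, such that for every real $E_0$ there is $\delta>0$, depending only on $\mathcal N,\nu,\alpha,E_0$ (in particular independent of $h$), with the following property. For every $R>0$ and every $\sigma\in(0,\delta R^2]$ there is a constant $C$, depending only on $\mathcal N,\nu,\alpha,E_0,R,\sigma$, such that for all $h>0$, all solutions $u^h$ with mesh size $h$ and $E^h[u^h(0)]\le E_0$, all $x_0\in\mathbb R^2$ and all $t_0\ge0$: $$E^h[u^h(t_0);B_R(x_0)]\le\varepsilon_0\quad\Longrightarrow\quad \sup_{t_0+\sigma\le t\le t_0+\delta R^2}\|D^2u^h(t)\|_{L^2_h(B_{R/8}(x_0))}\le C .$$ -/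

import Mathlib

open scoped ENNReal ContDiff

noncomputable section

namespace DiscreteLLG

/-- The plane `ℝ²` with its Euclidean norm. -/
abbrev Plane : Type := EuclideanSpace ℝ (Fin 2)

/-- The space `ℝ³` with its Euclidean norm. -/
abbrev Space : Type := EuclideanSpace ℝ (Fin 3)

/-- Grid indices `j = (j₁, j₂)`. -/
abbrev Grid : Type := Fin 2 → ℤ

/-- Grid functions with values in `ℝ³`. -/
abbrev GridFun : Type := Grid → Space

/-! ### The target hypersurface -/

/-- `g` is a smooth function on the open set `U`, without critical points there, whose zero set
in `U` is exactly the part of `N` in `U`. -/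
structure IsLocalEquation (N U : Set Space) (g : Space → ℝ) : Prop where
  isOpen : IsOpen U
  smooth : ContDiffOn ℝ ∞ g U
  regular : ∀ p ∈ U, fderiv ℝ g p ≠ 0
  zero_iff : ∀ p ∈ U, p ∈ N ↔ g p = 0

/-- `N` is a compact smooth (embedded, boundaryless) hypersurface of `ℝ³`, and `ν` is a continuous
field of unit normals along `N`. The tangent plane of `N` at `q` is the kernel of the derivative
at `q` of a local equation, and `ν q` is orthogonal to it. A continuous unit normal field is
locally plus or minus the normalized gradient of the local equation, hence is smooth. The values
of `ν` off `N` play no role. -/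
structure IsCompactHypersurface (N : Set Space) (ν : Space → Space) : Prop where
  isCompact : IsCompact N
  exists_local : ∀ p ∈ N, ∃ (U : Set Space) (g : Space → ℝ), p ∈ U ∧ IsLocalEquation N U g ∧
    ∀ q ∈ N ∩ U, ∀ v : Space, fderiv ℝ g q v = 0 → inner ℝ (ν q) v = 0
  continuousOn_normal : ContinuousOn ν N
  norm_normal : ∀ p ∈ N, ‖ν p‖ = 1

/-- The vector product on Euclidean `ℝ³`. -/
def cross (a b : Space) : Space :=
  WithLp.toLp 2 (crossProduct (WithLp.ofLp a) (WithLp.ofLp b))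

/-! ### Finite differences on the grid `hℤ²` -/

/-- The grid point `(j₁ h, j₂ h)`. -/
def gridPoint (h : ℝ) (j : Grid) : Plane := WithLp.toLp 2 (fun k => (j k : ℝ) * h)

/-- Forward difference `(D_{+k} u)_j = (u_{j_k + 1} - u_j) / h`. -/
def forwardDiff (h : ℝ) (k : Fin 2) (u : GridFun) : GridFun :=
  fun j => h⁻¹ • (u (j + Pi.single k 1) - u j)

/-- Backward difference `(D_{-k} u)_j = (u_j - u_{j_k - 1}) / h`. -/
def backwardDiff (h : ℝ) (k : Fin 2) (u : GridFun) : GridFun :=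
  fun j => h⁻¹ • (u j - u (j - Pi.single k 1))

/-- The discrete Laplacian `Δʰ = ∑_k D_{+k} D_{-k}`. -/
def laplacian (h : ℝ) (u : GridFun) : GridFun :=
  fun j => ∑ k : Fin 2, forwardDiff h k (backwardDiff h k u) j

/-- The difference operator `D^a = ∏_k (D_{+k})^{a (k, true)} (D_{-k})^{a (k, false)}`. The multi-index
`a` has one entry for each forward and one for each backward difference; the factors commute. -/
def multiDiff (h : ℝ) (a : Fin 2 × Bool → ℕ) (u : GridFun) : GridFun :=
  (forwardDiff h 0)^[a (0, true)] ((backwardDiff h 0)^[a (0, false)]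
    ((forwardDiff h 1)^[a (1, true)] ((backwardDiff h 1)^[a (1, false)] u)))

/-- `|D^m u_j|²`: the sum of `|D^a u_j|²` over all multi-indices `a` with `|a| = m`. -/
def diffNormSq (h : ℝ) (m : ℕ) (u : GridFun) (j : Grid) : ℝ :=
  ∑ a ∈ Finset.piAntidiag (Finset.univ : Finset (Fin 2 × Bool)) m, ‖multiDiff h a u j‖ ^ 2

/-- The discrete norm `‖D^m u‖_{L²_h(S)} = (h² ∑_{j : jh ∈ S} |D^m u_j|²)^{1/2}`, possibly `∞`. -/
def diffL2Norm (h : ℝ) (m : ℕ) (u : GridFun) (S : Set Plane) : ℝ≥0∞ :=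
  (∑' j : {j : Grid // gridPoint h j ∈ S},
    ENNReal.ofReal (h ^ 2 * diffNormSq h m u j)) ^ (1 / 2 : ℝ)

/-- The discrete Dirichlet energy of `u` over the grid points in `S`, possibly `∞`:
`E^h[u; S] = ½ h² ∑_{j : jh ∈ S} ½ ∑_k (|D_{+k} u_j|² + |D_{-k} u_j|²)`. -/
def energy (h : ℝ) (u : GridFun) (S : Set Plane) : ℝ≥0∞ :=
  ∑' j : {j : Grid // gridPoint h j ∈ S}, ENNReal.ofReal
    (1 / 2 * h ^ 2 * (1 / 2 * ∑ k : Fin 2,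
      (‖forwardDiff h k u j‖ ^ 2 + ‖backwardDiff h k u j‖ ^ 2)))

/-! ### The semi-discrete Landau–Lifshitz–Gilbert system -/

/-- The Lagrange multiplier `λ_j = - Δʰu_j · ν(u_j)`. -/
def multiplier (ν : Space → Space) (h : ℝ) (u : GridFun) (j : Grid) : ℝ :=
  -inner ℝ (laplacian h u j) (ν (u j))

/-- The right-hand side `ν_j ∧ Δʰu_j + α (Δʰu_j + λ_j ν_j)`, where `ν_j = ν(u_j)`. -/
def llgField (ν : Space → Space) (α h : ℝ) (u : GridFun) (j : Grid) : Space :=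
  cross (ν (u j)) (laplacian h u j)
    + α • (laplacian h u j + multiplier ν h u j • ν (u j))

/-- `u`, a function of time and grid index, takes its values in `N` and solves the semi-discrete
LLG system with mesh size `h` for all times `t ≥ 0`. Its initial datum is `u 0`. -/
structure IsSolution (N : Set Space) (ν : Space → Space) (α h : ℝ) (u : ℝ → GridFun) : Prop where
  mem : ∀ t, 0 ≤ t → ∀ j, u t j ∈ N
  hasDeriv : ∀ t, 0 ≤ t → ∀ j,
    HasDerivWithinAt (fun s => u s j) (llgField ν α h (u t) j) (Set.Ici 0) t

end DiscreteLLG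

end

namespace DiscreteLLG

/-! ### Calculus on the unit grid -/

/-! In the plane the Dirichlet energy is scale invariant, so rescaling time by `h ^ 2` removes the
mesh size (`IsSolution.isUnitSolution`, `sum_en_le_of_energy_le`). The analysis takes place on the
unit grid at radius `r = R / (16 h)`, with constants independent of `r`. It follows the small-energy
regularity theory of the harmonic map heat flow, with the velocity `v = fld ν α u` as the controlled
quantity.

Space. The velocity is a rotated and damped copy of the tangential part of `lap u`, hence controls
it. The normal part is quadratic in the first differences, because secants of `N` are tangent up to
second order (`NormalBounds.abs_inner_lap_le`). Its square is quartic, and a discrete Ladyzhenskaya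
inequality bounds the quartic sum by local energy times second differences, up to cutoff errors. For
small local energy this is absorbed: `IsCutoff.second_order_estimate` bounds second differences by
`v` in `L²`.

Energy. The localized energy inequality (`exists_hasDerivAt_energy`) is used three times. On larger
and larger boxes it shows that the total energy never exceeds its initial bound; at scale `r` it
keeps the local energy small for a time of order `r ^ 2`; and it bounds the space-time sum of `‖v‖ ^
2`.

Velocity. The equation is differentiated in time and tested with `φ ^ 2 • v`
(`NormalBounds.exists_velocity_inequality`). The precession term has no sign, but antisymmetry
removes its top order part, leaving first differences of `ν`. The remaining products are absorbed,
again by Ladyzhenskaya, into the dissipation due to `α`. The growth rate is then the local sum of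
`‖lap u‖ ^ 2 + en u ^ 2`, whose time integral is bounded by the first two parts. Gronwall's lemma
weighted by `t - t₀` needs no bound on the velocity at `t₀`, since `‖v‖ ^ 2` is integrable in time.

If `r < 4`, only boundedly many sites are involved, and compactness of `N` suffices
(`NormalBounds.coarse_bound`). -/

/-- The unit step in direction `k`. -/
def stp (k : Fin 2) : Grid := Pi.single k 1

lemma abs_stp_le (k i : Fin 2) : |stp k i| ≤ 1 := by
  fin_cases k <;> fin_cases i <;> simp [stp]

/-- The forward difference with unit mesh size. -/
def fd {X : Type*} [AddCommGroup X] (k : Fin 2) (f : Grid → X) : Grid → X :=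
  fun j => f (j + stp k) - f j

/-- The function vanishes at all sites within sup-distance one of `j`. -/
def Far (φ : Grid → ℝ) (j : Grid) : Prop := ∀ i : Grid, (∀ k, |i k - j k| ≤ 1) → φ i = 0

lemma Far.self {φ : Grid → ℝ} {j : Grid} (h : Far φ j) : φ j = 0 := h j (by simp)

lemma Far.add {φ : Grid → ℝ} {j : Grid} (h : Far φ j) (k : Fin 2) : φ (j + stp k) = 0 :=
  h _ (by simpa using abs_stp_le k)

lemma Far.sub {φ : Grid → ℝ} {j : Grid} (h : Far φ j) (k : Fin 2) : φ (j - stp k) = 0 :=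
  h _ (by simpa using abs_stp_le k)

open Classical in
/-- The indicator of the sites within sup-distance one of the support of `φ`. -/
noncomputable def chi (φ : Grid → ℝ) (j : Grid) : ℝ := if Far φ j then 0 else 1

lemma chi_nonneg (φ : Grid → ℝ) (j : Grid) : 0 ≤ chi φ j := by
  unfold chi; split_ifs <;> norm_num

lemma chi_sq (φ : Grid → ℝ) (j : Grid) : chi φ j ^ 2 = chi φ j := by
  unfold chi; split_ifs <;> norm_num

lemma Far.chi_eq {φ : Grid → ℝ} {j : Grid} (h : Far φ j) : chi φ j = 0 := by
  unfold chi; rw [if_pos h]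

lemma chi_eq_one {φ : Grid → ℝ} {j : Grid} (h : ¬ Far φ j) : chi φ j = 1 := by
  unfold chi; rw [if_neg h]

/-- `φ` is a cutoff function with Lipschitz constant `L ≤ 1` whose support lies at distance more
than three from the complement of `A`. -/
structure IsCutoff (A : Finset Grid) (φ : Grid → ℝ) (L : ℝ) : Prop where
  nonneg : ∀ j, 0 ≤ φ j
  le_one : ∀ j, φ j ≤ 1
  lip_nonneg : 0 ≤ L
  lip_le_one : L ≤ 1
  lip : ∀ k j, |φ (j + stp k) - φ j| ≤ L
  pad : ∀ j, φ j ≠ 0 → ∀ i : Grid, (∀ k, |i k - j k| ≤ 3) → i ∈ A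

namespace IsCutoff

variable {A : Finset Grid} {φ : Grid → ℝ} {L : ℝ}

lemma mem_of_not_far (hφ : IsCutoff A φ L) {j : Grid} (hj : ¬ Far φ j) (i : Grid)
    (hi : ∀ k, |i k - j k| ≤ 2) : i ∈ A := by
  unfold Far at hj
  push Not at hj
  obtain ⟨l, hl, hl0⟩ := hj
  refine hφ.pad l hl0 i fun k => ?_
  have h1 := hi k
  have h2 := hl k
  rw [abs_le] at *
  constructor <;> linarith

lemma lip_chi (hφ : IsCutoff A φ L) (k : Fin 2) (j : Grid) :
    |φ (j + stp k) - φ j| ≤ L * chi φ j := by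
  by_cases h : Far φ j
  · simp [h.chi_eq, h.self, h.add]
  · simpa [chi_eq_one h] using hφ.lip k j

lemma lip_chi_sub (hφ : IsCutoff A φ L) (k : Fin 2) (j : Grid) :
    |φ j - φ (j - stp k)| ≤ L * chi φ j := by
  by_cases h : Far φ j
  · simp [h.chi_eq, h.self, h.sub]
  · simpa [chi_eq_one h] using hφ.lip k (j - stp k)

lemma finsum_eq (hφ : IsCutoff A φ L) (F : Grid → ℝ) (hF : ∀ j, Far φ j → F j = 0) (s : Grid)
    (hs : ∀ k, |s k| ≤ 2) : ∑ᶠ j, F (j + s) = ∑ j ∈ A, F (j + s) := by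
  refine finsum_eq_sum_of_support_subset _ fun j hj => ?_
  have h1 : ¬ Far φ (j + s) := fun h => hj (hF _ h)
  exact hφ.mem_of_not_far h1 j (fun k => by simpa using hs k)

/-- Both sides equal the sum over the whole grid, which is translation invariant; the padding of the
cutoff keeps the shifted support inside `A`. -/
lemma sum_shift (hφ : IsCutoff A φ L) (F : Grid → ℝ) (hF : ∀ j, Far φ j → F j = 0) (s : Grid)
    (hs : ∀ k, |s k| ≤ 2) : ∑ j ∈ A, F (j + s) = ∑ j ∈ A, F j := by
  rw [← hφ.finsum_eq F hF s hs]
  have h0 := hφ.finsum_eq F hF 0 (by simp)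
  simp only [add_zero] at h0
  rw [← h0]
  exact finsum_comp_equiv (Equiv.addRight s)

lemma sum_add (hφ : IsCutoff A φ L) (F : Grid → ℝ) (hF : ∀ j, Far φ j → F j = 0) (k : Fin 2) :
    ∑ j ∈ A, F (j + stp k) = ∑ j ∈ A, F j :=
  hφ.sum_shift F hF _ fun i => (abs_stp_le k i).trans (by norm_num)

lemma sum_sub (hφ : IsCutoff A φ L) (F : Grid → ℝ) (hF : ∀ j, Far φ j → F j = 0) (k : Fin 2) :
    ∑ j ∈ A, F (j - stp k) = ∑ j ∈ A, F j := by
  simp only [sub_eq_add_neg]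
  exact hφ.sum_shift F hF _ fun i => by
    simpa using (abs_stp_le k i).trans (by norm_num : (1 : ℤ) ≤ 2)

/-- Differences of `φ` live where `chi φ` is `1`, and by the padding the neighbours of these sites
lie in `A`. Cutoff errors are thus bounded by unweighted sums over `A`. -/
lemma sum_chi_shift_le (hφ : IsCutoff A φ L) (f : Grid → ℝ) (hf : ∀ j, 0 ≤ f j) (s : Grid)
    (hs : ∀ k, |s k| ≤ 2) : ∑ j ∈ A, chi φ j * f (j + s) ≤ ∑ j ∈ A, f j := by
  classical
  have h1 : ∑ j ∈ A, chi φ j * f (j + s) = ∑ j ∈ A with ¬ Far φ j, f (j + s) := by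
    rw [Finset.sum_filter]
    refine Finset.sum_congr rfl fun j _ => ?_
    by_cases h : Far φ j
    · simp [h.chi_eq, h]
    · simp [chi_eq_one h, h]
  have h2 := Finset.sum_map (A.filter fun j => ¬ Far φ j) (addRightEmbedding s) f
  simp only [addRightEmbedding_apply] at h2
  rw [h1, ← h2]
  refine Finset.sum_le_sum_of_subset_of_nonneg (fun i hi => ?_) (fun j _ _ => hf j)
  simp only [Finset.mem_map, Finset.mem_filter, addRightEmbedding_apply] at hi
  obtain ⟨j, ⟨-, hj⟩, rfl⟩ := hi
  exact hφ.mem_of_not_far hj _ (by simpa using hs)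

lemma sum_chi_le (hφ : IsCutoff A φ L) (f : Grid → ℝ) (hf : ∀ j, 0 ≤ f j) :
    ∑ j ∈ A, chi φ j * f j ≤ ∑ j ∈ A, f j := by
  simpa using hφ.sum_chi_shift_le f hf 0 (by simp)

lemma sum_chi_add_le (hφ : IsCutoff A φ L) (f : Grid → ℝ) (hf : ∀ j, 0 ≤ f j) (k : Fin 2) :
    ∑ j ∈ A, chi φ j * f (j + stp k) ≤ ∑ j ∈ A, f j :=
  hφ.sum_chi_shift_le f hf _ fun i => (abs_stp_le k i).trans (by norm_num)

end IsCutoff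

/-! ### The discrete Sobolev inequality -/

lemma abs_le_sum_abs_sub (f : ℤ → ℝ) (n : ℕ) (hf : ∀ i : ℤ, i ∉ Finset.Ico (-n : ℤ) n → f i = 0)
    (i : ℤ) : |f i| ≤ ∑ l ∈ Finset.Ico (-n - 1 : ℤ) n, |f (l + 1) - f l| := by
  by_cases hi : i ∈ Finset.Ico (-n : ℤ) n
  · rw [Finset.mem_Ico] at hi
    -- The telescoping sum starts one site to the left of the support.
    have h0 : f (-n - 1) = 0 := hf _ (by simp)
    have key : ∀ m : ℤ, -n - 1 ≤ m → f m = ∑ l ∈ Finset.Ico (-n - 1 : ℤ) m, (f (l + 1) - f l) := by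
      intro m hm
      induction m, hm using Int.leInduction with
      | base => simp [h0]
      | succ m hm ih =>
        have : Finset.Ico (-n - 1 : ℤ) (m + 1) = insert m (Finset.Ico (-n - 1 : ℤ) m) := by
          ext x; simp only [Finset.mem_Ico, Finset.mem_insert]; omega
        rw [this, Finset.sum_insert (by simp), ← ih]; ring
    rw [key i (by omega)]
    refine (Finset.abs_sum_le_sum_abs _ _).trans ?_
    refine Finset.sum_le_sum_of_subset_of_nonneg (fun x hx => ?_) (fun _ _ _ => abs_nonneg _)
    simp only [Finset.mem_Ico] at hx ⊢; omega
  · rw [hf i hi, abs_zero]; positivity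

lemma sum_piFinset_eq (I : Finset ℤ) (F : Grid → ℝ) :
    ∑ j ∈ Fintype.piFinset (fun _ : Fin 2 => I), F j = ∑ x ∈ I, ∑ y ∈ I, F ![x, y] := by
  rw [← Finset.sum_product']
  refine Finset.sum_nbij' (fun j => (j 0, j 1)) (fun p => ![p.1, p.2]) ?_ ?_ ?_ ?_ ?_
  · intro j hj; simp at hj; simp [hj]
  · intro p hp; simp at hp; simp [Fin.forall_fin_two, hp]
  · intro j _; ext k; fin_cases k <;> simp
  · intro p _; simp
  · intro j _; congr 1; ext k; fin_cases k <;> simp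

/-- The discrete version of the embedding `W^{1,1} ⊂ L²` in the plane. -/
lemma IsCutoff.sobolev {A : Finset Grid} {φ : Grid → ℝ} {L : ℝ} (hφ : IsCutoff A φ L)
    (f : Grid → ℝ) (hf : ∀ j, φ j = 0 → f j = 0) :
    ∑ j ∈ A, f j ^ 2 ≤ (∑ j ∈ A, |fd 0 f j|) * ∑ j ∈ A, |fd 1 f j| := by
  obtain ⟨n, hn⟩ : ∃ n : ℕ, ∀ j ∈ A, ∀ k, j k ∈ Finset.Ico (-n : ℤ) n := by
    refine ⟨A.sup (fun j => (j 0).natAbs + (j 1).natAbs) + 1, fun j hj k => ?_⟩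
    have h1 := Finset.le_sup (f := fun j : Grid => (j 0).natAbs + (j 1).natAbs) hj
    simp only [Finset.mem_Ico] at h1 ⊢
    have h2 : ∀ k : Fin 2, (j k).natAbs ≤ A.sup (fun j => (j 0).natAbs + (j 1).natAbs) := by
      rw [Fin.forall_fin_two]; constructor <;> omega
    have := h2 k
    omega
  set I : Finset ℤ := Finset.Ico (-n - 1 : ℤ) n with hI
  have hAI : ∀ j ∈ A, j ∈ Fintype.piFinset (fun _ : Fin 2 => I) := by
    intro j hj
    rw [Fintype.mem_piFinset]
    intro k
    have := hn j hj k
    simp only [hI, Finset.mem_Ico] at this ⊢; omega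
  have hbox : ∀ F : Grid → ℝ, (∀ j, Far φ j → F j = 0) →
      ∑ j ∈ A, F j = ∑ x ∈ I, ∑ y ∈ I, F ![x, y] := by
    intro F hF
    rw [← sum_piFinset_eq]
    refine Finset.sum_subset hAI fun j _ hj => hF j ?_
    by_contra h
    exact hj (hφ.mem_of_not_far h j (by simp))
  have hfz : ∀ j : Grid, j ∉ A → f j = 0 := by
    intro j hj
    refine hf j ?_
    by_contra h
    exact hj (hφ.pad j h j (by simp))
  have h0 : ∀ x y : ℤ, |f ![x, y]| ≤ ∑ l ∈ I, |fd 0 f ![l, y]| := by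
    intro x y
    have := abs_le_sum_abs_sub (fun l => f ![l, y]) n (fun i hi => hfz _ fun h => hi (hn _ h 0)) x
    refine this.trans_eq (Finset.sum_congr rfl fun l _ => ?_)
    have : (![l, y] + stp 0 : Grid) = ![l + 1, y] := by
      ext k; fin_cases k <;> simp [stp]
    simp [fd, this]
  have h1 : ∀ x y : ℤ, |f ![x, y]| ≤ ∑ l ∈ I, |fd 1 f ![x, l]| := by
    intro x y
    have := abs_le_sum_abs_sub (fun l => f ![x, l]) n (fun i hi => hfz _ fun h => hi (hn _ h 1)) y
    refine this.trans_eq (Finset.sum_congr rfl fun l _ => ?_)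
    have : (![x, l] + stp 1 : Grid) = ![x, l + 1] := by
      ext k; fin_cases k <;> simp [stp]
    simp [fd, this]
  rw [hbox (fun j => f j ^ 2) (fun j h => by simp [hf j h.self]),
    hbox (fun j => |fd 0 f j|) (fun j h => by simp [fd, hf j h.self, hf _ (h.add 0)]),
    hbox (fun j => |fd 1 f j|) (fun j h => by simp [fd, hf j h.self, hf _ (h.add 1)])]
  -- The square at `(x, y)` is at most a sum depending only on `y` times a sum depending only on
  -- `x`, so the double sum factorises.
  calc ∑ x ∈ I, ∑ y ∈ I, f ![x, y] ^ 2
      ≤ ∑ x ∈ I, ∑ y ∈ I, (∑ l ∈ I, |fd 0 f ![l, y]|) * ∑ l ∈ I, |fd 1 f ![x, l]| := by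
        refine Finset.sum_le_sum fun x _ => Finset.sum_le_sum fun y _ => ?_
        rw [← sq_abs, sq]
        exact mul_le_mul (h0 x y) (h1 x y) (abs_nonneg _) (by positivity)
    _ = (∑ x ∈ I, ∑ y ∈ I, |fd 0 f ![x, y]|) * ∑ x ∈ I, ∑ y ∈ I, |fd 1 f ![x, y]| := by
        rw [Finset.sum_comm (f := fun x y => |fd 0 f ![x, y]|), Finset.sum_mul_sum,
          Finset.sum_comm]

end DiscreteLLG

namespace DiscreteLLG

open Filter Topology

/-! ### The geometry of the target hypersurface -/

/-- Bounds, with one constant `c`, for the unit normal field `ν` along `N`. -/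
structure NormalBounds (N : Set Space) (ν : Space → Space) (c : ℝ) : Prop where
  one_le : 1 ≤ c
  dist_le : ∀ p ∈ N, ∀ q ∈ N, ‖p - q‖ ≤ c
  unit : ∀ p ∈ N, ‖ν p‖ = 1
  continuousOn : ContinuousOn ν N
  lip : ∀ p ∈ N, ∀ q ∈ N, ‖ν p - ν q‖ ≤ c * ‖p - q‖
  quad : ∀ p ∈ N, ∀ q ∈ N, |inner ℝ (ν p) (q - p)| ≤ c * ‖q - p‖ ^ 2
  hasDeriv : ∀ (u : ℝ → Space) (v : Space) (t : ℝ), HasDerivAt u v t →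
    (∀ᶠ s in 𝓝 t, u s ∈ N) → ∃ n' : Space, HasDerivAt (fun s => ν (u s)) n' t ∧ ‖n'‖ ≤ c * ‖v‖

variable {N : Set Space} {ν : Space → Space}

/-- Being unit and orthogonal to the tangent plane, `ν` is plus or minus the normalized gradient of
`g`. This yields an extension of `ν` that is smooth on a full neighbourhood of `p`. -/
lemma IsLocalEquation.exists_normal_eq {U : Set Space} {g : Space → ℝ}
    (hg : IsLocalEquation N U g) (hνc : ContinuousOn ν N) (hν1 : ∀ p ∈ N, ‖ν p‖ = 1)
    (hν : ∀ q ∈ N ∩ U, ∀ v : Space, fderiv ℝ g q v = 0 → inner ℝ (ν q) v = 0)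
    {p : Space} (hp : p ∈ N) (hpU : p ∈ U) :
    ∃ κ : Space → ℝ, ContDiffAt ℝ ∞ κ p ∧ ∀ᶠ q in 𝓝 p, q ∈ N →
      ν q = κ q • (InnerProductSpace.toDual ℝ Space).symm (fderiv ℝ g q) := by
  set G : Space → Space := fun q => (InnerProductSpace.toDual ℝ Space).symm (fderiv ℝ g q) with hG
  have hGi : ∀ q v, inner ℝ (G q) v = fderiv ℝ g q v := fun q v => by
    simp [hG]
  have hG0 : ∀ q ∈ U, G q ≠ 0 := fun q hq h => hg.regular q hq (by
    ext v; rw [← hGi, h]; simp)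
  have hUn : ∀ q ∈ U, U ∈ 𝓝 q := fun q hq => hg.isOpen.mem_nhds hq
  have hGs : ∀ q ∈ U, ContDiffAt ℝ ∞ G q := fun q hq => by
    have h1 : ContDiffAt ℝ ∞ (fderiv ℝ g) q :=
      (hg.smooth.contDiffAt (hUn q hq)).fderiv_right (by simp)
    exact (InnerProductSpace.toDual ℝ Space).symm.toContinuousLinearEquiv.contDiff.contDiffAt.comp
      q h1
  set F : Space → Space := fun q => ‖G q‖⁻¹ • G q with hF
  have hFs : ∀ q ∈ U, ContDiffAt ℝ ∞ (fun q => ‖G q‖⁻¹) q := fun q hq =>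
    ((hGs q hq).norm ℝ (hG0 q hq)).inv (norm_ne_zero_iff.2 (hG0 q hq))
  have hFu : ∀ q ∈ U, ‖F q‖ = 1 := fun q hq => by
    simp [hF, norm_smul, norm_ne_zero_iff.2 (hG0 q hq)]
  have hspan : ∀ q ∈ N, q ∈ U → ν q = inner ℝ (F q) (ν q) • F q := by
    intro q hq hqU
    set v := ν q - inner ℝ (F q) (ν q) • F q with hv
    have h1 : inner ℝ (F q) v = 0 := by
      rw [hv, inner_sub_right, inner_smul_right, real_inner_self_eq_norm_sq, hFu q hqU]; simp
    have h2 : fderiv ℝ g q v = 0 := by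
      rw [← hGi]
      have : G q = ‖G q‖ • F q := by
        simp [hF, smul_smul, norm_ne_zero_iff.2 (hG0 q hqU)]
      rw [this, inner_smul_left, h1]; simp
    have h3 := hν q ⟨hq, hqU⟩ v h2
    have h4 : inner ℝ v v = 0 := by
      nth_rewrite 1 [hv]
      rw [inner_sub_left, inner_smul_left, h1, h3]; simp
    have h5 : v = 0 := inner_self_eq_zero.1 h4
    exact sub_eq_zero.1 h5
  have habs : ∀ q ∈ N, q ∈ U → |inner ℝ (F q) (ν q)| = 1 := by
    intro q hq hqU
    have h := congrArg norm (hspan q hq hqU)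
    rw [norm_smul, hFu q hqU, hν1 q hq, mul_one, Real.norm_eq_abs] at h
    exact h.symm
  set a := inner ℝ (F p) (ν p) with ha
  have hcont : ContinuousWithinAt (fun q => inner ℝ (F q) (ν q)) N p := by
    refine ContinuousWithinAt.inner ?_ (hνc p hp)
    exact (((hFs p hpU).continuousAt).smul (hGs p hpU).continuousAt).continuousWithinAt
  -- The sign is continuous on `N` and takes only the values `1` and `-1`; being within `1` of its
  -- value at `p` makes it equal to that value.
  have hsign : ∀ᶠ q in 𝓝 p, q ∈ N → inner ℝ (F q) (ν q) = a := by
    have h1 : ∀ᶠ q in 𝓝[N] p, |inner ℝ (F q) (ν q) - a| < 1 := by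
      have := (Metric.tendsto_nhds.1 hcont.tendsto) 1 one_pos
      simpa [Real.dist_eq] using this
    rw [eventually_nhdsWithin_iff] at h1
    filter_upwards [h1, hUn p hpU] with q hq hqU hqN
    have h2 := habs q hqN hqU
    have h3 := habs p hp hpU
    have h4 := hq hqN
    rw [← ha] at h3
    rcases eq_or_eq_neg_of_abs_eq h2 with h2 | h2 <;> rcases eq_or_eq_neg_of_abs_eq h3 with h3 | h3 <;>
      rw [h2, h3] at h4 ⊢ <;> norm_num at h4
  refine ⟨fun q => a * ‖G q‖⁻¹, contDiffAt_const.mul (hFs p hpU), ?_⟩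
  filter_upwards [hsign, hUn p hpU] with q hq hqU hqN
  rw [mul_smul]
  change ν q = a • F q
  rw [← hq hqN]
  exact hspan q hqN hqU

/-- The Lipschitz bound comes from a smooth extension of `ν`. The quadratic bound is Taylor's
formula for the local equation, which vanishes at both points. The extension itself is kept for
differentiating `ν` along curves in `N`. -/
lemma IsCompactHypersurface.exists_local_bounds (hN : IsCompactHypersurface N ν) {p : Space}
    (hp : p ∈ N) : ∃ c r : ℝ, 0 < r ∧ (∀ q ∈ N, dist q p < r → ∀ q' ∈ N, dist q' p < r →
      ‖ν q - ν q'‖ ≤ c * ‖q - q'‖ ∧ |inner ℝ (ν q) (q' - q)| ≤ c * ‖q' - q‖ ^ 2) ∧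
      ∃ F : Space → Space, DifferentiableAt ℝ F p ∧ ∀ᶠ q in 𝓝 p, q ∈ N → ν q = F q := by
  obtain ⟨U, g, hpU, hg, hν⟩ := hN.exists_local p hp
  obtain ⟨κ, hκ, hev⟩ := hg.exists_normal_eq hN.continuousOn_normal hN.norm_normal hν hp hpU
  have hUn : U ∈ 𝓝 p := hg.isOpen.mem_nhds hpU
  have h1 : ContDiffAt ℝ ∞ (fderiv ℝ g) p :=
    (hg.smooth.contDiffAt hUn).fderiv_right (by simp)
  have hFs : ContDiffAt ℝ ∞
      (fun q => κ q • (InnerProductSpace.toDual ℝ Space).symm (fderiv ℝ g q)) p :=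
    hκ.smul ((InnerProductSpace.toDual ℝ Space).symm.toContinuousLinearEquiv.contDiff.contDiffAt.comp
      p h1)
  set F : Space → Space :=
    fun q => κ q • (InnerProductSpace.toDual ℝ Space).symm (fderiv ℝ g q) with hF
  obtain ⟨K₁, t₁, ht₁, hl₁⟩ := (hFs.of_le (m := 1) (by simp)).exists_lipschitzOnWith
  obtain ⟨K₂, t₂, ht₂, hl₂⟩ := (h1.of_le (m := 1) (by simp)).exists_lipschitzOnWith
  have hκb : ∀ᶠ q in 𝓝 p, |κ q| < |κ p| + 1 :=
    (hκ.continuousAt.abs).eventually_lt continuousAt_const (by simp)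
  obtain ⟨r, hr, hball⟩ := Metric.eventually_nhds_iff.1
    ((((hev.and hUn).and ht₁).and ht₂).and hκb)
  refine ⟨max K₁ ((|κ p| + 1) * K₂), r, hr, ?_, F, (hFs.differentiableAt (by simp)), hev⟩
  intro q hq hqr q' hq' hqr'
  obtain ⟨⟨⟨⟨a1, a2⟩, a3⟩, a4⟩, a5⟩ := hball hqr
  obtain ⟨⟨⟨⟨b1, b2⟩, b3⟩, b4⟩, b5⟩ := hball hqr'
  constructor
  · rw [a1 hq, b1 hq']
    have := hl₁.dist_le_mul q a3 q' b3
    rw [dist_eq_norm, dist_eq_norm] at this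
    exact this.trans (mul_le_mul_of_nonneg_right (le_max_left _ _) (norm_nonneg _))
  -- The chord leaves `N`, but it stays in the ball where `g` is defined, and only `g` is evaluated
  -- on it.
  · have hseg : ∀ x ∈ segment ℝ q q', dist x p < r := by
      intro x hx
      exact (convex_ball p r).segment_subset (Metric.mem_ball.2 hqr) (Metric.mem_ball.2 hqr') hx
    have hdiff : ∀ x ∈ segment ℝ q q',
        HasFDerivWithinAt g (fderiv ℝ g x) (segment ℝ q q') x := by
      intro x hx
      obtain ⟨⟨⟨⟨-, h2⟩, -⟩, -⟩, -⟩ := hball (hseg x hx)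
      exact ((hg.smooth.contDiffAt (hg.isOpen.mem_nhds h2)).differentiableAt
        (by simp)).hasFDerivAt.hasFDerivWithinAt
    have hbound : ∀ x ∈ segment ℝ q q', ‖fderiv ℝ g x - fderiv ℝ g q‖ ≤ K₂ * ‖q' - q‖ := by
      intro x hx
      obtain ⟨⟨-, h4⟩, -⟩ := hball (hseg x hx)
      have h5 := hl₂.dist_le_mul x h4 q a4
      rw [dist_eq_norm, dist_eq_norm] at h5
      refine h5.trans (mul_le_mul_of_nonneg_left ?_ K₂.2)
      rw [segment_eq_image'] at hx
      obtain ⟨θ, ⟨hθ0, hθ1⟩, rfl⟩ := hx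
      rw [add_sub_cancel_left, norm_smul, Real.norm_of_nonneg hθ0]
      exact mul_le_of_le_one_left (norm_nonneg _) hθ1
    have key := (convex_segment q q').norm_image_sub_le_of_norm_hasFDerivWithin_le' hdiff hbound
      (left_mem_segment ℝ q q') (right_mem_segment ℝ q q')
    rw [(hg.zero_iff q a2).1 hq, (hg.zero_iff q' b2).1 hq', sub_zero, zero_sub, norm_neg,
      Real.norm_eq_abs] at key
    have h6 : inner ℝ (ν q) (q' - q) = κ q * fderiv ℝ g q (q' - q) := by
      rw [a1 hq, inner_smul_left]; simp
    rw [h6, abs_mul]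
    have h7 : |κ q| * |fderiv ℝ g q (q' - q)| ≤ (|κ p| + 1) * (K₂ * ‖q' - q‖ * ‖q' - q‖) :=
      mul_le_mul a5.le key (abs_nonneg _) (by positivity)
    have h8 := mul_le_mul_of_nonneg_right (le_max_right (K₁ : ℝ) ((|κ p| + 1) * K₂))
      (sq_nonneg ‖q' - q‖)
    nlinarith [h7, h8]

/-- In the compactness induction only the first point is confined to `S`, so that the property
passes to unions; halving the local radius keeps the second point in the local ball. -/
lemma IsCompactHypersurface.exists_uniform_bounds (hN : IsCompactHypersurface N ν) :
    ∃ c r : ℝ, 0 < r ∧ ∀ q ∈ N, ∀ q' ∈ N, dist q q' < r →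
      ‖ν q - ν q'‖ ≤ c * ‖q - q'‖ ∧ |inner ℝ (ν q) (q' - q)| ≤ c * ‖q' - q‖ ^ 2 := by
  refine hN.isCompact.induction_on (p := fun S => ∃ c r : ℝ, 0 < r ∧ ∀ q ∈ S, ∀ q' ∈ N,
    dist q q' < r → ‖ν q - ν q'‖ ≤ c * ‖q - q'‖ ∧ |inner ℝ (ν q) (q' - q)| ≤ c * ‖q' - q‖ ^ 2)
    ⟨0, 1, one_pos, by simp⟩ ?_ ?_ ?_
  · rintro s t hst ⟨c, r, hr, h⟩
    exact ⟨c, r, hr, fun q hq => h q (hst hq)⟩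
  · rintro s t ⟨c, r, hr, h⟩ ⟨c', r', hr', h'⟩
    refine ⟨max c c', min r r', lt_min hr hr', fun q hq q' hq' hd => ?_⟩
    rcases hq with hq | hq
    · obtain ⟨h1, h2⟩ := h q hq q' hq' (hd.trans_le (min_le_left _ _))
      exact ⟨h1.trans (mul_le_mul_of_nonneg_right (le_max_left _ _) (norm_nonneg _)),
        h2.trans (mul_le_mul_of_nonneg_right (le_max_left _ _) (sq_nonneg _))⟩
    · obtain ⟨h1, h2⟩ := h' q hq q' hq' (hd.trans_le (min_le_right _ _))
      exact ⟨h1.trans (mul_le_mul_of_nonneg_right (le_max_right _ _) (norm_nonneg _)),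
        h2.trans (mul_le_mul_of_nonneg_right (le_max_right _ _) (sq_nonneg _))⟩
  · intro p hp
    obtain ⟨c, r, hr, h, -⟩ := hN.exists_local_bounds hp
    refine ⟨N ∩ Metric.ball p (r / 2), ?_, c, r / 2, half_pos hr, ?_⟩
    · exact inter_mem self_mem_nhdsWithin
        (mem_nhdsWithin_of_mem_nhds (Metric.ball_mem_nhds p (half_pos hr)))
    · rintro q ⟨hq, hqp⟩ q' hq' hd
      rw [Metric.mem_ball] at hqp
      refine h q hq (by linarith) q' hq' ?_
      have := dist_triangle_left q' p q
      linarith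

lemma IsCompactHypersurface.exists_normalBounds (hN : IsCompactHypersurface N ν) :
    ∃ c : ℝ, NormalBounds N ν c := by
  obtain ⟨c₀, r, hr, hloc⟩ := hN.exists_uniform_bounds
  obtain ⟨M, hM⟩ := hN.isCompact.isBounded.subset_closedBall 0
  set c := max (max 1 (2 * M)) (max c₀ (2 / r)) with hc
  have hc1 : 1 ≤ c := (le_max_left _ _).trans (le_max_left _ _)
  have hcM : 2 * M ≤ c := (le_max_right _ _).trans (le_max_left _ _)
  have hc0 : c₀ ≤ c := (le_max_left _ _).trans (le_max_right _ _)
  have hcr : 2 / r ≤ c := (le_max_right _ _).trans (le_max_right _ _)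
  have hlip : ∀ p ∈ N, ∀ q ∈ N, ‖ν p - ν q‖ ≤ c * ‖p - q‖ := by
    intro p hp q hq
    by_cases h : dist p q < r
    · exact (hloc p hp q hq h).1.trans (mul_le_mul_of_nonneg_right hc0 (norm_nonneg _))
    -- For points at distance at least `r`, two unit vectors differ by at most `2 ≤ (2 / r) * ‖p -
    -- q‖`.
    · rw [dist_eq_norm, not_lt] at h
      have h1 := norm_sub_le (ν p) (ν q)
      rw [hN.norm_normal p hp, hN.norm_normal q hq] at h1
      have h2 : (2 : ℝ) = 2 / r * r := by field_simp
      have h3 := mul_le_mul hcr h hr.le (by linarith)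
      linarith
  refine ⟨c, hc1, ?_, hN.norm_normal, hN.continuousOn_normal, hlip, ?_, ?_⟩
  · intro p hp q hq
    have h1 := hM hp
    have h2 := hM hq
    rw [mem_closedBall_zero_iff] at h1 h2
    linarith [norm_sub_le p q]
  · intro p hp q hq
    by_cases h : dist p q < r
    · exact (hloc p hp q hq h).2.trans (mul_le_mul_of_nonneg_right hc0 (sq_nonneg _))
    · rw [dist_comm, dist_eq_norm, not_lt] at h
      have h1 := abs_real_inner_le_norm (ν p) (q - p)
      rw [hN.norm_normal p hp, one_mul] at h1
      have h2 : (2 : ℝ) = 2 / r * r := by field_simp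
      have h3 := mul_le_mul hcr h hr.le (by linarith)
      nlinarith [norm_nonneg (q - p)]
  · intro u v t hu hmem
    obtain ⟨-, -, -, -, F, hF, hev⟩ := hN.exists_local_bounds (hmem.self_of_nhds)
    have h1 : HasDerivAt (fun s => F (u s)) (fderiv ℝ F (u t) v) t :=
      hF.hasFDerivAt.comp_hasDerivAt t hu
    have h2 : (fun s => ν (u s)) =ᶠ[𝓝 t] fun s => F (u s) := by
      filter_upwards [hmem, hu.continuousAt.eventually hev] with s hs hs'
      exact hs' hs
    have h3 := h1.congr_of_eventuallyEq h2
    refine ⟨_, h3, ?_⟩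
    -- The derivative of the local extension carries no uniform bound; the Lipschitz bound along `N`
    -- is passed to the limit in difference quotients instead.
    have h4 := (hasDerivAt_iff_tendsto_slope.1 h3).norm
    have h5 := ((hasDerivAt_iff_tendsto_slope.1 hu).norm).const_mul c
    refine le_of_tendsto_of_tendsto h4 h5 ?_
    have h6 : ∀ᶠ s in 𝓝[≠] t, u s ∈ N := hmem.filter_mono nhdsWithin_le_nhds
    filter_upwards [h6] with s hs
    rw [slope_def_module, slope_def_module, norm_smul, norm_smul, mul_left_comm]
    exact mul_le_mul_of_nonneg_left (hlip _ hs _ hmem.self_of_nhds) (norm_nonneg _)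

end DiscreteLLG

namespace DiscreteLLG

open Filter Topology

/-! ### The vector product -/

lemma inner_eq_three (a b : Space) : inner ℝ a b = a 0 * b 0 + a 1 * b 1 + a 2 * b 2 := by
  simp [PiLp.inner_apply, Fin.sum_univ_three, mul_comm]

lemma norm_sq_eq_three (a : Space) : ‖a‖ ^ 2 = a 0 ^ 2 + a 1 ^ 2 + a 2 ^ 2 := by
  rw [← real_inner_self_eq_norm_sq, inner_eq_three]; ring

@[simp] lemma cross_zero_coord (a b : Space) : cross a b 0 = a 1 * b 2 - a 2 * b 1 := by
  simp [cross, crossProduct]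

@[simp] lemma cross_one_coord (a b : Space) : cross a b 1 = a 2 * b 0 - a 0 * b 2 := by
  simp [cross, crossProduct]

@[simp] lemma cross_two_coord (a b : Space) : cross a b 2 = a 0 * b 1 - a 1 * b 0 := by
  simp [cross, crossProduct]

lemma inner_cross_self_left (a b : Space) : inner ℝ (cross a b) a = 0 := by
  simp only [inner_eq_three, cross_zero_coord, cross_one_coord, cross_two_coord]; ring

lemma inner_cross_self_right (a b : Space) : inner ℝ (cross a b) b = 0 := by
  simp only [inner_eq_three, cross_zero_coord, cross_one_coord, cross_two_coord]; ring

lemma inner_cross_rotate (a b d : Space) : inner ℝ a (cross b d) = inner ℝ (cross a b) d := by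
  simp only [inner_eq_three, cross_zero_coord, cross_one_coord, cross_two_coord]; ring

lemma norm_cross_sq (a b : Space) :
    ‖cross a b‖ ^ 2 = ‖a‖ ^ 2 * ‖b‖ ^ 2 - inner ℝ a b ^ 2 := by
  simp only [norm_sq_eq_three, inner_eq_three, cross_zero_coord, cross_one_coord, cross_two_coord]
  ring

lemma norm_cross_le (a b : Space) : ‖cross a b‖ ≤ ‖a‖ * ‖b‖ := by
  refine (sq_le_sq₀ (norm_nonneg _) (by positivity)).1 ?_
  rw [norm_cross_sq, mul_pow]
  linarith [sq_nonneg (inner ℝ a b : ℝ)]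

lemma abs_inner_cross_le (a b d : Space) : |inner ℝ a (cross b d)| ≤ ‖a‖ * ‖b‖ * ‖d‖ := by
  refine (abs_real_inner_le_norm _ _).trans ?_
  rw [mul_assoc]
  exact mul_le_mul_of_nonneg_left (norm_cross_le b d) (norm_nonneg a)

lemma isBoundedBilinearMap_cross :
    IsBoundedBilinearMap ℝ (fun p : Space × Space => cross p.1 p.2) where
  add_left a b d := by simp [cross]
  smul_left r a b := by simp [cross]
  add_right a b d := by simp [cross]
  smul_right r a b := by simp [cross]
  bound := ⟨1, one_pos, fun a b => by simpa using norm_cross_le a b⟩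

lemma _root_.HasDerivAt.cross {f g : ℝ → Space} {f' g' : Space} {t : ℝ} (hf : HasDerivAt f f' t)
    (hg : HasDerivAt g g' t) :
    HasDerivAt (fun s => DiscreteLLG.cross (f s) (g s))
      (DiscreteLLG.cross (f t) g' + DiscreteLLG.cross f' (g t)) t := by
  have := (isBoundedBilinearMap_cross.hasFDerivAt (f t, g t)).comp_hasDerivAt t (hf.prodMk hg)
  exact this.congr_deriv (by simp)

lemma continuous_cross : Continuous (fun p : Space × Space => cross p.1 p.2) :=
  isBoundedBilinearMap_cross.continuous

/-! ### The vector field with unit mesh size -/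

/-- The Laplacian with unit mesh size. -/
noncomputable def lap (u : GridFun) (j : Grid) : Space :=
  ∑ k : Fin 2, (fd k u j - fd k u (j - stp k))

/-- The sum of the squares of the four differences at a site. -/
noncomputable def en (u : GridFun) (j : Grid) : ℝ :=
  ∑ k : Fin 2, (‖fd k u j‖ ^ 2 + ‖fd k u (j - stp k)‖ ^ 2)

/-- The right-hand side of the system with unit mesh size. -/
noncomputable def fld (ν : Space → Space) (α : ℝ) (u : GridFun) (j : Grid) : Space :=
  cross (ν (u j)) (lap u j) + α • (lap u j - inner ℝ (lap u j) (ν (u j)) • ν (u j))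

lemma en_nonneg (u : GridFun) (j : Grid) : 0 ≤ en u j := by
  unfold en; positivity

lemma norm_fd_sq_le_en (u : GridFun) (j : Grid) (k : Fin 2) : ‖fd k u j‖ ^ 2 ≤ en u j := by
  unfold en
  refine le_trans ?_ (Finset.single_le_sum (f := fun k : Fin 2 =>
    ‖fd k u j‖ ^ 2 + ‖fd k u (j - stp k)‖ ^ 2) (fun _ _ => by positivity) (Finset.mem_univ k))
  linarith [sq_nonneg ‖fd k u (j - stp k)‖]

lemma norm_sub_sq_le_two_mul (a b : Space) : ‖a - b‖ ^ 2 ≤ 2 * (‖a‖ ^ 2 + ‖b‖ ^ 2) := by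
  have := norm_sub_le a b
  have h := pow_le_pow_left₀ (norm_nonneg _) this 2
  nlinarith [sq_nonneg (‖a‖ - ‖b‖)]

lemma norm_add_sq_le_two_mul (a b : Space) : ‖a + b‖ ^ 2 ≤ 2 * (‖a‖ ^ 2 + ‖b‖ ^ 2) := by
  simpa using norm_sub_sq_le_two_mul a (-b)

lemma norm_lap_sq_le (u : GridFun) (j : Grid) : ‖lap u j‖ ^ 2 ≤ 4 * en u j := by
  simp only [lap, en, Fin.sum_univ_two]
  have h := norm_add_sq_le_two_mul (fd 0 u j - fd 0 u (j - stp 0)) (fd 1 u j - fd 1 u (j - stp 1))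
  have h0 := norm_sub_sq_le_two_mul (fd 0 u j) (fd 0 u (j - stp 0))
  have h1 := norm_sub_sq_le_two_mul (fd 1 u j) (fd 1 u (j - stp 1))
  linarith

section Algebra

variable {n D v : Space} {α : ℝ}

lemma inner_field_normal (hn : ‖n‖ = 1) (hv : v = cross n D + α • (D - inner ℝ D n • n)) :
    inner ℝ v n = 0 := by
  rw [hv, inner_add_left, inner_cross_self_left, inner_smul_left, inner_sub_left, inner_smul_left,
    real_inner_self_eq_norm_sq, hn]
  simp

/-- The rotated vector and the tangential projection of `D` are orthogonal and have the same length.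
-/
lemma norm_field_sq (hn : ‖n‖ = 1) (hv : v = cross n D + α • (D - inner ℝ D n • n)) :
    ‖v‖ ^ 2 = (1 + α ^ 2) * (‖D‖ ^ 2 - inner ℝ D n ^ 2) := by
  have h1 : ‖D - inner ℝ D n • n‖ ^ 2 = ‖D‖ ^ 2 - inner ℝ D n ^ 2 := by
    rw [norm_sub_sq_real, inner_smul_right, norm_smul, hn, Real.norm_eq_abs, mul_one, sq_abs]; ring
  have h2 : inner ℝ (cross n D) (D - inner ℝ D n • n) = 0 := by
    rw [inner_sub_right, inner_smul_right, inner_cross_self_left, inner_cross_self_right]; simp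
  rw [hv, norm_add_sq_real, inner_smul_right, h2, norm_smul, mul_pow, h1, norm_cross_sq, hn,
    Real.norm_eq_abs, sq_abs, real_inner_comm D n]
  ring

/-- The precession part does no work against `D`; the damping part alone yields the dissipation. -/
lemma inner_field_laplacian (hn : ‖n‖ = 1) (hv : v = cross n D + α • (D - inner ℝ D n • n)) :
    inner ℝ v D = α / (1 + α ^ 2) * ‖v‖ ^ 2 := by
  rw [norm_field_sq hn hv]
  have : (1 + α ^ 2) ≠ 0 := by positivity
  field_simp
  rw [hv, inner_add_left, inner_cross_self_right, inner_smul_left, inner_sub_left, inner_smul_left,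
    real_inner_self_eq_norm_sq, real_inner_comm D n]
  simp only [conj_trivial]
  ring

end Algebra

variable {N : Set Space} {ν : Space → Space} {c α : ℝ} {u : GridFun}

/-- The Laplacian is a sum of secants from `u j`, each of which is normal only to second order. This
replaces the second fundamental form term of the continuous equation. -/
lemma NormalBounds.abs_inner_lap_le (hb : NormalBounds N ν c) (hu : ∀ j, u j ∈ N) (j : Grid) :
    |inner ℝ (lap u j) (ν (u j))| ≤ c * en u j := by
  have key : ∀ i, |inner ℝ (ν (u j)) (u i - u j)| ≤ c * ‖u i - u j‖ ^ 2 := fun i =>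
    hb.quad _ (hu j) _ (hu i)
  have h2 : lap u j = ∑ k : Fin 2, ((u (j + stp k) - u j) + (u (j - stp k) - u j)) := by
    simp only [lap, fd]
    refine Finset.sum_congr rfl fun k _ => ?_
    rw [sub_add_cancel]; abel
  have h3 : en u j = ∑ k : Fin 2, (‖u (j + stp k) - u j‖ ^ 2 + ‖u (j - stp k) - u j‖ ^ 2) := by
    simp only [en, fd]
    refine Finset.sum_congr rfl fun k _ => ?_
    rw [sub_add_cancel, norm_sub_rev (u j)]
  rw [real_inner_comm, h2, h3, inner_sum, Finset.mul_sum]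
  refine (Finset.abs_sum_le_sum_abs _ _).trans (Finset.sum_le_sum fun k _ => ?_)
  rw [inner_add_right]
  refine (abs_add_le _ _).trans ?_
  rw [mul_add]
  exact add_le_add (key _) (key _)

lemma NormalBounds.en_le (hb : NormalBounds N ν c) (hu : ∀ j, u j ∈ N) (j : Grid) :
    en u j ≤ 4 * c ^ 2 := by
  have key : ∀ i k, ‖fd k u i‖ ^ 2 ≤ c ^ 2 := fun i k =>
    pow_le_pow_left₀ (norm_nonneg _) (hb.dist_le _ (hu _) _ (hu _)) 2
  simp only [en, Fin.sum_univ_two]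
  linarith [key j 0, key j 1, key (j - stp 0) 0, key (j - stp 1) 1]

lemma NormalBounds.norm_fld_sq_le (hb : NormalBounds N ν c) (hu : ∀ j, u j ∈ N) (j : Grid) :
    ‖fld ν α u j‖ ^ 2 ≤ 4 * (1 + α ^ 2) * en u j := by
  rw [norm_field_sq (α := α) (hb.unit _ (hu j)) (rfl : fld ν α u j = _)]
  have h1 := norm_lap_sq_le u j
  have h2 := mul_le_mul_of_nonneg_left
    (show ‖lap u j‖ ^ 2 - inner ℝ (lap u j) (ν (u j)) ^ 2 ≤ 4 * en u j by
      linarith [sq_nonneg (inner ℝ (lap u j) (ν (u j)) : ℝ)]) (show 0 ≤ 1 + α ^ 2 by positivity)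
  linarith

/-- The tangential part of the Laplacian is no longer than the velocity because `1 ≤ 1 + α ^ 2`; the
normal part is quadratic in the first differences. -/
lemma NormalBounds.norm_lap_sq_le_fld (hb : NormalBounds N ν c) (hu : ∀ j, u j ∈ N) (j : Grid) :
    ‖lap u j‖ ^ 2 ≤ ‖fld ν α u j‖ ^ 2 + c ^ 2 * en u j ^ 2 := by
  have h := norm_field_sq (α := α) (hb.unit _ (hu j)) (rfl : fld ν α u j = _)
  have h1 := pow_le_pow_left₀ (abs_nonneg _) (hb.abs_inner_lap_le hu j) 2
  rw [sq_abs, mul_pow] at h1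
  have h2 := abs_real_inner_le_norm (lap u j) (ν (u j))
  rw [hb.unit _ (hu j), mul_one] at h2
  have h3 := pow_le_pow_left₀ (abs_nonneg _) h2 2
  rw [sq_abs] at h3
  nlinarith [mul_nonneg (sq_nonneg α) (sub_nonneg.2 h3)]

end DiscreteLLG

namespace DiscreteLLG

open Filter Topology

/-! ### Discrete Ladyzhenskaya inequalities and the second order estimate -/

/-- The pure second difference in direction `k`. -/
noncomputable def pureDiff (k : Fin 2) (u : GridFun) (j : Grid) : Space :=
  fd k u j - fd k u (j - stp k)

/-- The sum of the squares of the second differences at a site. -/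
noncomputable def hess (u : GridFun) (j : Grid) : ℝ :=
  ‖pureDiff 0 u j‖ ^ 2 + ‖pureDiff 1 u j‖ ^ 2 + 2 * ‖fd 1 (fd 0 u) j‖ ^ 2

lemma hess_nonneg (u : GridFun) (j : Grid) : 0 ≤ hess u j := by
  unfold hess; positivity

lemma lap_eq_pureDiff (u : GridFun) (j : Grid) : lap u j = pureDiff 0 u j + pureDiff 1 u j := by
  rw [lap, Fin.sum_univ_two]; rfl

lemma fd_comm {X : Type*} [AddCommGroup X] (k l : Fin 2) (f : Grid → X) :
    fd k (fd l f) = fd l (fd k f) := by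
  ext j
  simp only [fd, add_right_comm j (stp k) (stp l)]
  abel

lemma fd_fd_self (k : Fin 2) (u : GridFun) (j : Grid) :
    fd k (fd k u) j = pureDiff k u (j + stp k) := by
  simp [fd, pureDiff]

lemma norm_pureDiff_sq_le (k : Fin 2) (u : GridFun) (j : Grid) :
    ‖pureDiff k u j‖ ^ 2 ≤ 2 * en u j := by
  have h := norm_sub_sq_le_two_mul (fd k u j) (fd k u (j - stp k))
  have h2 : ‖fd k u j‖ ^ 2 + ‖fd k u (j - stp k)‖ ^ 2 ≤ en u j :=
    Finset.single_le_sum (f := fun k : Fin 2 => ‖fd k u j‖ ^ 2 + ‖fd k u (j - stp k)‖ ^ 2)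
      (fun _ _ => by positivity) (Finset.mem_univ k)
  exact h.trans (by linarith)

lemma abs_norm_sq_sub_norm_sq_le (a b : Space) :
    |‖a‖ ^ 2 - ‖b‖ ^ 2| ≤ ‖a - b‖ * (‖b‖ + ‖a‖) := by
  rw [sq_sub_sq, abs_mul, mul_comm, abs_of_nonneg (by positivity : 0 ≤ ‖a‖ + ‖b‖), add_comm ‖b‖]
  exact mul_le_mul_of_nonneg_right (abs_norm_sub_norm_le a b) (by positivity)

namespace IsCutoff

variable {A : Finset Grid} {φ : Grid → ℝ} {L : ℝ}

lemma mul_chi (φ : Grid → ℝ) (j : Grid) : φ j * chi φ j = φ j := by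
  by_cases h : Far φ j
  · simp [h.self]
  · simp [chi_eq_one h]

lemma sum_inner_pureDiff (hφ : IsCutoff A φ L) (k : Fin 2) (a b : GridFun)
    (ha : ∀ j, Far φ j → a j = 0) :
    ∑ j ∈ A, inner ℝ (a j) (b j - b (j - stp k)) = -∑ j ∈ A, inner ℝ (fd k a j) (b j) := by
  have h := hφ.sum_add (fun j => inner ℝ (a j) (b (j - stp k))) (fun j hj => by simp [ha j hj]) k
  simp only [add_sub_cancel_right] at h
  simp only [inner_sub_right, fd, inner_sub_left, Finset.sum_sub_distrib, h]
  ring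

/-- The Sobolev inequality is applied to `‖g‖ ^ 2`, whose differences are estimated by
Cauchy–Schwarz. -/
lemma ladyzhenskaya_of_support (hφ : IsCutoff A φ L) (g : GridFun) (hg : ∀ j, φ j = 0 → g j = 0) :
    ∑ j ∈ A, ‖g j‖ ^ 4 ≤
      2 * (∑ j ∈ A, ‖g j‖ ^ 2) * ∑ j ∈ A, (‖fd 0 g j‖ ^ 2 + ‖fd 1 g j‖ ^ 2) := by
  have key : ∀ k, (∑ j ∈ A, |fd k (fun j => ‖g j‖ ^ 2) j|) ^ 2 ≤
      (∑ j ∈ A, ‖fd k g j‖ ^ 2) * (4 * ∑ j ∈ A, ‖g j‖ ^ 2) := by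
    intro k
    have h1 : ∑ j ∈ A, |fd k (fun j => ‖g j‖ ^ 2) j| ≤
        ∑ j ∈ A, ‖fd k g j‖ * (‖g j‖ + ‖g (j + stp k)‖) :=
      Finset.sum_le_sum fun j _ => abs_norm_sq_sub_norm_sq_le _ _
    refine (pow_le_pow_left₀ (by positivity) h1 2).trans ?_
    refine (Finset.sum_mul_sq_le_sq_mul_sq _ _ _).trans ?_
    refine mul_le_mul_of_nonneg_left ?_ (by positivity)
    have h2 := hφ.sum_add (fun j => ‖g j‖ ^ 2) (fun j hj => by simp [hg j hj.self]) k
    have h3 : ∑ j ∈ A, (‖g j‖ + ‖g (j + stp k)‖) ^ 2 ≤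
        ∑ j ∈ A, (2 * ‖g j‖ ^ 2 + 2 * ‖g (j + stp k)‖ ^ 2) :=
      Finset.sum_le_sum fun j _ => by nlinarith [sq_nonneg (‖g j‖ - ‖g (j + stp k)‖)]
    rw [Finset.sum_add_distrib, ← Finset.mul_sum, ← Finset.mul_sum] at h3
    linarith
  have h0 := hφ.sobolev (fun j => ‖g j‖ ^ 2) (fun j hj => by simp [hg j hj])
  have h4 : ∑ j ∈ A, ‖g j‖ ^ 4 = ∑ j ∈ A, (‖g j‖ ^ 2) ^ 2 :=
    Finset.sum_congr rfl fun j _ => by ring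
  rw [h4, Finset.sum_add_distrib]
  nlinarith [key 0, key 1, sq_nonneg ((∑ j ∈ A, |fd 0 (fun j => ‖g j‖ ^ 2) j|) -
    ∑ j ∈ A, |fd 1 (fun j => ‖g j‖ ^ 2) j|)]

/-- Here `g` is not localized, so the Sobolev inequality is applied to `φ * ‖g‖ ^ 2`; the
differences of `φ` cost the term with `L ^ 2`. -/
lemma ladyzhenskaya (hφ : IsCutoff A φ L) (g : GridFun) :
    ∑ j ∈ A, φ j ^ 2 * ‖g j‖ ^ 4 ≤
      4 * (∑ j ∈ A, ‖g j‖ ^ 2) * (∑ j ∈ A, φ j ^ 2 * (‖fd 0 g j‖ ^ 2 + ‖fd 1 g j‖ ^ 2))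
        + 2 * L ^ 2 * (∑ j ∈ A, ‖g j‖ ^ 2) ^ 2 := by
  set K := ∑ j ∈ A, ‖g j‖ ^ 2 with hK
  have hK0 : 0 ≤ K := by positivity
  have key : ∀ k, (∑ j ∈ A, |fd k (fun j => φ j * ‖g j‖ ^ 2) j|) ^ 2 ≤
      2 * ((∑ j ∈ A, φ j ^ 2 * ‖fd k g j‖ ^ 2) * (4 * K)) + 2 * L ^ 2 * K ^ 2 := by
    intro k
    have hs := hφ.sum_chi_add_le (fun j => ‖g j‖ ^ 2) (fun j => by positivity) k
    have hs0 := hφ.sum_chi_le (fun j => ‖g j‖ ^ 2) (fun j => by positivity)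
    have h1 : ∑ j ∈ A, |fd k (fun j => φ j * ‖g j‖ ^ 2) j| ≤
        ∑ j ∈ A, (φ j * ‖fd k g j‖) * (chi φ j * (‖g j‖ + ‖g (j + stp k)‖)) +
          L * ∑ j ∈ A, chi φ j * ‖g (j + stp k)‖ ^ 2 := by
      rw [Finset.mul_sum, ← Finset.sum_add_distrib]
      refine Finset.sum_le_sum fun j _ => ?_
      have e1 : fd k (fun j => φ j * ‖g j‖ ^ 2) j = φ j * (‖g (j + stp k)‖ ^ 2 - ‖g j‖ ^ 2) +
          (φ (j + stp k) - φ j) * ‖g (j + stp k)‖ ^ 2 := by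
        simp only [fd]; ring
      rw [e1]
      refine (abs_add_le _ _).trans (add_le_add ?_ ?_)
      · rw [abs_mul, abs_of_nonneg (hφ.nonneg j)]
        have := abs_norm_sq_sub_norm_sq_le (g (j + stp k)) (g j)
        calc φ j * |‖g (j + stp k)‖ ^ 2 - ‖g j‖ ^ 2|
            ≤ φ j * (‖fd k g j‖ * (‖g j‖ + ‖g (j + stp k)‖)) :=
              mul_le_mul_of_nonneg_left this (hφ.nonneg j)
          _ = (φ j * chi φ j) * (‖fd k g j‖ * (‖g j‖ + ‖g (j + stp k)‖)) := by rw [mul_chi]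
          _ = _ := by ring
      · rw [abs_mul, abs_of_nonneg (sq_nonneg ‖g (j + stp k)‖), ← mul_assoc]
        exact mul_le_mul_of_nonneg_right (hφ.lip_chi k j) (sq_nonneg _)
    have h2 : (∑ j ∈ A, (φ j * ‖fd k g j‖) * (chi φ j * (‖g j‖ + ‖g (j + stp k)‖))) ^ 2 ≤
        (∑ j ∈ A, φ j ^ 2 * ‖fd k g j‖ ^ 2) * (4 * K) := by
      refine (Finset.sum_mul_sq_le_sq_mul_sq _ _ _).trans ?_
      simp only [mul_pow, chi_sq]
      refine mul_le_mul_of_nonneg_left ?_ (by positivity)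
      have h3 : ∑ j ∈ A, chi φ j * (‖g j‖ + ‖g (j + stp k)‖) ^ 2 ≤
          ∑ j ∈ A, (2 * (chi φ j * ‖g j‖ ^ 2) + 2 * (chi φ j * ‖g (j + stp k)‖ ^ 2)) :=
        Finset.sum_le_sum fun j _ => by
          nlinarith [mul_nonneg (chi_nonneg φ j) (sq_nonneg (‖g j‖ - ‖g (j + stp k)‖))]
      rw [Finset.sum_add_distrib, ← Finset.mul_sum, ← Finset.mul_sum] at h3
      linarith
    have h4 : L * ∑ j ∈ A, chi φ j * ‖g (j + stp k)‖ ^ 2 ≤ L * K :=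
      mul_le_mul_of_nonneg_left hs hφ.lip_nonneg
    have h5 : 0 ≤ ∑ j ∈ A, |fd k (fun j => φ j * ‖g j‖ ^ 2) j| := by positivity
    have h6 := pow_le_pow_left₀ h5 (h1.trans (add_le_add le_rfl h4)) 2
    nlinarith [sq_nonneg ((∑ j ∈ A, (φ j * ‖fd k g j‖) * (chi φ j * (‖g j‖ + ‖g (j + stp k)‖))) -
      L * K)]
  have h0 := hφ.sobolev (fun j => φ j * ‖g j‖ ^ 2) (fun j hj => by simp [hj])
  have h4 : ∑ j ∈ A, φ j ^ 2 * ‖g j‖ ^ 4 = ∑ j ∈ A, (φ j * ‖g j‖ ^ 2) ^ 2 :=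
    Finset.sum_congr rfl fun j _ => by ring
  simp only [mul_add]
  rw [h4, Finset.sum_add_distrib]
  nlinarith [key 0, key 1, sq_nonneg ((∑ j ∈ A, |fd 0 (fun j => φ j * ‖g j‖ ^ 2) j|) -
    ∑ j ∈ A, |fd 1 (fun j => φ j * ‖g j‖ ^ 2) j|)]

/-- Two forms, so that the weight can be taken at whichever endpoint carries the second difference
to be absorbed. -/
lemma abs_fd_sq_le (hφ : IsCutoff A φ L) (k : Fin 2) (j : Grid) :
    |fd k (fun i => φ i ^ 2) j| ≤ L * chi φ j * (2 * φ j + L) ∧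
    |fd k (fun i => φ i ^ 2) j| ≤ L * chi φ j * (2 * φ (j + stp k) + L) := by
  have h1 := hφ.lip_chi k j
  have h2 := hφ.lip k j
  have h3 := hφ.nonneg j
  have h4 := hφ.nonneg (j + stp k)
  have e : fd k (fun i => φ i ^ 2) j = (φ (j + stp k) - φ j) * (φ (j + stp k) + φ j) := by
    simp only [fd]; ring
  rw [e, abs_mul, abs_of_nonneg (add_nonneg h4 h3)]
  rw [abs_le] at h2
  exact ⟨mul_le_mul h1 (by linarith [h2.2]) (by positivity) ((abs_nonneg _).trans h1),
    mul_le_mul h1 (by linarith [h2.1]) (by positivity) ((abs_nonneg _).trans h1)⟩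

/-- Two summations by parts, one in each direction, trade the product of pure second differences for
the squared mixed one; the last two sums come from the cutoff. -/
lemma sum_inner_pureDiff_pureDiff (hφ : IsCutoff A φ L) (u : GridFun) :
    ∑ j ∈ A, φ j ^ 2 * inner ℝ (pureDiff 0 u j) (pureDiff 1 u j) =
      ∑ j ∈ A, φ j ^ 2 * ‖fd 1 (fd 0 u) j‖ ^ 2 +
      ∑ j ∈ A, fd 1 (fun i => φ i ^ 2) j * inner ℝ (fd 0 u (j + stp 1)) (fd 1 (fd 0 u) j) -
      ∑ j ∈ A, fd 0 (fun i => φ i ^ 2) j * inner ℝ (pureDiff 1 u (j + stp 0)) (fd 0 u j) := by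
  have h1 := hφ.sum_inner_pureDiff 0 (fun j => φ j ^ 2 • pureDiff 1 u j) (fd 0 u)
    (fun j hj => by simp [hj.self])
  have h2 := hφ.sum_inner_pureDiff 1 (fun j => φ j ^ 2 • fd 0 u j) (fd 1 (fd 0 u))
    (fun j hj => by simp [hj.self])
  have e1 : ∀ j, fd 0 (fun j => φ j ^ 2 • pureDiff 1 u j) j =
      φ j ^ 2 • (fd 1 (fd 0 u) j - fd 1 (fd 0 u) (j - stp 1)) +
        fd 0 (fun i => φ i ^ 2) j • pureDiff 1 u (j + stp 0) := by
    intro j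
    have : fd 1 (fd 0 u) j - fd 1 (fd 0 u) (j - stp 1) =
        pureDiff 1 u (j + stp 0) - pureDiff 1 u j := by
      rw [fd_comm 1 0]
      simp only [pureDiff]
      simp only [fd]
      rw [sub_add_eq_add_sub j (stp 1) (stp 0)]
      abel
    rw [this]
    simp only [fd]
    module
  have e2 : ∀ j, fd 1 (fun j => φ j ^ 2 • fd 0 u j) j =
      φ j ^ 2 • fd 1 (fd 0 u) j + fd 1 (fun i => φ i ^ 2) j • fd 0 u (j + stp 1) := by
    intro j
    simp only [fd]
    module
  simp only [e1, inner_add_left, inner_smul_left, conj_trivial, Finset.sum_add_distrib] at h1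
  simp only [e2, inner_add_left, inner_smul_left, conj_trivial, Finset.sum_add_distrib,
    real_inner_self_eq_norm_sq] at h2
  have h3 : ∑ j ∈ A, φ j ^ 2 * inner ℝ (pureDiff 0 u j) (pureDiff 1 u j) =
      ∑ j ∈ A, φ j ^ 2 * inner ℝ (pureDiff 1 u j) (fd 0 u j - fd 0 u (j - stp 0)) :=
    Finset.sum_congr rfl fun j _ => by rw [real_inner_comm]; rfl
  have h4 : ∑ j ∈ A, φ j ^ 2 * inner ℝ (fd 1 (fd 0 u) j - fd 1 (fd 0 u) (j - stp 1)) (fd 0 u j) =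
      ∑ j ∈ A, φ j ^ 2 * inner ℝ (fd 0 u j) (fd 1 (fd 0 u) j - fd 1 (fd 0 u) (j - stp 1)) :=
    Finset.sum_congr rfl fun j _ => by rw [real_inner_comm]
  rw [h3, h1, h4, h2]
  ring

lemma sum_hess_le (hφ : IsCutoff A φ L) (u : GridFun) :
    ∑ j ∈ A, φ j ^ 2 * hess u j ≤
      2 * ∑ j ∈ A, φ j ^ 2 * ‖lap u j‖ ^ 2 + 40 * L ^ 2 * ∑ j ∈ A, en u j := by
  set K := ∑ j ∈ A, en u j with hK
  have hid := hφ.sum_inner_pureDiff_pureDiff u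
  have hexp : ∑ j ∈ A, φ j ^ 2 * ‖lap u j‖ ^ 2 = ∑ j ∈ A, φ j ^ 2 * ‖pureDiff 0 u j‖ ^ 2 +
      ∑ j ∈ A, φ j ^ 2 * ‖pureDiff 1 u j‖ ^ 2 +
      2 * ∑ j ∈ A, φ j ^ 2 * inner ℝ (pureDiff 0 u j) (pureDiff 1 u j) := by
    rw [Finset.mul_sum, ← Finset.sum_add_distrib, ← Finset.sum_add_distrib]
    refine Finset.sum_congr rfl fun j _ => ?_
    rw [lap_eq_pureDiff, norm_add_sq_real]; ring
  have hH : ∑ j ∈ A, φ j ^ 2 * hess u j = ∑ j ∈ A, φ j ^ 2 * ‖pureDiff 0 u j‖ ^ 2 +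
      ∑ j ∈ A, φ j ^ 2 * ‖pureDiff 1 u j‖ ^ 2 +
      2 * ∑ j ∈ A, φ j ^ 2 * ‖fd 1 (fd 0 u) j‖ ^ 2 := by
    rw [Finset.mul_sum, ← Finset.sum_add_distrib, ← Finset.sum_add_distrib]
    refine Finset.sum_congr rfl fun j _ => ?_
    unfold hess; ring
  have hL2 : 0 ≤ L ^ 2 := sq_nonneg L
  -- This cutoff error uses up one of the two copies of the mixed square, and `hE2` half of a pure
  -- square. The rest still dominates half of `hess`, whence the factor `2` and `40 = 2 * (9 + 11)`.
  have hE1 : -(2 * ∑ j ∈ A, fd 1 (fun i => φ i ^ 2) j *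
      inner ℝ (fd 0 u (j + stp 1)) (fd 1 (fd 0 u) j)) ≤
      ∑ j ∈ A, φ j ^ 2 * ‖fd 1 (fd 0 u) j‖ ^ 2 + 9 * L ^ 2 * K := by
    have hs := hφ.sum_chi_add_le (en u) (en_nonneg u) 1
    have hs0 := hφ.sum_chi_le (en u) (en_nonneg u)
    have h1 : -(2 * ∑ j ∈ A, fd 1 (fun i => φ i ^ 2) j *
        inner ℝ (fd 0 u (j + stp 1)) (fd 1 (fd 0 u) j)) ≤
        ∑ j ∈ A, (φ j ^ 2 * ‖fd 1 (fd 0 u) j‖ ^ 2 +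
          (7 * L ^ 2 * (chi φ j * en u (j + stp 1)) + 2 * L ^ 2 * (chi φ j * en u j))) := by
      rw [Finset.mul_sum, ← Finset.sum_neg_distrib]
      refine Finset.sum_le_sum fun j _ => ?_
      have a1 := (hφ.abs_fd_sq_le 1 j).1
      have a2 := abs_real_inner_le_norm (fd 0 u (j + stp 1)) (fd 1 (fd 0 u) j)
      have a3 : ‖fd 1 (fd 0 u) j‖ ^ 2 ≤ 2 * (‖fd 0 u (j + stp 1)‖ ^ 2 + ‖fd 0 u j‖ ^ 2) :=
        norm_sub_sq_le_two_mul _ _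
      have a4 := norm_fd_sq_le_en u (j + stp 1) 0
      have a5 := norm_fd_sq_le_en u j 0
      have a6 := mul_le_mul a1 a2 (abs_nonneg _) ((abs_nonneg _).trans a1)
      rw [← abs_mul] at a6
      have a7 := (neg_le_abs _).trans a6
      have a8 := mul_chi φ j
      set x := ‖fd 0 u (j + stp 1)‖
      set m := ‖fd 1 (fd 0 u) j‖
      have hc0 := chi_nonneg φ j
      have b1 : L * chi φ j * (2 * φ j + L) * (x * m) =
          2 * ((φ j * m) * (L * chi φ j * x)) + chi φ j * L ^ 2 * (x * m) := by
        ring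
      have b2 : (L * chi φ j * x) ^ 2 = chi φ j * L ^ 2 * x ^ 2 := by
        rw [mul_pow, mul_pow, chi_sq]; ring
      have b3 : 4 * ((φ j * m) * (L * chi φ j * x)) ≤
          (φ j * m) ^ 2 + 4 * (chi φ j * L ^ 2 * x ^ 2) := by
        rw [← b2]; nlinarith [sq_nonneg (φ j * m - 2 * (L * chi φ j * x))]
      have b4 : 2 * (x * m) ≤ 3 * en u (j + stp 1) + 2 * en u j := by
        nlinarith [sq_nonneg (x - m)]
      have b5 := mul_le_mul_of_nonneg_left b4 (mul_nonneg hc0 hL2)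
      have b6 := mul_le_mul_of_nonneg_left a4 (mul_nonneg hc0 hL2)
      rw [b1] at a7
      linarith
    rw [Finset.sum_add_distrib, Finset.sum_add_distrib, ← Finset.mul_sum, ← Finset.mul_sum] at h1
    nlinarith
  have hE2 : 2 * ∑ j ∈ A, fd 0 (fun i => φ i ^ 2) j *
      inner ℝ (pureDiff 1 u (j + stp 0)) (fd 0 u j) ≤
      1 / 2 * ∑ j ∈ A, φ j ^ 2 * ‖pureDiff 1 u j‖ ^ 2 + 11 * L ^ 2 * K := by
    have hs := hφ.sum_chi_add_le (en u) (en_nonneg u) 0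
    have hs0 := hφ.sum_chi_le (en u) (en_nonneg u)
    have hsh := hφ.sum_add (fun j => φ j ^ 2 * ‖pureDiff 1 u j‖ ^ 2)
      (fun j hj => by simp [hj.self]) 0
    have h1 : 2 * ∑ j ∈ A, fd 0 (fun i => φ i ^ 2) j *
        inner ℝ (pureDiff 1 u (j + stp 0)) (fd 0 u j) ≤
        ∑ j ∈ A, (1 / 2 * (φ (j + stp 0) ^ 2 * ‖pureDiff 1 u (j + stp 0)‖ ^ 2) +
          (2 * L ^ 2 * (chi φ j * en u (j + stp 0)) + 9 * L ^ 2 * (chi φ j * en u j))) := by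
      rw [Finset.mul_sum]
      refine Finset.sum_le_sum fun j _ => ?_
      have a1 := (hφ.abs_fd_sq_le 0 j).2
      have a2 := abs_real_inner_le_norm (pureDiff 1 u (j + stp 0)) (fd 0 u j)
      have a3 := norm_pureDiff_sq_le 1 u (j + stp 0)
      have a5 := norm_fd_sq_le_en u j 0
      have a6 := mul_le_mul a1 a2 (abs_nonneg _) ((abs_nonneg _).trans a1)
      rw [← abs_mul] at a6
      have a7 := (le_abs_self _).trans a6
      set m := ‖pureDiff 1 u (j + stp 0)‖
      set x := ‖fd 0 u j‖
      set f := φ (j + stp 0)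
      have hc0 := chi_nonneg φ j
      have b1 : L * chi φ j * (2 * f + L) * (m * x) =
          2 * ((f * m) * (L * chi φ j * x)) + chi φ j * L ^ 2 * (x * m) := by
        ring
      have b2 : (L * chi φ j * x) ^ 2 = chi φ j * L ^ 2 * x ^ 2 := by
        rw [mul_pow, mul_pow, chi_sq]; ring
      have b3 : 4 * ((f * m) * (L * chi φ j * x)) ≤
          1 / 2 * (f * m) ^ 2 + 8 * (chi φ j * L ^ 2 * x ^ 2) := by
        rw [← b2]; nlinarith [sq_nonneg (f * m - 4 * (L * chi φ j * x))]
      have b4 : 2 * (x * m) ≤ 2 * en u (j + stp 0) + en u j := by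
        nlinarith [sq_nonneg (x - m)]
      have b5 := mul_le_mul_of_nonneg_left b4 (mul_nonneg hc0 hL2)
      have b6 := mul_le_mul_of_nonneg_left a5 (mul_nonneg hc0 hL2)
      rw [b1] at a7
      linarith
    rw [Finset.sum_add_distrib, Finset.sum_add_distrib, ← Finset.mul_sum, ← Finset.mul_sum,
      ← Finset.mul_sum, hsh] at h1
    nlinarith
  have hp0 : 0 ≤ ∑ j ∈ A, φ j ^ 2 * ‖pureDiff 0 u j‖ ^ 2 := by positivity
  rw [hid] at hexp
  linarith

/-- Ladyzhenskaya for a first difference. Iterating a forward difference gives the pure second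
difference one site ahead, so the weight must be moved there, at the cost of a term with `L ^ 2`. -/
lemma sum_fd_pow_four_le (hφ : IsCutoff A φ L) (u : GridFun) (k : Fin 2) :
    ∑ j ∈ A, φ j ^ 2 * ‖fd k u j‖ ^ 4 ≤
      8 * (∑ j ∈ A, en u j) * (∑ j ∈ A, φ j ^ 2 * hess u j) +
        18 * L ^ 2 * (∑ j ∈ A, en u j) ^ 2 := by
  set K := ∑ j ∈ A, en u j with hK
  set H := ∑ j ∈ A, φ j ^ 2 * hess u j with hH
  have hK0 : 0 ≤ K := Finset.sum_nonneg fun j _ => en_nonneg u j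
  have hlad := hφ.ladyzhenskaya (fd k u)
  have hKg : ∑ j ∈ A, ‖fd k u j‖ ^ 2 ≤ K :=
    Finset.sum_le_sum fun j _ => norm_fd_sq_le_en u j k
  have hKg0 : 0 ≤ ∑ j ∈ A, ‖fd k u j‖ ^ 2 := by positivity
  have hD : ∑ j ∈ A, φ j ^ 2 * (‖fd 0 (fd k u) j‖ ^ 2 + ‖fd 1 (fd k u) j‖ ^ 2) ≤
      2 * H + 4 * L ^ 2 * K := by
    have hs := hφ.sum_chi_add_le (en u) (en_nonneg u) k
    have hsh := hφ.sum_add (fun j => φ j ^ 2 * ‖pureDiff k u j‖ ^ 2)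
      (fun j hj => by simp [hj.self]) k
    have h1 : ∑ j ∈ A, φ j ^ 2 * (‖fd 0 (fd k u) j‖ ^ 2 + ‖fd 1 (fd k u) j‖ ^ 2) ≤
        ∑ j ∈ A, (2 * (φ (j + stp k) ^ 2 * ‖pureDiff k u (j + stp k)‖ ^ 2) +
          (4 * L ^ 2 * (chi φ j * en u (j + stp k)) + φ j ^ 2 * ‖fd 1 (fd 0 u) j‖ ^ 2)) := by
      refine Finset.sum_le_sum fun j _ => ?_
      have a1 : ‖fd 0 (fd k u) j‖ ^ 2 + ‖fd 1 (fd k u) j‖ ^ 2 =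
          ‖pureDiff k u (j + stp k)‖ ^ 2 + ‖fd 1 (fd 0 u) j‖ ^ 2 := by
        rw [← fd_fd_self]
        fin_cases k
        · simp
        · simp only [Fin.mk_one, fd_comm 0 1]; ring
      have a2 := norm_pureDiff_sq_le k u (j + stp k)
      have a3 := pow_le_pow_left₀ (abs_nonneg _) (hφ.lip_chi k j) 2
      rw [sq_abs, mul_pow, chi_sq] at a3
      have a4 : φ j ^ 2 ≤ 2 * φ (j + stp k) ^ 2 + 2 * (L ^ 2 * chi φ j) := by
        nlinarith [sq_nonneg (φ (j + stp k) + (φ (j + stp k) - φ j))]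
      have a5 := mul_le_mul_of_nonneg_right a4 (sq_nonneg ‖pureDiff k u (j + stp k)‖)
      have a6 := mul_le_mul_of_nonneg_left a2
        (mul_nonneg (sq_nonneg L) (chi_nonneg φ j))
      rw [a1]
      linarith
    rw [Finset.sum_add_distrib, Finset.sum_add_distrib, ← Finset.mul_sum, ← Finset.mul_sum,
      hsh] at h1
    have h2 : 2 * ∑ j ∈ A, φ j ^ 2 * ‖pureDiff k u j‖ ^ 2 +
        ∑ j ∈ A, φ j ^ 2 * ‖fd 1 (fd 0 u) j‖ ^ 2 ≤ 2 * H := by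
      rw [hH, Finset.mul_sum, Finset.mul_sum, ← Finset.sum_add_distrib]
      refine Finset.sum_le_sum fun j _ => ?_
      have : 2 * ‖pureDiff k u j‖ ^ 2 + ‖fd 1 (fd 0 u) j‖ ^ 2 ≤ 2 * hess u j := by
        unfold hess
        fin_cases k
        · simp only [Fin.zero_eta]; nlinarith [sq_nonneg ‖pureDiff 1 u j‖, sq_nonneg ‖fd 1 (fd 0 u) j‖]
        · simp only [Fin.mk_one]; nlinarith [sq_nonneg ‖pureDiff 0 u j‖, sq_nonneg ‖fd 1 (fd 0 u) j‖]
      nlinarith [mul_le_mul_of_nonneg_left this (sq_nonneg (φ j))]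
    have h3 := mul_le_mul_of_nonneg_left hs (mul_nonneg (by norm_num : (0 : ℝ) ≤ 4) (sq_nonneg L))
    linarith
  have hD0 : 0 ≤ ∑ j ∈ A, φ j ^ 2 * (‖fd 0 (fd k u) j‖ ^ 2 + ‖fd 1 (fd k u) j‖ ^ 2) := by positivity
  have h5 := mul_le_mul hKg hD hD0 hK0
  have h6 := mul_le_mul_of_nonneg_left (pow_le_pow_left₀ hKg0 hKg 2) (sq_nonneg L)
  linarith

/-- Backward differences are forward ones at a shifted site. Moving the weight uses the bounded
diameter of `N`, which gives the last term, linear in the energy. -/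
lemma sum_en_sq_le (hφ : IsCutoff A φ L) {N : Set Space} {ν : Space → Space} {c : ℝ}
    (hb : NormalBounds N ν c) {u : GridFun} (hu : ∀ j, u j ∈ N) :
    ∑ j ∈ A, φ j ^ 2 * en u j ^ 2 ≤
      192 * (∑ j ∈ A, en u j) * (∑ j ∈ A, φ j ^ 2 * hess u j) +
        432 * L ^ 2 * (∑ j ∈ A, en u j) ^ 2 + 16 * c ^ 2 * L ^ 2 * ∑ j ∈ A, en u j := by
  set K := ∑ j ∈ A, en u j with hK
  have hfour := hφ.sum_fd_pow_four_le u
  have hback : ∀ k, ∑ j ∈ A, φ j ^ 2 * ‖fd k u (j - stp k)‖ ^ 4 ≤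
      2 * ∑ j ∈ A, φ j ^ 2 * ‖fd k u j‖ ^ 4 + 2 * c ^ 2 * L ^ 2 * K := by
    intro k
    have hsh := hφ.sum_sub (fun j => φ (j + stp k) ^ 2 * ‖fd k u j‖ ^ 4)
      (fun j hj => by simp [hj.add]) k
    simp only [sub_add_cancel] at hsh
    rw [hsh]
    have hs0 := hφ.sum_chi_le (en u) (en_nonneg u)
    have h1 : ∑ j ∈ A, φ (j + stp k) ^ 2 * ‖fd k u j‖ ^ 4 ≤
        ∑ j ∈ A, (2 * (φ j ^ 2 * ‖fd k u j‖ ^ 4) + 2 * c ^ 2 * L ^ 2 * (chi φ j * en u j)) := by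
      refine Finset.sum_le_sum fun j _ => ?_
      have a3 := pow_le_pow_left₀ (abs_nonneg _) (hφ.lip_chi k j) 2
      rw [sq_abs, mul_pow, chi_sq] at a3
      have a4 : φ (j + stp k) ^ 2 ≤ 2 * φ j ^ 2 + 2 * (L ^ 2 * chi φ j) := by
        nlinarith [sq_nonneg (φ j - (φ (j + stp k) - φ j))]
      have a5 := mul_le_mul_of_nonneg_right a4 (pow_nonneg (norm_nonneg (fd k u j)) 4)
      have a6 : ‖fd k u j‖ ^ 4 ≤ c ^ 2 * en u j := by
        have := pow_le_pow_left₀ (norm_nonneg _) (hb.dist_le _ (hu (j + stp k)) _ (hu j)) 2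
        have h2 := mul_le_mul this (norm_fd_sq_le_en u j k) (by positivity) (by positivity)
        refine le_trans (le_of_eq ?_) h2
        rw [show u (j + stp k) - u j = fd k u j from rfl]; ring
      have a7 := mul_le_mul_of_nonneg_left a6 (mul_nonneg (sq_nonneg L) (chi_nonneg φ j))
      linarith
    rw [Finset.sum_add_distrib, ← Finset.mul_sum, ← Finset.mul_sum] at h1
    have h3 := mul_le_mul_of_nonneg_left hs0 (by positivity : 0 ≤ 2 * c ^ 2 * L ^ 2)
    linarith
  have h1 : ∑ j ∈ A, φ j ^ 2 * en u j ^ 2 ≤ ∑ j ∈ A,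
      (4 * (φ j ^ 2 * ‖fd 0 u j‖ ^ 4) + (4 * (φ j ^ 2 * ‖fd 0 u (j - stp 0)‖ ^ 4) +
      (4 * (φ j ^ 2 * ‖fd 1 u j‖ ^ 4) + 4 * (φ j ^ 2 * ‖fd 1 u (j - stp 1)‖ ^ 4)))) := by
    refine Finset.sum_le_sum fun j _ => ?_
    have : en u j ^ 2 ≤ 4 * (‖fd 0 u j‖ ^ 4 + ‖fd 0 u (j - stp 0)‖ ^ 4 + ‖fd 1 u j‖ ^ 4 +
        ‖fd 1 u (j - stp 1)‖ ^ 4) := by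
      simp only [en, Fin.sum_univ_two]
      set a := ‖fd 0 u j‖ ^ 2 with ha
      set b := ‖fd 0 u (j - stp 0)‖ ^ 2 with hb
      set d := ‖fd 1 u j‖ ^ 2 with hd
      set e := ‖fd 1 u (j - stp 1)‖ ^ 2 with he
      rw [show ‖fd 0 u j‖ ^ 4 = a ^ 2 by rw [ha]; ring,
        show ‖fd 0 u (j - stp 0)‖ ^ 4 = b ^ 2 by rw [hb]; ring,
        show ‖fd 1 u j‖ ^ 4 = d ^ 2 by rw [hd]; ring,
        show ‖fd 1 u (j - stp 1)‖ ^ 4 = e ^ 2 by rw [he]; ring]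
      linarith [sq_nonneg (a - b), sq_nonneg (a - d), sq_nonneg (a - e), sq_nonneg (b - d),
        sq_nonneg (b - e), sq_nonneg (d - e)]
    linarith [mul_le_mul_of_nonneg_left this (sq_nonneg (φ j))]
  simp only [Finset.sum_add_distrib, ← Finset.mul_sum] at h1
  linarith [hfour 0, hfour 1, hback 0, hback 1]

/-- The second order estimate under a smallness condition on the energy. -/
lemma second_order_estimate (hφ : IsCutoff A φ L) {N : Set Space} {ν : Space → Space} {c α : ℝ}
    (hb : NormalBounds N ν c) {u : GridFun} (hu : ∀ j, u j ∈ N)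
    (hK : 2000 * c ^ 2 * ∑ j ∈ A, en u j ≤ 1) :
    ∑ j ∈ A, φ j ^ 2 * hess u j ≤ 4 * ∑ j ∈ A, φ j ^ 2 * ‖fld ν α u j‖ ^ 2 +
        2000 * c ^ 4 * L ^ 2 * ∑ j ∈ A, en u j ∧
    ∑ j ∈ A, φ j ^ 2 * (‖lap u j‖ ^ 2 + en u j ^ 2) ≤ 3 * ∑ j ∈ A, φ j ^ 2 * ‖fld ν α u j‖ ^ 2 +
        2000 * c ^ 4 * L ^ 2 * ∑ j ∈ A, en u j := by
  have h1 := hφ.sum_hess_le u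
  have h2 := hφ.sum_en_sq_le hb hu
  have h3 : ∑ j ∈ A, φ j ^ 2 * ‖lap u j‖ ^ 2 ≤ ∑ j ∈ A, φ j ^ 2 * ‖fld ν α u j‖ ^ 2 +
      c ^ 2 * ∑ j ∈ A, φ j ^ 2 * en u j ^ 2 := by
    rw [Finset.mul_sum, ← Finset.sum_add_distrib]
    refine Finset.sum_le_sum fun j _ => ?_
    have := mul_le_mul_of_nonneg_left (hb.norm_lap_sq_le_fld (α := α) hu j) (sq_nonneg (φ j))
    linarith
  have hH0 : 0 ≤ ∑ j ∈ A, φ j ^ 2 * hess u j :=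
    Finset.sum_nonneg fun j _ => mul_nonneg (sq_nonneg _) (hess_nonneg u j)
  have hV0 : 0 ≤ ∑ j ∈ A, φ j ^ 2 * ‖fld ν α u j‖ ^ 2 := by positivity
  have hK0 : 0 ≤ ∑ j ∈ A, en u j := Finset.sum_nonneg fun j _ => en_nonneg u j
  have hS0 : 0 ≤ ∑ j ∈ A, φ j ^ 2 * en u j ^ 2 := by positivity
  simp only [mul_add, Finset.sum_add_distrib]
  set K := ∑ j ∈ A, en u j
  set H := ∑ j ∈ A, φ j ^ 2 * hess u j
  set V := ∑ j ∈ A, φ j ^ 2 * ‖fld ν α u j‖ ^ 2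
  set S := ∑ j ∈ A, φ j ^ 2 * en u j ^ 2
  set P := ∑ j ∈ A, φ j ^ 2 * ‖lap u j‖ ^ 2
  have hc1 : 1 ≤ c ^ 2 := one_le_pow₀ hb.one_le
  have hc2 : c ^ 2 ≤ c ^ 4 := by nlinarith
  have hLK : 0 ≤ L ^ 2 * K := mul_nonneg (sq_nonneg L) hK0
  -- The smallness assumption absorbs the quartic sum, since `192 / 2000 < 1 / 10`.
  have h4 : c ^ 2 * S ≤ 1 / 10 * H + 17 * c ^ 4 * (L ^ 2 * K) := by
    have e1 : c ^ 2 * S ≤ c ^ 2 * (192 * K * H + 432 * L ^ 2 * K ^ 2 + 16 * c ^ 2 * L ^ 2 * K) :=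
      mul_le_mul_of_nonneg_left h2 (by positivity)
    have e2 : (2000 * c ^ 2 * K) * H ≤ 1 * H := mul_le_mul_of_nonneg_right hK hH0
    have e3 : (2000 * c ^ 2 * K) * (L ^ 2 * K) ≤ 1 * (L ^ 2 * K) :=
      mul_le_mul_of_nonneg_right hK hLK
    have e4 : (L ^ 2 * K) ≤ c ^ 4 * (L ^ 2 * K) :=
      le_mul_of_one_le_left hLK (hc1.trans hc2)
    nlinarith
  have e4 : (L ^ 2 * K) ≤ c ^ 4 * (L ^ 2 * K) := le_mul_of_one_le_left hLK (hc1.trans hc2)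
  have e5 : S ≤ c ^ 2 * S := le_mul_of_one_le_left hS0 hc1
  constructor
  · linarith
  · linarith

end IsCutoff

end DiscreteLLG

namespace DiscreteLLG

open Filter Topology

/-! ### The localized energy inequality -/

/-- Solutions of the system with unit mesh size. -/
structure IsUnitSolution (N : Set Space) (ν : Space → Space) (α : ℝ) (u : ℝ → GridFun) : Prop where
  mem : ∀ t, 0 ≤ t → ∀ j, u t j ∈ N
  hasDeriv : ∀ t, 0 ≤ t → ∀ j,
    HasDerivWithinAt (fun s => u s j) (fld ν α (u t) j) (Set.Ici 0) t

lemma le_of_hasDerivAt_nonpos {f : ℝ → ℝ} {a b : ℝ} (hab : a ≤ b)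
    (hf : ContinuousOn f (Set.Icc a b))
    (hd : ∀ x ∈ Set.Ioo a b, ∃ f', HasDerivAt f f' x ∧ f' ≤ 0) : f b ≤ f a := by
  refine antitoneOn_of_deriv_nonpos (convex_Icc a b) hf ?_ ?_ (Set.left_mem_Icc.2 hab)
    (Set.right_mem_Icc.2 hab) hab
  · rw [interior_Icc]
    intro x hx
    obtain ⟨f', h, -⟩ := hd x hx
    exact h.differentiableAt.differentiableWithinAt
  · rw [interior_Icc]
    intro x hx
    obtain ⟨f', h, h'⟩ := hd x hx
    rwa [h.deriv]

namespace IsCutoff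

variable {A : Finset Grid} {φ : Grid → ℝ} {L : ℝ}

lemma abs_sq_sub_sq_le (hφ : IsCutoff A φ L) (k : Fin 2) (j : Grid) :
    |φ j ^ 2 - φ (j - stp k) ^ 2| ≤ L * chi φ j * (2 * φ j + L) := by
  have h1 := hφ.lip_chi_sub k j
  have h2 := hφ.lip k (j - stp k)
  rw [sub_add_cancel] at h2
  have h3 := hφ.nonneg j
  have h4 := hφ.nonneg (j - stp k)
  have e : φ j ^ 2 - φ (j - stp k) ^ 2 = (φ j - φ (j - stp k)) * (φ j + φ (j - stp k)) := by ring
  rw [e, abs_mul, abs_of_nonneg (add_nonneg h3 h4)]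
  rw [abs_le] at h2
  exact mul_le_mul h1 (by linarith [h2.1]) (by positivity) ((abs_nonneg _).trans h1)

/-- Summation by parts for an arbitrary variation `v`: the bulk term pairs `v` with the Laplacian,
and the remainder contains only differences of `φ ^ 2`. -/
lemma energy_variation_eq (hφ : IsCutoff A φ L) (u v : GridFun) :
    ∑ j ∈ A, φ j ^ 2 * ∑ k : Fin 2, (inner ℝ (fd k u j) (fd k v j) +
      inner ℝ (fd k u (j - stp k)) (fd k v (j - stp k))) =
    ∑ j ∈ A, (-(2 * (φ j ^ 2 * inner ℝ (v j) (lap u j))) - ∑ k : Fin 2,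
      ((φ j ^ 2 - φ (j - stp k) ^ 2) * inner ℝ (v j) (fd k u (j - stp k)) +
        (φ (j + stp k) ^ 2 - φ j ^ 2) * inner ℝ (v j) (fd k u j))) := by
  have key : ∀ k : Fin 2, ∑ j ∈ A, φ j ^ 2 * (inner ℝ (fd k u j) (fd k v j) +
      inner ℝ (fd k u (j - stp k)) (fd k v (j - stp k))) =
      ∑ j ∈ A, (-(2 * (φ j ^ 2 * inner ℝ (v j) (fd k u j - fd k u (j - stp k)))) -
        ((φ j ^ 2 - φ (j - stp k) ^ 2) * inner ℝ (v j) (fd k u (j - stp k)) +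
        (φ (j + stp k) ^ 2 - φ j ^ 2) * inner ℝ (v j) (fd k u j))) := by
    intro k
    have h1 := hφ.sum_sub (fun j => φ j ^ 2 * inner ℝ (fd k u j) (v (j + stp k)))
      (fun j hj => by simp [hj.self]) k
    have h2 := hφ.sum_add (fun j => φ j ^ 2 * inner ℝ (fd k u (j - stp k)) (v (j - stp k)))
      (fun j hj => by simp [hj.self]) k
    simp only [sub_add_cancel, add_sub_cancel_right] at h1 h2
    have e1 : ∑ j ∈ A, φ j ^ 2 * (inner ℝ (fd k u j) (fd k v j) +
        inner ℝ (fd k u (j - stp k)) (fd k v (j - stp k))) =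
        ∑ j ∈ A, φ j ^ 2 * inner ℝ (fd k u j) (v (j + stp k)) -
        ∑ j ∈ A, φ j ^ 2 * inner ℝ (fd k u (j - stp k)) (v (j - stp k)) +
        ∑ j ∈ A, φ j ^ 2 * (inner ℝ (fd k u (j - stp k)) (v j) - inner ℝ (fd k u j) (v j)) := by
      rw [← Finset.sum_sub_distrib, ← Finset.sum_add_distrib]
      refine Finset.sum_congr rfl fun j _ => ?_
      have : fd k v (j - stp k) = v j - v (j - stp k) := by simp [fd]
      rw [this]
      simp only [fd, inner_sub_right]
      ring
    rw [e1, ← h1, ← h2, ← Finset.sum_sub_distrib, ← Finset.sum_add_distrib]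
    refine Finset.sum_congr rfl fun j _ => ?_
    rw [inner_sub_right, real_inner_comm (v j) (fd k u j), real_inner_comm (v j)]
    ring
  simp only [lap, inner_sum, Finset.mul_sum, ← Finset.sum_sub_distrib, ← Finset.sum_neg_distrib]
  rw [Finset.sum_comm, Finset.sum_comm (s := A)]
  exact Finset.sum_congr rfl fun k _ => key k

/-- The bulk term is `-β` times the weighted square of the velocity, with `β = α / (1 + α ^ 2)`.
Young's inequality spends half of it on the cutoff errors. -/
lemma energy_variation_le (hφ : IsCutoff A φ L) {N : Set Space} {ν : Space → Space} {c α : ℝ}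
    (hα : 0 < α) (hb : NormalBounds N ν c) {u : GridFun} (hu : ∀ j, u j ∈ N) :
    1 / 2 * ∑ j ∈ A, φ j ^ 2 * ∑ k : Fin 2, (inner ℝ (fd k u j) (fd k (fld ν α u) j) +
      inner ℝ (fd k u (j - stp k)) (fd k (fld ν α u) (j - stp k))) ≤
    -(α / (1 + α ^ 2) / 2 * ∑ j ∈ A, φ j ^ 2 * ‖fld ν α u j‖ ^ 2) +
      (2 / (α / (1 + α ^ 2)) + 2 * (1 + α ^ 2) + 1) * L ^ 2 * ∑ j ∈ A, en u j := by
  set β := α / (1 + α ^ 2) with hβ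
  have hβ0 : 0 < β := by positivity
  set C := 2 / β + 2 * (1 + α ^ 2) + 1 with hC
  have hL0 := hφ.lip_nonneg
  have hs := mul_le_mul_of_nonneg_left (hφ.sum_chi_le (en u) (en_nonneg u))
    (by positivity : 0 ≤ C * L ^ 2)
  refine le_trans ?_ (add_le_add le_rfl hs)
  rw [hφ.energy_variation_eq, Finset.mul_sum, Finset.mul_sum, Finset.mul_sum,
    ← Finset.sum_neg_distrib, ← Finset.sum_add_distrib]
  refine Finset.sum_le_sum fun j _ => ?_
  rw [inner_field_laplacian (hb.unit _ (hu j)) (rfl : fld ν α u j = _), ← hβ]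
  set v := fld ν α u j with hv
  set x := chi φ j
  have hx0 : 0 ≤ x := chi_nonneg φ j
  have hf0 := hφ.nonneg j
  have key : ∀ k, -((φ j ^ 2 - φ (j - stp k) ^ 2) * inner ℝ v (fd k u (j - stp k)) +
        (φ (j + stp k) ^ 2 - φ j ^ 2) * inner ℝ v (fd k u j)) ≤
      β / 2 * (φ j ^ 2 * ‖v‖ ^ 2) + x * L ^ 2 * ((4 / β + 1) *
        (‖fd k u j‖ ^ 2 + ‖fd k u (j - stp k)‖ ^ 2) + 1 / 2 * ‖v‖ ^ 2) := by
    intro k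
    have a1 := hφ.abs_sq_sub_sq_le k j
    have a2 := (hφ.abs_fd_sq_le k j).1
    have a3 := mul_le_mul a1 (abs_real_inner_le_norm v (fd k u (j - stp k))) (abs_nonneg _)
      ((abs_nonneg _).trans a1)
    have a4 := mul_le_mul a2 (abs_real_inner_le_norm v (fd k u j)) (abs_nonneg _)
      ((abs_nonneg _).trans a2)
    rw [← abs_mul] at a3 a4
    have a5 := (neg_le_abs _).trans a3
    have a6 := (neg_le_abs _).trans a4
    simp only [fd] at a5 a6 ⊢
    set p := ‖u (j + stp k) - u j‖
    set q := ‖u (j - stp k + stp k) - u (j - stp k)‖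
    have b0 : x ^ 2 = x := chi_sq φ j
    have b1 : 2 * ((φ j * ‖v‖) * (L * x * (p + q))) ≤
        β / 2 * (φ j * ‖v‖) ^ 2 + 2 / β * (L * x * (p + q)) ^ 2 := by
      have : 0 ≤ β / 2 * ((φ j * ‖v‖) - 2 / β * (L * x * (p + q))) ^ 2 := by positivity
      have e : β / 2 * ((φ j * ‖v‖) - 2 / β * (L * x * (p + q))) ^ 2 = β / 2 * (φ j * ‖v‖) ^ 2 +
        2 / β * (L * x * (p + q)) ^ 2 - 2 * ((φ j * ‖v‖) * (L * x * (p + q))) := by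
        field_simp; ring
      linarith
    have b2 : (L * x * (p + q)) ^ 2 ≤ x * L ^ 2 * (2 * (p ^ 2 + q ^ 2)) := by
      have e : (L * x * (p + q)) ^ 2 = x * L ^ 2 * (p + q) ^ 2 := by
        rw [mul_pow, mul_pow, b0]; ring
      rw [e]
      refine mul_le_mul_of_nonneg_left ?_ (by positivity)
      nlinarith [sq_nonneg (p - q)]
    have b3 := mul_le_mul_of_nonneg_left b2 (by positivity : 0 ≤ 2 / β)
    have b4 : ‖v‖ * (p + q) ≤ (p ^ 2 + q ^ 2) + 1 / 2 * ‖v‖ ^ 2 := by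
      nlinarith [sq_nonneg (‖v‖ - (p + q)), sq_nonneg (p - q)]
    have b5 := mul_le_mul_of_nonneg_left b4 (by positivity : 0 ≤ x * L ^ 2)
    have e2 : x * L ^ 2 * ((4 / β + 1) * (p ^ 2 + q ^ 2) + 1 / 2 * ‖v‖ ^ 2) =
        2 / β * (x * L ^ 2 * (2 * (p ^ 2 + q ^ 2))) +
        x * L ^ 2 * ((p ^ 2 + q ^ 2) + 1 / 2 * ‖v‖ ^ 2) := by ring
    rw [e2]
    linarith
  have h0 := key 0
  have h1 := key 1
  -- The errors quadratic in `L` contain `‖v‖ ^ 2` without weight; on the unit grid this is bounded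
  -- by the energy density.
  have hv4 := mul_le_mul_of_nonneg_left (hb.norm_fld_sq_le (α := α) hu j)
    (by positivity : 0 ≤ x * L ^ 2)
  rw [← hv] at hv4
  have hen : en u j = (‖fd 0 u j‖ ^ 2 + ‖fd 0 u (j - stp 0)‖ ^ 2) +
    (‖fd 1 u j‖ ^ 2 + ‖fd 1 u (j - stp 1)‖ ^ 2) := by simp [en, Fin.sum_univ_two]
  have e3 : C * L ^ 2 * (x * en u j) = 1 / 2 * (x * L ^ 2 * ((4 / β + 1) * en u j)) +
      1 / 2 * (x * L ^ 2 * (4 * (1 + α ^ 2) * en u j)) + 1 / 2 * (x * L ^ 2 * en u j) := by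
    rw [hC]; ring
  have hxe : 0 ≤ x * L ^ 2 * en u j := mul_nonneg (by positivity) (en_nonneg u j)
  rw [e3]
  rw [hen] at hv4 hxe ⊢
  rw [Fin.sum_univ_two]
  linarith

end IsCutoff

namespace IsUnitSolution

variable {N : Set Space} {ν : Space → Space} {c α : ℝ} {u : ℝ → GridFun}

lemma continuousOn (hu : IsUnitSolution N ν α u) (j : Grid) :
    ContinuousOn (fun s => u s j) (Set.Ici 0) := fun t ht =>
  (hu.hasDeriv t ht j).continuousWithinAt

lemma continuousOn_en (hu : IsUnitSolution N ν α u) (j : Grid) :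
    ContinuousOn (fun s => en (u s) j) (Set.Ici 0) := by
  unfold en fd
  exact continuousOn_finsetSum _ fun k _ =>
    ((((hu.continuousOn _).sub (hu.continuousOn _)).norm.pow 2).add
    (((hu.continuousOn _).sub (hu.continuousOn _)).norm.pow 2))

lemma hasDerivAt (hu : IsUnitSolution N ν α u) {t : ℝ} (ht : 0 < t) (j : Grid) :
    HasDerivAt (fun s => u s j) (fld ν α (u t) j) t :=
  (hu.hasDeriv t ht.le j).hasDerivAt (Ici_mem_nhds ht)

lemma hasDerivAt_en (hu : IsUnitSolution N ν α u) {t : ℝ} (ht : 0 < t) (j : Grid) :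
    HasDerivAt (fun s => en (u s) j) (2 * ∑ k : Fin 2,
      (inner ℝ (fd k (u t) j) (fd k (fld ν α (u t)) j) +
      inner ℝ (fd k (u t) (j - stp k)) (fd k (fld ν α (u t)) (j - stp k)))) t := by
  have h : ∀ k i, HasDerivAt (fun s => ‖fd k (u s) i‖ ^ 2)
      (2 * inner ℝ (fd k (u t) i) (fd k (fld ν α (u t)) i)) t := fun k i =>
    ((hu.hasDerivAt ht (i + stp k)).sub (hu.hasDerivAt ht i)).norm_sq
  unfold en
  rw [Finset.mul_sum]
  refine HasDerivAt.fun_sum fun k _ => ?_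
  rw [mul_add]
  exact (h k j).add (h k _)

/-- The localized energy inequality. -/
lemma exists_hasDerivAt_energy (hu : IsUnitSolution N ν α u) (hα : 0 < α)
    (hb : NormalBounds N ν c) {A : Finset Grid} {φ : Grid → ℝ} {L : ℝ} (hφ : IsCutoff A φ L)
    {t : ℝ} (ht : 0 < t) :
    ∃ D, HasDerivAt (fun s => 1 / 4 * ∑ j ∈ A, φ j ^ 2 * en (u s) j) D t ∧
      D ≤ -(α / (1 + α ^ 2) / 2 * ∑ j ∈ A, φ j ^ 2 * ‖fld ν α (u t) j‖ ^ 2) +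
      (2 / (α / (1 + α ^ 2)) + 2 * (1 + α ^ 2) + 1) * L ^ 2 * ∑ j ∈ A, en (u t) j := by
  refine ⟨_, (HasDerivAt.fun_sum fun j _ => (hu.hasDerivAt_en ht j).const_mul (φ j ^ 2)).const_mul _,
    (le_of_eq ?_).trans (hφ.energy_variation_le hα hb (hu.mem t ht.le))⟩
  rw [Finset.mul_sum, Finset.mul_sum]
  exact Finset.sum_congr rfl fun j _ => by ring

lemma continuousOn_energy (hu : IsUnitSolution N ν α u) (A : Finset Grid) (φ : Grid → ℝ) :
    ContinuousOn (fun s => 1 / 4 * ∑ j ∈ A, φ j ^ 2 * en (u s) j) (Set.Ici 0) :=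
  continuousOn_const.mul (continuousOn_finsetSum _ fun j _ =>
    continuousOn_const.mul (hu.continuousOn_en j))

lemma energy_le (hu : IsUnitSolution N ν α u) (hα : 0 < α)
    (hb : NormalBounds N ν c) {A : Finset Grid} {φ : Grid → ℝ} {L : ℝ} (hφ : IsCutoff A φ L)
    {a b K : ℝ} (ha : 0 ≤ a) (hab : a ≤ b) (hK : ∀ t ∈ Set.Icc a b, ∑ j ∈ A, en (u t) j ≤ K) :
    1 / 4 * ∑ j ∈ A, φ j ^ 2 * en (u b) j ≤ 1 / 4 * ∑ j ∈ A, φ j ^ 2 * en (u a) j +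
      (2 / (α / (1 + α ^ 2)) + 2 * (1 + α ^ 2) + 1) * L ^ 2 * K * (b - a) := by
  set C := (2 / (α / (1 + α ^ 2)) + 2 * (1 + α ^ 2) + 1) * L ^ 2 with hC
  have hC0 : 0 ≤ C := by positivity
  have h := le_of_hasDerivAt_nonpos (f := fun s => 1 / 4 * ∑ j ∈ A, φ j ^ 2 * en (u s) j -
    C * K * (s - a)) hab ?_ ?_
  · simp only [sub_self, mul_zero, sub_zero] at h
    linarith
  · refine ContinuousOn.sub ((hu.continuousOn_energy A φ).mono fun x hx => ha.trans hx.1) ?_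
    fun_prop
  · intro x hx
    obtain ⟨D, hD, hle⟩ := hu.exists_hasDerivAt_energy hα hb hφ (ha.trans_lt hx.1)
    rw [← hC] at hle
    refine ⟨D - C * K * 1, hD.sub (((hasDerivAt_id x).sub_const a).const_mul _), ?_⟩
    have h1 := mul_le_mul_of_nonneg_left (hK x (Set.Ioo_subset_Icc_self hx)) hC0
    have h2 : 0 ≤ α / (1 + α ^ 2) / 2 * ∑ j ∈ A, φ j ^ 2 * ‖fld ν α (u x) j‖ ^ 2 := by positivity
    linarith

end IsUnitSolution

end DiscreteLLG

namespace DiscreteLLG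

open Filter Topology

/-! ### Cutoff functions -/

/-- The sup-distance of the grid site `j` from the point `x`. -/
noncomputable def gdist (x : Fin 2 → ℝ) (j : Grid) : ℝ := ‖fun k => (j k : ℝ) - x k‖

lemma gdist_le_iff {x : Fin 2 → ℝ} {j : Grid} {r : ℝ} (hr : 0 ≤ r) :
    gdist x j ≤ r ↔ ∀ k, |(j k : ℝ) - x k| ≤ r :=
  pi_norm_le_iff_of_nonneg hr

lemma gdist_le_add {x : Fin 2 → ℝ} {i j : Grid} {m : ℝ} (hm : 0 ≤ m)
    (h : ∀ k, |(i k : ℝ) - j k| ≤ m) : gdist x i ≤ gdist x j + m := by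
  have h1 : ‖fun k => (i k : ℝ) - (j k : ℝ)‖ ≤ m := (pi_norm_le_iff_of_nonneg hm).2 h
  have h2 : (fun k => (i k : ℝ) - x k) =
      (fun k => (j k : ℝ) - x k) + fun k => (i k : ℝ) - (j k : ℝ) := by
    ext k; simp
  unfold gdist
  rw [h2]
  exact (norm_add_le _ _).trans (add_le_add le_rfl h1)

/-- The sites at sup-distance at most `r` from `x`. -/
noncomputable def box (x : Fin 2 → ℝ) (r : ℝ) : Finset Grid :=
  Fintype.piFinset fun k => Finset.Icc ⌈x k - r⌉ ⌊x k + r⌋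

lemma mem_box {x : Fin 2 → ℝ} {r : ℝ} (hr : 0 ≤ r) {j : Grid} : j ∈ box x r ↔ gdist x j ≤ r := by
  rw [gdist_le_iff hr, box, Fintype.mem_piFinset]
  refine forall_congr' fun k => ?_
  rw [Finset.mem_Icc, Int.ceil_le, Int.le_floor, abs_le]
  constructor <;> rintro ⟨h1, h2⟩ <;> constructor <;> linarith

lemma card_box_le (x : Fin 2 → ℝ) {r : ℝ} (hr : 0 ≤ r) :
    ((box x r).card : ℝ) ≤ (2 * r + 1) ^ 2 := by
  have h : ∀ k, ((Finset.Icc ⌈x k - r⌉ ⌊x k + r⌋).card : ℝ) ≤ 2 * r + 1 := by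
    intro k
    rw [Int.card_Icc]
    have h1 := Int.floor_le (x k + r)
    have h2 := Int.le_ceil (x k - r)
    have h3 : (((⌊x k + r⌋ + 1 - ⌈x k - r⌉).toNat : ℤ) : ℝ) ≤ 2 * r + 1 := by
      rw [Int.toNat_eq_max]
      push_cast
      exact max_le (by linarith) (by linarith)
    exact_mod_cast h3
  rw [box, Fintype.card_piFinset, Fin.prod_univ_two, Nat.cast_mul, sq]
  exact mul_le_mul (h 0) (h 1) (by positivity) (by positivity)

/-- The piecewise linear cutoff function that is `1` up to distance `b` and `0` from distance `a`
on. -/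
noncomputable def ramp (x : Fin 2 → ℝ) (a b : ℝ) (j : Grid) : ℝ :=
  max 0 (min 1 ((a - gdist x j) / (a - b)))

lemma ramp_eq_one {x : Fin 2 → ℝ} {a b : ℝ} (hab : b < a) {j : Grid} (hj : gdist x j ≤ b) :
    ramp x a b j = 1 := by
  have : 1 ≤ (a - gdist x j) / (a - b) := by
    rw [le_div_iff₀ (by linarith)]; linarith
  simp [ramp, this]

lemma gdist_lt_of_ramp_ne_zero {x : Fin 2 → ℝ} {a b : ℝ} (hab : b < a) {j : Grid}
    (hj : ramp x a b j ≠ 0) : gdist x j < a := by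
  by_contra! h
  refine hj ?_
  have : (a - gdist x j) / (a - b) ≤ 0 := div_nonpos_of_nonpos_of_nonneg (by linarith) (by linarith)
  exact max_eq_left ((min_le_right _ _).trans this)

/-- The margin `3` in the box is the padding required of a cutoff; a ramp of length at least one
makes the Lipschitz constant at most one. -/
lemma isCutoff_ramp (x : Fin 2 → ℝ) {a b : ℝ} (ha : 0 ≤ a) (hab : b + 1 ≤ a) :
    IsCutoff (box x (a + 3)) (ramp x a b) (1 / (a - b)) where
  nonneg j := le_max_left _ _
  le_one j := max_le zero_le_one (min_le_left _ _)
  lip_nonneg := one_div_nonneg.2 (by linarith)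
  lip_le_one := by rw [div_le_one (by linarith)]; linarith
  lip k j := by
    unfold ramp
    refine (abs_max_sub_max_le_max (0 : ℝ) _ 0 _).trans ?_
    rw [sub_self, abs_zero, max_eq_right (abs_nonneg _)]
    refine (abs_min_sub_min_le_max (1 : ℝ) _ 1 _).trans ?_
    rw [sub_self, abs_zero, max_eq_right (abs_nonneg _), ← sub_div, abs_div,
      abs_of_pos (by linarith : 0 < a - b)]
    refine div_le_div_of_nonneg_right ?_ (by linarith)
    have h1 : ∀ i : Fin 2, |(((j + stp k) i : ℤ) : ℝ) - j i| ≤ 1 := fun i => by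
      have := abs_stp_le k i
      rw [← Int.cast_sub, ← Int.cast_abs]
      simpa using (by exact_mod_cast this : ((|stp k i| : ℤ) : ℝ) ≤ 1)
    have h2 : ∀ i : Fin 2, |(j i : ℝ) - ((j + stp k) i : ℤ)| ≤ 1 := fun i => by
      rw [abs_sub_comm]; exact h1 i
    have h3 := gdist_le_add (x := x) zero_le_one h1
    have h4 := gdist_le_add (x := x) zero_le_one h2
    rw [abs_le]
    constructor <;> linarith
  pad j hj i hi := by
    have h1 := gdist_lt_of_ramp_ne_zero (by linarith) hj
    rw [mem_box (by linarith)]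
    have h2 : ∀ k, |(i k : ℝ) - j k| ≤ 3 := fun k => by
      rw [← Int.cast_sub, ← Int.cast_abs]
      exact_mod_cast hi k
    linarith [gdist_le_add (x := x) (by norm_num) h2]

lemma sum_le_sum_ramp {x : Fin 2 → ℝ} {a b : ℝ} (ha : 0 ≤ a) (hab : b + 1 ≤ a) {F : Finset Grid}
    (hF : ∀ j ∈ F, gdist x j ≤ b) {f : Grid → ℝ} (hf : ∀ j, 0 ≤ f j) :
    ∑ j ∈ F, f j ≤ ∑ j ∈ box x (a + 3), ramp x a b j ^ 2 * f j := by
  have h1 : ∑ j ∈ F, f j = ∑ j ∈ F, ramp x a b j ^ 2 * f j :=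
    Finset.sum_congr rfl fun j hj => by rw [ramp_eq_one (by linarith) (hF j hj)]; ring
  rw [h1]
  refine Finset.sum_le_sum_of_subset_of_nonneg (fun j hj => ?_)
    (fun j _ _ => mul_nonneg (sq_nonneg _) (hf j))
  rw [mem_box (by linarith)]
  linarith [hF j hj]

lemma IsCutoff.sum_mul_le {A : Finset Grid} {φ : Grid → ℝ} {L : ℝ} (hφ : IsCutoff A φ L)
    {f : Grid → ℝ} (hf : ∀ j, 0 ≤ f j) : ∑ j ∈ A, φ j ^ 2 * f j ≤ ∑ j ∈ A, f j :=
  Finset.sum_le_sum fun j _ => mul_le_of_le_one_left (hf j) (pow_le_one₀ (hφ.nonneg j) (hφ.le_one j))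

/-! ### The global energy inequality -/

namespace IsUnitSolution

variable {N : Set Space} {ν : Space → Space} {c α : ℝ} {u : ℝ → GridFun}

/-- The cutoff decreases between distances `n` and `2 * n`, so the energy flux is of order `K * T /
n ^ 2`. -/
lemma sum_en_le_add (hu : IsUnitSolution N ν α u) (hα : 0 < α) (hb : NormalBounds N ν c) {E : ℝ}
    (hE : ∀ F : Finset Grid, ∑ j ∈ F, en (u 0) j ≤ E) {T : ℝ} (hT : 0 ≤ T) {n K : ℝ} (hn : 1 ≤ n)
    (hK : ∀ t ∈ Set.Icc 0 T, ∑ j ∈ box 0 (2 * n + 3), en (u t) j ≤ K) {F : Finset Grid}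
    (hF : ∀ j ∈ F, gdist 0 j ≤ n) :
    ∑ j ∈ F, en (u T) j ≤ E +
      4 * ((2 / (α / (1 + α ^ 2)) + 2 * (1 + α ^ 2) + 1) * (1 / n) ^ 2 * K * T) := by
  have hφ := isCutoff_ramp 0 (a := 2 * n) (b := n) (by linarith) (by linarith)
  have h1 := hu.energy_le hα hb hφ le_rfl hT hK
  have h2 := sum_le_sum_ramp (x := 0) (a := 2 * n) (b := n) (by linarith) (by linarith) hF
    (en_nonneg (u T))
  have h3 := (hφ.sum_mul_le (en_nonneg (u 0))).trans (hE _)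
  rw [show 2 * n - n = n by ring, sub_zero] at h1
  linarith

/-- The energy of a solution is bounded by the energy of its initial datum. -/
lemma sum_en_le (hu : IsUnitSolution N ν α u) (hα : 0 < α) (hb : NormalBounds N ν c) {E : ℝ}
    (hE : ∀ F : Finset Grid, ∑ j ∈ F, en (u 0) j ≤ E) {T : ℝ} (hT : 0 ≤ T) (F : Finset Grid) :
    ∑ j ∈ F, en (u T) j ≤ E := by
  set C := 2 / (α / (1 + α ^ 2)) + 2 * (1 + α ^ 2) + 1 with hC
  have hC0 : 0 < C := by positivity
  have hbd : ∀ F : Finset Grid, ∃ n : ℝ, 1 ≤ n ∧ ∀ j ∈ F, gdist 0 j ≤ n := by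
    intro F
    obtain ⟨m, hm⟩ := (F.image (gdist 0)).exists_le
    exact ⟨max 1 m, le_max_left _ _, fun j hj =>
      (hm _ (Finset.mem_image_of_mem _ hj)).trans (le_max_right _ _)⟩
  have hc2 : 0 ≤ c ^ 2 := sq_nonneg c
  set K := E + 4 * (C * (484 * c ^ 2) * T) with hK
  have hE0 : 0 ≤ E := by simpa using hE ∅
  have hK0 : 0 ≤ K := by positivity
  -- First pass: bounded density gives energy at most `484 * c ^ 2 * n ^ 2` on the box, and this
  -- growth is cancelled by the factor `(1 / n) ^ 2` in the flux. The result is a crude bound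
  -- uniform in `n`.
  have step1 : ∀ t ∈ Set.Icc 0 T, ∀ F : Finset Grid, ∑ j ∈ F, en (u t) j ≤ K := by
    rintro t ⟨ht0, htT⟩ F
    obtain ⟨n, hn, hF⟩ := hbd F
    have h1 : ∀ s ∈ Set.Icc 0 t, ∑ j ∈ box 0 (2 * n + 3), en (u s) j ≤ 484 * c ^ 2 * n ^ 2 := by
      intro s hs
      refine (Finset.sum_le_card_nsmul _ _ _ fun j _ => hb.en_le (hu.mem s hs.1) j).trans ?_
      rw [nsmul_eq_mul]
      have h2 := card_box_le 0 (r := 2 * n + 3) (by linarith)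
      have h3 : (2 * (2 * n + 3) + 1) ^ 2 ≤ 121 * n ^ 2 := by nlinarith
      refine (mul_le_mul_of_nonneg_right (h2.trans ?_) (by positivity)).trans_eq
        (show 121 * n ^ 2 * (4 * c ^ 2) = _ by ring)
      nlinarith
    have h2 := hu.sum_en_le_add hα hb hE ht0 hn h1 hF
    rw [← hC] at h2
    have h3 : C * (1 / n) ^ 2 * (484 * c ^ 2 * n ^ 2) * t = C * (484 * c ^ 2) * t := by
      field_simp
    rw [h3] at h2
    have h4 : C * (484 * c ^ 2) * t ≤ C * (484 * c ^ 2) * T :=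
      mul_le_mul_of_nonneg_left htT (by positivity)
    linarith
  -- Second pass: with the crude bound as `K`, the flux tends to zero as `n` grows.
  refine le_of_forall_pos_le_add fun ε hε => ?_
  obtain ⟨n₀, hn₀, hF⟩ := hbd F
  set m := 4 * C * K * T / ε with hm
  have hm0 : 0 ≤ m := by positivity
  have hn : 1 ≤ max n₀ m := hn₀.trans (le_max_left _ _)
  have h2 := hu.sum_en_le_add hα hb hE hT hn (fun t ht => step1 t ht _)
    (fun j hj => (hF j hj).trans (le_max_left _ _))
  rw [← hC] at h2
  refine h2.trans ?_
  have hmn : m ≤ max n₀ m := le_max_right _ _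
  set n := max n₀ m
  have h3 : 4 * (C * (1 / n) ^ 2 * K * T) = m * ε / n ^ 2 := by
    rw [hm]; field_simp
  have h4 : m * ε / n ^ 2 ≤ ε := by
    rw [div_le_iff₀ (by positivity)]
    have : m ≤ n ^ 2 := by nlinarith
    nlinarith
  linarith

end IsUnitSolution

end DiscreteLLG

namespace DiscreteLLG

open Filter Topology

/-! ### The evolution of the velocity -/

lemma sum_inner_lap {A : Finset Grid} {φ : Grid → ℝ} {L : ℝ} (hφ : IsCutoff A φ L) (a b : GridFun)
    (ha : ∀ j, Far φ j → a j = 0) :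
    ∑ j ∈ A, inner ℝ (a j) (lap b j) = -∑ j ∈ A, ∑ k : Fin 2, inner ℝ (fd k a j) (fd k b j) := by
  simp only [lap, inner_sum]
  rw [Finset.sum_comm, Finset.sum_comm (s := A), ← Finset.sum_neg_distrib]
  exact Finset.sum_congr rfl fun k _ => hφ.sum_inner_pureDiff k a (fd k b) ha

lemma inner_fd_sq_smul (φ : Grid → ℝ) (v : GridFun) (k : Fin 2) (j : Grid) :
    inner ℝ (fd k (fun i => φ i ^ 2 • v i) j) (fd k v j) =
      ‖fd k (fun i => φ i • v i) j‖ ^ 2 - fd k φ j ^ 2 * inner ℝ (v j) (v (j + stp k)) := by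
  simp only [fd, norm_sub_sq_real, inner_sub_left, inner_sub_right, inner_smul_left,
    inner_smul_right, norm_smul, Real.norm_eq_abs, mul_pow, sq_abs, conj_trivial,
    real_inner_self_eq_norm_sq, real_inner_comm (v j) (v (j + stp k))]
  ring

/-- The product rule would also produce `fd k v` paired with a vector product containing `fd k v`,
which vanishes. Only differences of `n` and of the cutoff survive. -/
lemma inner_fd_sq_smul_cross (φ : Grid → ℝ) (v n : GridFun) (k : Fin 2) (j : Grid) :
    -inner ℝ (fd k (fun i => φ i ^ 2 • cross (v i) (n i)) j) (fd k v j) =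
      φ (j + stp k) ^ 2 * inner ℝ (fd k v j) (cross (fd k n j) (v j)) +
      (φ (j + stp k) ^ 2 - φ j ^ 2) * inner ℝ (fd k v j) (cross (n j) (v j)) := by
  simp only [fd, inner_eq_three, PiLp.sub_apply, PiLp.smul_apply, cross_zero_coord, cross_one_coord,
    cross_two_coord, smul_eq_mul]
  ring

/-- Young's inequality with `γ`, `g`, `δ`, `m` standing for the norms of the differences of `φ • v`,
of `φ • v`, and of the differences of `u` and `ν`. Terms with a factor `g` use `m ≤ c * δ`; the
others use `m ≤ 2`. -/
lemma cross_term_le {α c γ g m ℓ x x' δ : ℝ} (hα : 0 < α) (hγ : 0 ≤ γ) (hg : 0 ≤ g) (hx : 0 ≤ x)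
    (hℓ0 : 0 ≤ ℓ) (m1 : m ≤ 2) (m2 : m ≤ c * δ) :
    (γ + ℓ * x) * (g + ℓ * x) * m + ℓ * (2 * γ + ℓ * x + ℓ * x') * x ≤
      3 * α / 8 * γ ^ 2 + ((2 / α + 1 / 2) * c ^ 2 * (g ^ 2 * δ ^ 2) +
        ((16 / α + 4) * (ℓ ^ 2 * x ^ 2) + (16 / α + 4) * (ℓ ^ 2 * x' ^ 2))) := by
  have y1 : γ * g * m ≤ α / 8 * γ ^ 2 + 2 / α * (c ^ 2 * (g ^ 2 * δ ^ 2)) := by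
    have q1 : γ * g * m ≤ γ * g * (c * δ) := mul_le_mul_of_nonneg_left m2 (by positivity)
    have q2 : 0 ≤ α / 8 * (γ - 4 / α * (c * (g * δ))) ^ 2 := by positivity
    have q3 : α / 8 * (γ - 4 / α * (c * (g * δ))) ^ 2 = α / 8 * γ ^ 2 +
        2 / α * (c ^ 2 * (g ^ 2 * δ ^ 2)) - γ * g * (c * δ) := by
      field_simp; ring
    linarith
  have y2 : γ * (ℓ * x) * m ≤ α / 8 * γ ^ 2 + 8 / α * (ℓ ^ 2 * x ^ 2) := by
    have q1 : γ * (ℓ * x) * m ≤ γ * (ℓ * x) * 2 := mul_le_mul_of_nonneg_left m1 (by positivity)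
    have q2 : 0 ≤ α / 8 * (γ - 8 / α * (ℓ * x)) ^ 2 := by positivity
    have q3 : α / 8 * (γ - 8 / α * (ℓ * x)) ^ 2 = α / 8 * γ ^ 2 +
        8 / α * (ℓ ^ 2 * x ^ 2) - γ * (ℓ * x) * 2 := by
      field_simp; ring
    linarith
  have y3 : ℓ * x * g * m ≤ 1 / 2 * (ℓ ^ 2 * x ^ 2) + 1 / 2 * (c ^ 2 * (g ^ 2 * δ ^ 2)) := by
    have q1 : ℓ * x * g * m ≤ ℓ * x * g * (c * δ) := mul_le_mul_of_nonneg_left m2 (by positivity)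
    nlinarith [sq_nonneg (ℓ * x - c * (g * δ))]
  have y4 : ℓ * x * (ℓ * x) * m ≤ 2 * (ℓ ^ 2 * x ^ 2) := by
    have := mul_le_mul_of_nonneg_left m1 (by positivity : 0 ≤ ℓ * x * (ℓ * x))
    linarith
  have y5 : ℓ * (2 * γ) * x ≤ α / 8 * γ ^ 2 + 8 / α * (ℓ ^ 2 * x ^ 2) := by
    have q2 : 0 ≤ α / 8 * (γ - 8 / α * (ℓ * x)) ^ 2 := by positivity
    have q3 : α / 8 * (γ - 8 / α * (ℓ * x)) ^ 2 = α / 8 * γ ^ 2 +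
        8 / α * (ℓ ^ 2 * x ^ 2) - γ * (ℓ * x) * 2 := by
      field_simp; ring
    linarith
  have y6 : ℓ * (ℓ * x') * x ≤ 1 / 2 * (ℓ ^ 2 * x ^ 2) + 1 / 2 * (ℓ ^ 2 * x' ^ 2) := by
    nlinarith [sq_nonneg (ℓ * x - ℓ * x')]
  have z1 : 0 ≤ 16 / α * (ℓ ^ 2 * x' ^ 2) := by positivity
  have z2 : 0 ≤ ℓ ^ 2 * x' ^ 2 := by positivity
  have e9 : 8 / α * (ℓ ^ 2 * x ^ 2) + 8 / α * (ℓ ^ 2 * x ^ 2) = 16 / α * (ℓ ^ 2 * x ^ 2) := by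
    ring
  have z3 : 0 ≤ ℓ ^ 2 * x ^ 2 := by positivity
  linarith

lemma absorb_cross_term_le {α C X Y G Γ : ℝ} (hα : 0 < α) (hC : 0 ≤ C) (hX : 0 ≤ X) (hY : 0 ≤ Y)
    (hG : 0 ≤ G) (hΓ : 0 ≤ Γ) (h : X ^ 2 ≤ 4 * (Y * Γ) * G) :
    C * X ≤ α / 2 * Γ + 2 * C ^ 2 / α * (Y * G) := by
  refine (sq_le_sq₀ (by positivity) (by positivity)).1 ?_
  have e : (α / 2 * Γ + 2 * C ^ 2 / α * (Y * G)) ^ 2 =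
      (α / 2 * Γ - 2 * C ^ 2 / α * (Y * G)) ^ 2 + C ^ 2 * (4 * (Y * Γ) * G) := by
    field_simp; ring
  rw [e, mul_pow]
  have := mul_le_mul_of_nonneg_left h (sq_nonneg C)
  linarith [sq_nonneg (α / 2 * Γ - 2 * C ^ 2 / α * (Y * G))]

/-- Cauchy–Schwarz followed by Ladyzhenskaya for `g`: the product is controlled by its energy, which
the damping can absorb. -/
lemma sum_mul_sq_le {A : Finset Grid} {φ : Grid → ℝ} {L : ℝ} (hφ : IsCutoff A φ L) (g : GridFun)
    (hg : ∀ j, φ j = 0 → g j = 0) (a b : Grid → ℝ) :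
    (∑ j ∈ A, ‖g j‖ ^ 2 * (a j + b j)) ^ 2 ≤
      4 * ((∑ j ∈ A, ‖g j‖ ^ 2) * ∑ j ∈ A, (‖fd 0 g j‖ ^ 2 + ‖fd 1 g j‖ ^ 2)) *
        ∑ j ∈ A, (a j ^ 2 + b j ^ 2) := by
  have a1 := Finset.sum_mul_sq_le_sq_mul_sq A (fun j => ‖g j‖ ^ 2) (fun j => a j + b j)
  have a2 := hφ.ladyzhenskaya_of_support g hg
  have a3 : ∑ j ∈ A, (‖g j‖ ^ 2) ^ 2 = ∑ j ∈ A, ‖g j‖ ^ 4 :=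
    Finset.sum_congr rfl fun j _ => by ring
  have a4 : ∑ j ∈ A, (a j + b j) ^ 2 ≤ 2 * ∑ j ∈ A, (a j ^ 2 + b j ^ 2) := by
    rw [Finset.mul_sum]
    exact Finset.sum_le_sum fun j _ => by nlinarith [sq_nonneg (a j - b j)]
  rw [a3] at a1
  have a5 := mul_le_mul a2 a4 (by positivity) (by positivity)
  linarith

namespace IsCutoff

variable {A : Finset Grid} {φ : Grid → ℝ} {L : ℝ}

lemma sum_inner_lap_le (hφ : IsCutoff A φ L) (v : GridFun) :
    ∑ j ∈ A, φ j ^ 2 * inner ℝ (v j) (lap v j) ≤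
      -∑ j ∈ A, (‖fd 0 (fun i => φ i • v i) j‖ ^ 2 + ‖fd 1 (fun i => φ i • v i) j‖ ^ 2) +
        2 * L ^ 2 * ∑ j ∈ A, ‖v j‖ ^ 2 := by
  have h := sum_inner_lap hφ (fun j => φ j ^ 2 • v j) v (fun j hj => by simp [hj.self])
  simp only [inner_smul_left, conj_trivial, inner_fd_sq_smul] at h
  rw [h]
  have hs0 := hφ.sum_chi_le (fun j => ‖v j‖ ^ 2) (fun j => by positivity)
  have hs1 := fun k => hφ.sum_chi_add_le (fun j => ‖v j‖ ^ 2) (fun j => by positivity) k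
  have key : ∀ k, ∑ j ∈ A, fd k φ j ^ 2 * inner ℝ (v j) (v (j + stp k)) ≤
      L ^ 2 * ∑ j ∈ A, ‖v j‖ ^ 2 := by
    intro k
    have h1 : ∑ j ∈ A, fd k φ j ^ 2 * inner ℝ (v j) (v (j + stp k)) ≤
        ∑ j ∈ A, (L ^ 2 / 2 * (chi φ j * ‖v j‖ ^ 2) +
          L ^ 2 / 2 * (chi φ j * ‖v (j + stp k)‖ ^ 2)) := by
      refine Finset.sum_le_sum fun j _ => ?_
      have a1 := pow_le_pow_left₀ (abs_nonneg _) (hφ.lip_chi k j) 2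
      rw [sq_abs, mul_pow, chi_sq] at a1
      have a2 : inner ℝ (v j) (v (j + stp k)) ≤ (‖v j‖ ^ 2 + ‖v (j + stp k)‖ ^ 2) / 2 := by
        have := real_inner_le_norm (v j) (v (j + stp k))
        nlinarith [sq_nonneg (‖v j‖ - ‖v (j + stp k)‖)]
      have a3 := mul_le_mul_of_nonneg_left a2 (sq_nonneg (fd k φ j))
      have a4 := mul_le_mul_of_nonneg_right a1
        (by positivity : 0 ≤ (‖v j‖ ^ 2 + ‖v (j + stp k)‖ ^ 2) / 2)
      simp only [fd] at a3 ⊢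
      linarith
    rw [Finset.sum_add_distrib, ← Finset.mul_sum, ← Finset.mul_sum] at h1
    have h2 := mul_le_mul_of_nonneg_left hs0 (by positivity : 0 ≤ L ^ 2 / 2)
    have h3 := mul_le_mul_of_nonneg_left (hs1 k) (by positivity : 0 ≤ L ^ 2 / 2)
    linarith
  simp only [Fin.sum_univ_two, Finset.sum_add_distrib, Finset.sum_sub_distrib]
  linarith [key 0, key 1]

/-- After summation by parts, antisymmetry leaves only terms with a difference of `ν` or of `φ`, and
these use just `3 / 8` of the dissipation. -/
lemma sum_inner_cross_lap_le (hφ : IsCutoff A φ L) {N : Set Space} {ν : Space → Space} {c α : ℝ}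
    (hα : 0 < α) (hb : NormalBounds N ν c) {u : GridFun} (hu : ∀ j, u j ∈ N) (v : GridFun) :
    ∑ j ∈ A, φ j ^ 2 * inner ℝ (v j) (cross (ν (u j)) (lap v j)) ≤
      3 * α / 8 *
        ∑ j ∈ A, (‖fd 0 (fun i => φ i • v i) j‖ ^ 2 + ‖fd 1 (fun i => φ i • v i) j‖ ^ 2) +
      (2 / α + 1 / 2) * c ^ 2 * ∑ j ∈ A, ‖φ j • v j‖ ^ 2 * en u j +
      4 * (16 / α + 4) * L ^ 2 * ∑ j ∈ A, ‖v j‖ ^ 2 := by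
  have h := sum_inner_lap hφ (fun j => φ j ^ 2 • cross (v j) (ν (u j))) v
    (fun j hj => by simp [hj.self])
  have e1 : ∑ j ∈ A, φ j ^ 2 * inner ℝ (v j) (cross (ν (u j)) (lap v j)) =
      ∑ j ∈ A, inner ℝ (φ j ^ 2 • cross (v j) (ν (u j))) (lap v j) :=
    Finset.sum_congr rfl fun j _ => by
      rw [inner_cross_rotate, inner_smul_left, conj_trivial]
  rw [e1, h, ← Finset.sum_neg_distrib]
  simp only [← Finset.sum_neg_distrib]
  rw [Finset.sum_congr rfl fun j _ => Finset.sum_congr rfl fun k _ =>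
    inner_fd_sq_smul_cross φ v (fun i => ν (u i)) k j]
  have hs0 := hφ.sum_chi_le (fun j => ‖v j‖ ^ 2) (fun j => by positivity)
  have hs1 := fun k => hφ.sum_chi_add_le (fun j => ‖v j‖ ^ 2) (fun j => by positivity) k
  have key : ∀ j ∈ A, ∑ k : Fin 2, (φ (j + stp k) ^ 2 *
      inner ℝ (fd k v j) (cross (fd k (fun i => ν (u i)) j) (v j)) +
      (φ (j + stp k) ^ 2 - φ j ^ 2) * inner ℝ (fd k v j) (cross (ν (u j)) (v j))) ≤
      ∑ k : Fin 2, (3 * α / 8 * ‖fd k (fun i => φ i • v i) j‖ ^ 2 +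
        ((2 / α + 1 / 2) * c ^ 2 * (‖φ j • v j‖ ^ 2 * ‖fd k u j‖ ^ 2) +
        ((16 / α + 4) * L ^ 2 * (chi φ j * ‖v j‖ ^ 2) +
        (16 / α + 4) * L ^ 2 * (chi φ j * ‖v (j + stp k)‖ ^ 2)))) := by
    intro j _
    refine Finset.sum_le_sum fun k _ => ?_
    have hf0 := hφ.nonneg j
    have hf1 := hφ.nonneg (j + stp k)
    have a1 := hφ.lip_chi k j
    set f := φ j
    set f' := φ (j + stp k)
    set ℓ := L * chi φ j with hℓ
    have hℓ0 : 0 ≤ ℓ := mul_nonneg hφ.lip_nonneg (chi_nonneg _ _)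
    have hℓ2 : ℓ ^ 2 = L ^ 2 * chi φ j := by rw [hℓ, mul_pow, chi_sq]
    have b1 : f' * ‖fd k v j‖ ≤ ‖fd k (fun i => φ i • v i) j‖ + ℓ * ‖v j‖ := by
      have e : f' • fd k v j = fd k (fun i => φ i • v i) j - (f' - f) • v j := by
        simp only [fd, f, f']; module
      have := norm_sub_le (fd k (fun i => φ i • v i) j) ((f' - f) • v j)
      rw [← e, norm_smul, norm_smul, Real.norm_of_nonneg hf1, Real.norm_eq_abs] at this
      linarith [mul_le_mul_of_nonneg_right a1 (norm_nonneg (v j))]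
    have b2 : f * ‖fd k v j‖ ≤ ‖fd k (fun i => φ i • v i) j‖ + ℓ * ‖v (j + stp k)‖ := by
      have e : f • fd k v j = fd k (fun i => φ i • v i) j - (f' - f) • v (j + stp k) := by
        simp only [fd, f, f']; module
      have := norm_sub_le (fd k (fun i => φ i • v i) j) ((f' - f) • v (j + stp k))
      rw [← e, norm_smul, norm_smul, Real.norm_of_nonneg hf0, Real.norm_eq_abs] at this
      linarith [mul_le_mul_of_nonneg_right a1 (norm_nonneg (v (j + stp k)))]
    have b3 : f' * ‖v j‖ ≤ ‖f • v j‖ + ℓ * ‖v j‖ := by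
      rw [norm_smul, Real.norm_of_nonneg hf0, ← add_mul]
      exact mul_le_mul_of_nonneg_right (by linarith [(abs_le.1 a1).2]) (norm_nonneg _)
    have m1 : ‖fd k (fun i => ν (u i)) j‖ ≤ 2 := by
      have := norm_sub_le (ν (u (j + stp k))) (ν (u j))
      rw [hb.unit _ (hu _), hb.unit _ (hu _)] at this
      exact this.trans (by norm_num)
    have m2 : ‖fd k (fun i => ν (u i)) j‖ ≤ c * ‖fd k u j‖ := hb.lip _ (hu _) _ (hu _)
    have t1 := (le_abs_self _).trans (abs_inner_cross_le (fd k v j) (fd k (fun i => ν (u i)) j) (v j))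
    have t2 := abs_inner_cross_le (fd k v j) (ν (u j)) (v j)
    rw [hb.unit _ (hu j), mul_one] at t2
    set γ := ‖fd k (fun i => φ i • v i) j‖
    set d := ‖fd k v j‖
    set m := ‖fd k (fun i => ν (u i)) j‖
    set x := ‖v j‖
    set x' := ‖v (j + stp k)‖
    set g := ‖f • v j‖
    set δ := ‖fd k u j‖
    have hγ : 0 ≤ γ := norm_nonneg _
    have hd : 0 ≤ d := norm_nonneg _
    have hm : 0 ≤ m := norm_nonneg _
    have hx : 0 ≤ x := norm_nonneg _
    have hx' : 0 ≤ x' := norm_nonneg _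
    have hg : 0 ≤ g := norm_nonneg _
    have hc : 0 ≤ c := zero_le_one.trans hb.one_le
    have T1 : f' ^ 2 * inner ℝ (fd k v j) (cross (fd k (fun i => ν (u i)) j) (v j)) ≤
        (γ + ℓ * x) * (g + ℓ * x) * m := by
      have p1 := mul_le_mul_of_nonneg_left t1 (sq_nonneg f')
      have p2 := mul_le_mul b1 b3 (by positivity) (by positivity)
      have p3 := mul_le_mul_of_nonneg_right p2 hm
      calc _ ≤ f' ^ 2 * (d * m * x) := p1
        _ = f' * d * (f' * x) * m := by ring
        _ ≤ _ := p3
    have T2 : (f' ^ 2 - f ^ 2) * inner ℝ (fd k v j) (cross (ν (u j)) (v j)) ≤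
        ℓ * (2 * γ + ℓ * x + ℓ * x') * x := by
      have p1 : |f' ^ 2 - f ^ 2| ≤ ℓ * (f + f') := by
        rw [show f' ^ 2 - f ^ 2 = (f' - f) * (f + f') by ring, abs_mul,
          abs_of_nonneg (by positivity : 0 ≤ f + f')]
        exact mul_le_mul_of_nonneg_right a1 (by positivity)
      have p2 := mul_le_mul p1 t2 (abs_nonneg _) (by positivity)
      rw [← abs_mul] at p2
      have p3 : ℓ * x * (f * d + f' * d) ≤ ℓ * x * ((γ + ℓ * x') + (γ + ℓ * x)) :=
        mul_le_mul_of_nonneg_left (add_le_add b2 b1) (by positivity)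
      have p4 := (le_abs_self _).trans p2
      linarith
    have T3 := cross_term_le (x' := x') hα hγ hg hx hℓ0 m1 m2
    have e7 : (16 / α + 4) * L ^ 2 * (chi φ j * x ^ 2) = (16 / α + 4) * (ℓ ^ 2 * x ^ 2) := by
      rw [hℓ2]; ring
    have e8 : (16 / α + 4) * L ^ 2 * (chi φ j * x' ^ 2) = (16 / α + 4) * (ℓ ^ 2 * x' ^ 2) := by
      rw [hℓ2]; ring
    rw [e7, e8]
    linarith only [T1, T2, T3]
  refine (Finset.sum_le_sum key).trans ?_
  simp only [Fin.sum_univ_two]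
  simp only [Finset.sum_add_distrib]
  simp only [← Finset.mul_sum]
  have hen : ∑ j ∈ A, ‖φ j • v j‖ ^ 2 * ‖fd 0 u j‖ ^ 2 + ∑ j ∈ A, ‖φ j • v j‖ ^ 2 * ‖fd 1 u j‖ ^ 2 ≤
      ∑ j ∈ A, ‖φ j • v j‖ ^ 2 * en u j := by
    rw [← Finset.sum_add_distrib]
    refine Finset.sum_le_sum fun j _ => ?_
    rw [← mul_add]
    refine mul_le_mul_of_nonneg_left ?_ (sq_nonneg _)
    simp only [en, Fin.sum_univ_two]
    linarith [sq_nonneg ‖fd 0 u (j - stp 0)‖, sq_nonneg ‖fd 1 u (j - stp 1)‖]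
  have hen2 := mul_le_mul_of_nonneg_left hen (by positivity : 0 ≤ (2 / α + 1 / 2) * c ^ 2)
  have hp : 0 ≤ (16 / α + 4) * L ^ 2 := by positivity
  have r0 := mul_le_mul_of_nonneg_left hs0 hp
  have r1 := mul_le_mul_of_nonneg_left (hs1 0) hp
  have r2 := mul_le_mul_of_nonneg_left (hs1 1) hp
  linarith

end IsCutoff

variable {N : Set Space} {ν : Space → Space} {c α : ℝ}

namespace IsUnitSolution

variable {u : ℝ → GridFun}

lemma hasDerivAt_lap (hu : IsUnitSolution N ν α u) {t : ℝ} (ht : 0 < t) (j : Grid) :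
    HasDerivAt (fun s => lap (u s) j) (lap (fld ν α (u t)) j) t := by
  unfold lap
  refine HasDerivAt.fun_sum fun k _ => ?_
  exact ((hu.hasDerivAt ht _).sub (hu.hasDerivAt ht _)).sub
    ((hu.hasDerivAt ht _).sub (hu.hasDerivAt ht _))

/-- Testing with the velocity, which is tangential, kills the derivative of the Lagrange multiplier;
of the multiplier term only the derivative `n'` of the normal remains. -/
lemma exists_hasDerivAt_fld (hu : IsUnitSolution N ν α u) (hb : NormalBounds N ν c) {t : ℝ}
    (ht : 0 < t) (j : Grid) :
    ∃ v' n' : Space, HasDerivAt (fun s => fld ν α (u s) j) v' t ∧ ‖n'‖ ≤ c * ‖fld ν α (u t) j‖ ∧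
      inner ℝ (fld ν α (u t) j) v' =
        inner ℝ (fld ν α (u t) j) (cross (ν (u t j)) (lap (fld ν α (u t)) j)) +
        α * inner ℝ (fld ν α (u t) j) (lap (fld ν α (u t)) j) +
        (inner ℝ (fld ν α (u t) j) (cross n' (lap (u t) j)) -
        α * (inner ℝ (lap (u t) j) (ν (u t j)) * inner ℝ (fld ν α (u t) j) n')) := by
  have hmem : ∀ᶠ s in 𝓝 t, u s j ∈ N := by
    filter_upwards [Ioi_mem_nhds ht] with s hs
    exact hu.mem s (le_of_lt hs) j
  obtain ⟨n', hn', hle⟩ := hb.hasDeriv _ _ _ (hu.hasDerivAt ht j) hmem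
  have hl := hu.hasDerivAt_lap ht j
  have hd := (hn'.cross hl).add ((hl.sub ((hl.inner ℝ hn').smul hn')).const_smul α)
  refine ⟨_, n', hd, hle, ?_⟩
  have h0 : inner ℝ (fld ν α (u t) j) (ν (u t j)) = 0 :=
    inner_field_normal (hb.unit _ (hu.mem t ht.le j)) (rfl : fld ν α (u t) j = _)
  simp only [inner_add_right, inner_sub_right, inner_smul_right, h0]
  ring

lemma continuousOn_fld (hu : IsUnitSolution N ν α u) (hb : NormalBounds N ν c) (j : Grid) :
    ContinuousOn (fun s => fld ν α (u s) j) (Set.Ici 0) := by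
  have hl : ContinuousOn (fun s => lap (u s) j) (Set.Ici 0) := by
    unfold lap
    exact continuousOn_finsetSum _ fun k _ => ((hu.continuousOn _).sub (hu.continuousOn _)).sub
      ((hu.continuousOn _).sub (hu.continuousOn _))
  have hn : ContinuousOn (fun s => ν (u s j)) (Set.Ici 0) :=
    hb.continuousOn.comp (hu.continuousOn j) fun s hs => hu.mem s hs j
  have h1 : ContinuousOn (fun s => (inner ℝ (lap (u s) j) (ν (u s j)) : ℝ)) (Set.Ici 0) :=
    hl.inner hn
  have h2 : ContinuousOn (fun s => (inner ℝ (lap (u s) j) (ν (u s j)) : ℝ) • ν (u s j))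
    (Set.Ici 0) := h1.smul hn
  have h3 : ContinuousOn (fun s => cross (ν (u s j)) (lap (u s) j)) (Set.Ici 0) :=
    continuous_cross.comp_continuousOn (hn.prodMk hl)
  have h4 : ContinuousOn (fun s => α • (lap (u s) j - (inner ℝ (lap (u s) j) (ν (u s j)) : ℝ) •
    ν (u s j))) (Set.Ici 0) := (hl.sub h2).const_smul α
  exact h3.add h4

end IsUnitSolution

/-- The differential inequality for the localized `L²`-norm of the velocity. -/
lemma NormalBounds.exists_velocity_inequality (hb : NormalBounds N ν c) (hα : 0 < α) :
    ∃ C : ℝ, 0 ≤ C ∧ ∀ u : ℝ → GridFun, IsUnitSolution N ν α u →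
      ∀ (A : Finset Grid) (φ : Grid → ℝ) (L : ℝ), IsCutoff A φ L → ∀ t : ℝ, 0 < t →
      ∃ D, HasDerivAt (fun s => ∑ j ∈ A, φ j ^ 2 * ‖fld ν α (u s) j‖ ^ 2) D t ∧
        D ≤ C * (∑ j ∈ A, (‖lap (u t) j‖ ^ 2 + en (u t) j ^ 2)) *
            ∑ j ∈ A, φ j ^ 2 * ‖fld ν α (u t) j‖ ^ 2 +
          C * L ^ 2 * ∑ j ∈ A, ‖fld ν α (u t) j‖ ^ 2 := by
  have hc1 := hb.one_le
  set C₂ := (2 / α + 1 / 2 + α + 1) * c ^ 2 with hC₂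
  set C₃ := 2 * (2 * α + 4 * (16 / α + 4)) with hC₃
  have hC₂0 : 0 ≤ C₂ := by positivity
  have hC₃0 : 0 ≤ C₃ := by positivity
  refine ⟨4 * C₂ ^ 2 / α + C₃, by positivity, fun u hu A φ L hφ t ht => ?_⟩
  have hut := hu.mem t ht.le
  choose v' n' hv' hn' hin using fun j => hu.exists_hasDerivAt_fld hb ht j
  set v := fld ν α (u t) with hv
  refine ⟨_, HasDerivAt.fun_sum fun j _ => ((hv' j).norm_sq).const_mul (φ j ^ 2), ?_⟩
  simp only [← hv]
  set G := ∑ j ∈ A, (‖lap (u t) j‖ ^ 2 + en (u t) j ^ 2) with hG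
  set Γ := ∑ j ∈ A, (‖fd 0 (fun i => φ i • v i) j‖ ^ 2 + ‖fd 1 (fun i => φ i • v i) j‖ ^ 2) with hΓ
  have hY : ∑ j ∈ A, φ j ^ 2 * ‖v j‖ ^ 2 = ∑ j ∈ A, ‖φ j • v j‖ ^ 2 :=
    Finset.sum_congr rfl fun j _ => by rw [norm_smul, mul_pow, Real.norm_eq_abs, sq_abs]
  rw [hY]
  set Y := ∑ j ∈ A, ‖φ j • v j‖ ^ 2 with hYdef
  set V := ∑ j ∈ A, ‖v j‖ ^ 2 with hV
  set X := ∑ j ∈ A, ‖φ j • v j‖ ^ 2 * (‖lap (u t) j‖ + en (u t) j) with hX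
  have hG0 : 0 ≤ G := by positivity
  have hΓ0 : 0 ≤ Γ := by positivity
  have hY0 : 0 ≤ Y := by positivity
  have hV0 : 0 ≤ V := by positivity
  have hX0 : 0 ≤ X := Finset.sum_nonneg fun j _ =>
    mul_nonneg (sq_nonneg _) (add_nonneg (norm_nonneg _) (en_nonneg _ _))
  have h1 := hφ.sum_inner_lap_le v
  have h2 := hφ.sum_inner_cross_lap_le hα hb hut v
  have hXen : ∑ j ∈ A, ‖φ j • v j‖ ^ 2 * en (u t) j ≤ X :=
    Finset.sum_le_sum fun j _ =>
      mul_le_mul_of_nonneg_left (le_add_of_nonneg_left (norm_nonneg _)) (sq_nonneg _)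
  have h3 : ∑ j ∈ A, φ j ^ 2 * (inner ℝ (v j) (cross (n' j) (lap (u t) j)) -
        α * (inner ℝ (lap (u t) j) (ν (u t j)) * inner ℝ (v j) (n' j))) ≤
      (α + 1) * c ^ 2 * X := by
    rw [hX, Finset.mul_sum]
    refine Finset.sum_le_sum fun j _ => ?_
    have a1 := (le_abs_self _).trans (abs_inner_cross_le (v j) (n' j) (lap (u t) j))
    have a2 := (neg_le_abs _).trans_eq (abs_mul (inner ℝ (lap (u t) j) (ν (u t j)) : ℝ)
      (inner ℝ (v j) (n' j)))
    have a3 := mul_le_mul (hb.abs_inner_lap_le hut j) (abs_real_inner_le_norm (v j) (n' j))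
      (abs_nonneg _) (mul_nonneg (by linarith) (en_nonneg _ _))
    have a4 := hn' j
    have hx := norm_nonneg (v j)
    have hl := norm_nonneg (lap (u t) j)
    have he := en_nonneg (u t) j
    set x := ‖v j‖
    set l := ‖lap (u t) j‖
    set e := en (u t) j
    have b1 : x * ‖n' j‖ * l ≤ c ^ 2 * x ^ 2 * l := by
      have p : x * ‖n' j‖ ≤ c ^ 2 * x ^ 2 := by
        have q := mul_le_mul_of_nonneg_left a4 hx
        have r : c * x ^ 2 ≤ c ^ 2 * x ^ 2 :=
          mul_le_mul_of_nonneg_right (by nlinarith) (sq_nonneg x)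
        linarith
      exact mul_le_mul_of_nonneg_right p hl
    have b2 : c * e * (x * ‖n' j‖) ≤ c ^ 2 * x ^ 2 * e := by
      have q := mul_le_mul_of_nonneg_left a4 hx
      have := mul_le_mul_of_nonneg_left q (mul_nonneg (by linarith : 0 ≤ c) he)
      linarith
    have b3 : inner ℝ (v j) (cross (n' j) (lap (u t) j)) -
        α * (inner ℝ (lap (u t) j) (ν (u t j)) * inner ℝ (v j) (n' j)) ≤
        (α + 1) * c ^ 2 * (x ^ 2 * (l + e)) := by
      have p1 := mul_le_mul_of_nonneg_left (a2.trans (a3.trans b2)) hα.le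
      have p2 : 0 ≤ α * (c ^ 2 * x ^ 2 * l) := by positivity
      have p3 : 0 ≤ c ^ 2 * x ^ 2 * e := by positivity
      linarith
    have b4 := mul_le_mul_of_nonneg_left b3 (sq_nonneg (φ j))
    rw [norm_smul, mul_pow, Real.norm_eq_abs, sq_abs]
    linarith
  have hXsq : X ^ 2 ≤ 4 * (Y * Γ) * G :=
    sum_mul_sq_le hφ (fun j => φ j • v j) (fun j hj => by simp [hj]) _ _
  have hsum : ∑ j ∈ A, φ j ^ 2 * (2 * inner ℝ (v j) (v' j)) =
      2 * (∑ j ∈ A, φ j ^ 2 * inner ℝ (v j) (cross (ν (u t j)) (lap v j)) +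
      α * ∑ j ∈ A, φ j ^ 2 * inner ℝ (v j) (lap v j) +
      ∑ j ∈ A, φ j ^ 2 * (inner ℝ (v j) (cross (n' j) (lap (u t) j)) -
        α * (inner ℝ (lap (u t) j) (ν (u t j)) * inner ℝ (v j) (n' j)))) := by
    rw [Finset.mul_sum (f := fun j => φ j ^ 2 * inner ℝ (v j) (lap v j)),
      ← Finset.sum_add_distrib, ← Finset.sum_add_distrib, Finset.mul_sum]
    refine Finset.sum_congr rfl fun j _ => ?_
    rw [hin j]; ring
  rw [hsum]
  have h4 := mul_le_mul_of_nonneg_left h1 hα.le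
  have h5 := mul_le_mul_of_nonneg_left hXen (by positivity : 0 ≤ (2 / α + 1 / 2) * c ^ 2)
  -- The budget closes because `3 / 8 + 1 / 2 < 1`: the dissipation `α * Γ` pays for the precession
  -- term and for `C₂ * X`.
  have h6 := absorb_cross_term_le hα hC₂0 hX0 hY0 hG0 hΓ0 hXsq
  have h7 : 0 ≤ α * Γ := by positivity
  have h8 : 0 ≤ 4 * C₂ ^ 2 / α * (L ^ 2 * V) := by positivity
  have h9 : 0 ≤ C₃ * (G * Y) := by positivity
  have e10 : C₂ * X = (2 / α + 1 / 2) * c ^ 2 * X + (α + 1) * c ^ 2 * X := by rw [hC₂]; ring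
  have e11 : (4 * C₂ ^ 2 / α + C₃) * G * Y + (4 * C₂ ^ 2 / α + C₃) * L ^ 2 * V =
      2 * (2 * C₂ ^ 2 / α * (Y * G)) + C₃ * (G * Y) + 4 * C₂ ^ 2 / α * (L ^ 2 * V) +
      C₃ * (L ^ 2 * V) := by ring
  have e12 : C₃ * (L ^ 2 * V) = 2 * (α * (2 * L ^ 2 * V) + 4 * (16 / α + 4) * L ^ 2 * V) := by
    rw [hC₃]; ring
  rw [e11, e12]
  linarith only [h2, h3, h4, h5, h6, h7, h8, h9, e10]

end DiscreteLLG

namespace DiscreteLLG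

open Filter Topology

/-! ### The interior estimate with unit mesh size -/

/-- A time-weighted Gronwall inequality. -/
lemma weighted_gronwall {y P : ℝ → ℝ} {a b C D B : ℝ} (hab : a ≤ b) (hC : 0 ≤ C) (hD : 0 ≤ D)
    (hB : D * (b - a) ≤ B) (hy : ContinuousOn y (Set.Icc a b)) (hP : ContinuousOn P (Set.Icc a b))
    (hPa : P a = 0) (hd : ∀ x ∈ Set.Ioo a b, ∃ y' P', HasDerivAt y y' x ∧ HasDerivAt P P' x ∧
      0 ≤ y x ∧ y x ≤ P' ∧ y' ≤ C * P' * y x + D * P') :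
    (b - a) * y b ≤ (1 + B) * P b * Real.exp (C * P b) := by
  have hB0 : 0 ≤ B := (mul_nonneg hD (sub_nonneg.2 hab)).trans hB
  have hPpos : ∀ x ∈ Set.Icc a b, 0 ≤ P x := by
    intro x hx
    have h := le_of_hasDerivAt_nonpos (f := fun s => -P s) hx.1
      ((hP.mono (Set.Icc_subset_Icc le_rfl hx.2)).neg) (fun s hs => by
        obtain ⟨y', P', -, h2, h3, h4, -⟩ := hd s ⟨hs.1, hs.2.trans_le hx.2⟩
        exact ⟨-P', h2.neg, by linarith⟩)
    rw [hPa] at h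
    linarith
  -- With the integrating factor, the derivative of the weight `s - a` contributes `y`, which is
  -- paid for by `y ≤ P'`; the inhomogeneity is paid for by `D * (s - a) ≤ B`.
  have h := le_of_hasDerivAt_nonpos
    (f := fun s => (s - a) * y s * Real.exp (-(C * P s)) - (1 + B) * P s) hab ?_ ?_
  · simp only [hPa, sub_self, zero_mul, mul_zero] at h
    have h1 : (b - a) * y b * Real.exp (-(C * P b)) ≤ (1 + B) * P b := by linarith
    have h2 := mul_le_mul_of_nonneg_right h1 (Real.exp_pos (C * P b)).le
    rw [mul_assoc, ← Real.exp_add] at h2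
    simpa using h2
  · refine ContinuousOn.sub (ContinuousOn.mul (ContinuousOn.mul (by fun_prop) hy) ?_)
      (continuousOn_const.mul hP)
    exact Real.continuous_exp.comp_continuousOn (continuousOn_const.mul hP).neg
  · intro x hx
    obtain ⟨y', P', h1, h2, h3, h4, h5⟩ := hd x hx
    refine ⟨_, ((((hasDerivAt_id x).sub_const a).mul h1).mul ((h2.const_mul C).neg.exp)).sub
      (h2.const_mul (1 + B)), ?_⟩
    simp only [id, one_mul]
    have hxa : 0 ≤ x - a := by linarith [hx.1]
    have hP' : 0 ≤ P' := h3.trans h4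
    have e1 : Real.exp (-(C * P x)) ≤ 1 := by
      rw [Real.exp_le_one_iff]
      linarith [mul_nonneg hC (hPpos x (Set.Ioo_subset_Icc_self hx))]
    have e0 := (Real.exp_pos (-(C * P x))).le
    set e := Real.exp (-(C * P x))
    have k1 : (x - a) * y' ≤ C * P' * ((x - a) * y x) + B * P' := by
      have q1 := mul_le_mul_of_nonneg_left h5 hxa
      have q2 : D * (x - a) ≤ B :=
        (mul_le_mul_of_nonneg_left (by linarith [hx.2]) hD).trans hB
      have q3 := mul_le_mul_of_nonneg_right q2 hP'
      linarith
    have k2 : (y x + (x - a) * y' - C * P' * ((x - a) * y x)) * e ≤ (1 + B) * P' * e :=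
      mul_le_mul_of_nonneg_right (by linarith) e0
    have k3 : (1 + B) * P' * e ≤ (1 + B) * P' := mul_le_of_le_one_right (by positivity) e1
    change (y x + (x - a) * y') * e + (x - a) * y x * (e * -(C * P')) - (1 + B) * P' ≤ 0
    linarith

variable {N : Set Space} {ν : Space → Space} {c α : ℝ}

/-- Small local energy persists for a time proportional to the square of the radius. -/
lemma IsUnitSolution.sum_en_le_of_small {u : ℝ → GridFun} (hu : IsUnitSolution N ν α u)
    (hα : 0 < α) (hb : NormalBounds N ν c) {E : ℝ} (hE : ∀ F : Finset Grid, ∑ j ∈ F, en (u 0) j ≤ E)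
    {ε r : ℝ} (hr : 4 ≤ r) {x : Fin 2 → ℝ} {t₀ t : ℝ} (ht₀ : 0 ≤ t₀) (ht : t₀ ≤ t)
    (hε : ∀ F : Finset Grid, (∀ j ∈ F, gdist x j ≤ 11 * r) → ∑ j ∈ F, en (u t₀) j ≤ ε)
    (hsmall : 4 * (2 / (α / (1 + α ^ 2)) + 2 * (1 + α ^ 2) + 1) * E * (t - t₀) ≤ ε * r ^ 2)
    {F : Finset Grid} (hF : ∀ j ∈ F, gdist x j ≤ 10 * r) : ∑ j ∈ F, en (u t) j ≤ 2 * ε := by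
  have hφ := isCutoff_ramp x (a := 11 * r) (b := 10 * r) (by linarith) (by linarith)
  have h1 := hu.energy_le hα hb hφ ht₀ ht (fun s hs => hu.sum_en_le hα hb hE (ht₀.trans hs.1) _)
  have h2 := sum_le_sum_ramp (x := x) (a := 11 * r) (b := 10 * r) (by linarith) (by linarith) hF
    (en_nonneg (u t))
  have h3 : ∑ j ∈ box x (11 * r + 3), ramp x (11 * r) (10 * r) j ^ 2 * en (u t₀) j ≤ ε := by
    classical
    -- Smallness at `t₀` is known only up to distance `11 * r`, so the sum over the padded box is
    -- first restricted to the support of the cutoff.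
    rw [← Finset.sum_filter_of_ne (p := fun j => ramp x (11 * r) (10 * r) j ≠ 0)
      (fun j _ h h0 => h (by rw [h0]; ring))]
    refine (Finset.sum_le_sum fun j _ => mul_le_of_le_one_left (en_nonneg _ _)
      (pow_le_one₀ (hφ.nonneg j) (hφ.le_one j))).trans (hε _ fun j hj => ?_)
    exact (gdist_lt_of_ramp_ne_zero (by linarith) (Finset.mem_filter.1 hj).2).le
  rw [show 11 * r - 10 * r = r by ring] at h1
  have h4 : (2 / (α / (1 + α ^ 2)) + 2 * (1 + α ^ 2) + 1) * (1 / r) ^ 2 * E * (t - t₀) * 4 ≤ ε := by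
    have : (2 / (α / (1 + α ^ 2)) + 2 * (1 + α ^ 2) + 1) * (1 / r) ^ 2 * E * (t - t₀) * 4 =
      (4 * (2 / (α / (1 + α ^ 2)) + 2 * (1 + α ^ 2) + 1) * E * (t - t₀)) / r ^ 2 := by
      rw [one_div, inv_pow]; ring
    rw [this, div_le_iff₀ (by positivity)]
    exact hsmall
  linarith

/-- The interior estimate under a smallness condition on the energy in space-time. -/
lemma NormalBounds.exists_interior_estimate (hb : NormalBounds N ν c) (hα : 0 < α) :
    ∃ C : ℝ, 0 ≤ C ∧ ∀ u : ℝ → GridFun, IsUnitSolution N ν α u → ∀ (x : Fin 2 → ℝ) (r t₀ t : ℝ),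
      4 ≤ r → 0 ≤ t₀ → t₀ ≤ t → t - t₀ ≤ 256 * r ^ 2 →
      (∀ s ∈ Set.Icc t₀ t, ∀ F : Finset Grid, (∀ j ∈ F, gdist x j ≤ 10 * r) →
        2000 * c ^ 2 * ∑ j ∈ F, en (u s) j ≤ 1) →
      (t - t₀) * ∑ j ∈ box x (3 * r), hess (u t) j ≤ C := by
  obtain ⟨C, hC0, hvel⟩ := hb.exists_velocity_inequality hα
  have hc1 : 1 ≤ c ^ 2 := one_le_pow₀ hb.one_le
  set β := α / (1 + α ^ 2) with hβ
  have hβ0 : 0 < β := by positivity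
  set C₁ := 2 / β + 2 * (1 + α ^ 2) + 1 with hC₁
  have hC₁0 : 0 ≤ C₁ := by positivity
  set m := 2 / β * C₁ + 1 with hm
  set Pm := 2 / β + m * 256 with hPm
  set C' := C * (3 + 2000 * c ^ 4) with hC'
  have hC'0 : 0 ≤ C' := by positivity
  have hm0 : 0 ≤ m := by positivity
  refine ⟨4 * ((1 + C * 256) * Pm * Real.exp (C' * Pm)) + 2000 * c ^ 4 * 256, by positivity,
    fun u hu x r t₀ t hr ht₀ ht htr hsm => ?_⟩
  set L := 1 / r with hL
  have hLr : L ^ 2 * r ^ 2 = 1 := by rw [hL]; field_simp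
  have hL2 : 0 ≤ L ^ 2 := sq_nonneg L
  have hLt : L ^ 2 * (t - t₀) ≤ 256 := by
    have := mul_le_mul_of_nonneg_left htr hL2
    linarith
  -- Nested cutoffs: as `4 ≤ r`, `ψ` equals `1` on the box of `φ` because `4 * r + 3 ≤ 6 * r`, and
  -- the box of `ψ` lies in the region of small energy because `7 * r + 3 ≤ 10 * r`.
  have hψ : IsCutoff (box x (7 * r + 3)) (ramp x (7 * r) (6 * r)) L := by
    have := isCutoff_ramp x (a := 7 * r) (b := 6 * r) (by linarith) (by linarith)
    rwa [show 7 * r - 6 * r = r by ring] at this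
  have hφ : IsCutoff (box x (4 * r + 3)) (ramp x (4 * r) (3 * r)) L := by
    have := isCutoff_ramp x (a := 4 * r) (b := 3 * r) (by linarith) (by linarith)
    rwa [show 4 * r - 3 * r = r by ring] at this
  set A := box x (7 * r + 3) with hA
  set ψ := ramp x (7 * r) (6 * r) with hψdef
  set B := box x (4 * r + 3) with hBdef
  set φ := ramp x (4 * r) (3 * r) with hφdef
  have hAK : ∀ s ∈ Set.Icc t₀ t, 2000 * c ^ 2 * ∑ j ∈ A, en (u s) j ≤ 1 := fun s hs =>
    hsm s hs A fun j hj => by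
      rw [hA, mem_box (by linarith)] at hj; linarith
  have hBK : ∀ s ∈ Set.Icc t₀ t, 2000 * c ^ 2 * ∑ j ∈ B, en (u s) j ≤ 1 := fun s hs =>
    hsm s hs B fun j hj => by
      rw [hBdef, mem_box (by linarith)] at hj; linarith
  have hone : ∀ K : ℝ, 2000 * c ^ 2 * K ≤ 1 → K ≤ 1 := fun K hK => by
    by_contra! h
    nlinarith
  have hBψ : ∀ f : Grid → ℝ, (∀ j, 0 ≤ f j) → ∑ j ∈ B, f j ≤ ∑ j ∈ A, ψ j ^ 2 * f j := by
    intro f hf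
    refine sum_le_sum_ramp (x := x) (a := 7 * r) (b := 6 * r) (by linarith) (by linarith)
      (fun j hj => ?_) hf
    rw [hBdef, mem_box (by linarith)] at hj
    linarith
  set Eψ : ℝ → ℝ := fun s => 1 / 4 * ∑ j ∈ A, ψ j ^ 2 * en (u s) j with hEψ
  have hEψ0 : ∀ s, 0 ≤ Eψ s := fun s => mul_nonneg (by norm_num)
    (Finset.sum_nonneg fun j _ => mul_nonneg (sq_nonneg _) (en_nonneg _ _))
  have hEψ1 : Eψ t₀ ≤ 1 := by
    have h1 := hψ.sum_mul_le (en_nonneg (u t₀))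
    have h2 := hone _ (hAK t₀ ⟨le_rfl, ht⟩)
    simp only [hEψ]
    linarith
  set y : ℝ → ℝ := fun s => ∑ j ∈ B, φ j ^ 2 * ‖fld ν α (u s) j‖ ^ 2 with hy
  -- The energy dropped so far plus a linear term of slope of order `L ^ 2`. Its derivative
  -- dominates the weighted velocity sum plus `L ^ 2`, yet `P` itself stays bounded by `Pm`.
  set P : ℝ → ℝ := fun s => 2 / β * (Eψ t₀ - Eψ s) + m * (L ^ 2 * (s - t₀)) with hP
  have hIci : Set.Icc t₀ t ⊆ Set.Ici 0 := fun s hs => ht₀.trans hs.1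
  have hEψc : ContinuousOn Eψ (Set.Icc t₀ t) := (hu.continuousOn_energy A ψ).mono hIci
  have key : (t - t₀) * y t ≤ (1 + C * 256) * P t * Real.exp (C' * P t) := by
    refine weighted_gronwall (y := y) (P := P) (D := C * L ^ 2) ht hC'0 (by positivity) ?_ ?_ ?_ ?_ ?_
    · rw [mul_assoc]
      exact mul_le_mul_of_nonneg_left hLt hC0
    · exact ContinuousOn.mono (continuousOn_finsetSum _ fun j _ =>
        continuousOn_const.mul ((hu.continuousOn_fld hb j).norm.pow 2)) hIci
    · exact (continuousOn_const.mul (continuousOn_const.sub hEψc)).add (by fun_prop)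
    · simp [hP]
    · intro s hs
      have hs0 : 0 < s := ht₀.trans_lt hs.1
      have hsI : s ∈ Set.Icc t₀ t := Set.Ioo_subset_Icc_self hs
      obtain ⟨D, hD, hDle⟩ := hu.exists_hasDerivAt_energy hα hb hψ hs0
      obtain ⟨y', hy', hyle⟩ := hvel u hu B φ L hφ s hs0
      have hPd : HasDerivAt P (2 / β * (0 - D) + m * (L ^ 2 * 1)) s :=
        ((((hasDerivAt_const s (Eψ t₀)).sub hD).const_mul (2 / β))).add
          ((((hasDerivAt_id s).sub_const t₀).const_mul (L ^ 2)).const_mul m)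
      refine ⟨y', _, hy', hPd, by positivity, ?_⟩
      set P' := 2 / β * (0 - D) + m * (L ^ 2 * 1) with hP'
      have hsec := (hψ.second_order_estimate (α := α) hb (hu.mem s hs0.le) (hAK s hsI)).2
      have hV := hBψ (fun j => ‖fld ν α (u s) j‖ ^ 2) (fun j => by positivity)
      have hG := hBψ (fun j => ‖lap (u s) j‖ ^ 2 + en (u s) j ^ 2) (fun j => by positivity)
      have hyV : y s ≤ ∑ j ∈ B, ‖fld ν α (u s) j‖ ^ 2 :=
        hφ.sum_mul_le (f := fun j => ‖fld ν α (u s) j‖ ^ 2) (fun j => by positivity)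
      have hK1 := hone _ (hAK s hsI)
      have hK0 : 0 ≤ ∑ j ∈ A, en (u s) j := Finset.sum_nonneg fun j _ => en_nonneg _ _
      have hy0 : 0 ≤ y s := by positivity
      change y' ≤ C * (∑ j ∈ B, (‖lap (u s) j‖ ^ 2 + en (u s) j ^ 2)) * y s +
        C * L ^ 2 * ∑ j ∈ B, ‖fld ν α (u s) j‖ ^ 2 at hyle
      rw [← hβ, ← hC₁] at hDle
      set Q := ∑ j ∈ A, ψ j ^ 2 * ‖fld ν α (u s) j‖ ^ 2
      set K := ∑ j ∈ A, en (u s) j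
      set V := ∑ j ∈ B, ‖fld ν α (u s) j‖ ^ 2
      set G := ∑ j ∈ B, (‖lap (u s) j‖ ^ 2 + en (u s) j ^ 2)
      have hQ0 : 0 ≤ Q := by positivity
      have hLK : L ^ 2 * K ≤ L ^ 2 := mul_le_of_le_one_right hL2 hK1
      -- The slope `m` is chosen to offset the cutoff error of the energy inequality and to leave `L
      -- ^ 2` over.
      have hQP : Q + L ^ 2 ≤ P' := by
        have q1 := mul_le_mul_of_nonneg_left hDle (by positivity : 0 ≤ 2 / β)
        have q2 : 2 / β * (β / 2 * Q) = Q := by field_simp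
        have q3 : 2 / β * (-(β / 2 * Q) + C₁ * L ^ 2 * K) = -Q + 2 / β * C₁ * (L ^ 2 * K) := by
          rw [mul_add, mul_neg, q2]; ring
        rw [q3] at q1
        have q4 := mul_le_mul_of_nonneg_left hLK (by positivity : 0 ≤ 2 / β * C₁)
        rw [hP', hm]
        linarith
      refine ⟨by linarith, hyle.trans (add_le_add ?_ ?_)⟩
      · refine mul_le_mul_of_nonneg_right ?_ hy0
        rw [hC', mul_assoc]
        refine mul_le_mul_of_nonneg_left ?_ hC0
        have q1 : 2000 * c ^ 4 * L ^ 2 * K ≤ 2000 * c ^ 4 * L ^ 2 := by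
          rw [mul_assoc]
          exact mul_le_mul_of_nonneg_left hLK (by positivity)
        have q2 : 2000 * c ^ 4 * L ^ 2 ≤ 2000 * c ^ 4 * P' :=
          mul_le_mul_of_nonneg_left (by linarith) (by positivity)
        linarith
      · exact mul_le_mul_of_nonneg_left (by linarith) (by positivity)
  have hPt : P t ≤ Pm := by
    have h1 : 2 / β * (Eψ t₀ - Eψ t) ≤ 2 / β * 1 :=
      mul_le_mul_of_nonneg_left (by linarith [hEψ0 t]) (by positivity)
    have h2 := mul_le_mul_of_nonneg_left hLt hm0
    simp only [hP, hPm]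
    linarith
  have hPm0 : 0 ≤ Pm := by positivity
  have key2 : (1 + C * 256) * P t * Real.exp (C' * P t) ≤
      (1 + C * 256) * Pm * Real.exp (C' * Pm) :=
    mul_le_mul (mul_le_mul_of_nonneg_left hPt (by positivity))
      (Real.exp_le_exp.2 (mul_le_mul_of_nonneg_left hPt hC'0)) (Real.exp_pos _).le (by positivity)
  have htI : t ∈ Set.Icc t₀ t := ⟨ht, le_rfl⟩
  -- At the final time the velocity bound is converted back into a bound on second differences.
  have hfin := (hφ.second_order_estimate (α := α) hb (hu.mem t (ht₀.trans ht)) (hBK t htI)).1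
  have hbox : ∑ j ∈ box x (3 * r), hess (u t) j ≤ ∑ j ∈ B, φ j ^ 2 * hess (u t) j :=
    sum_le_sum_ramp (x := x) (a := 4 * r) (b := 3 * r) (by linarith) (by linarith)
      (fun j hj => by rwa [mem_box (by linarith)] at hj) (hess_nonneg (u t))
  have h1 := mul_le_mul_of_nonneg_left (hbox.trans hfin) (sub_nonneg.2 ht)
  have h2 : (t - t₀) * (2000 * c ^ 4 * L ^ 2 * ∑ j ∈ B, en (u t) j) ≤ 2000 * c ^ 4 * 256 := by
    have q1 := hone _ (hBK t htI)
    have q2 : L ^ 2 * (t - t₀) * ∑ j ∈ B, en (u t) j ≤ 256 * 1 :=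
      mul_le_mul hLt q1 (Finset.sum_nonneg fun j _ => en_nonneg _ _) (by norm_num)
    have q3 := mul_le_mul_of_nonneg_left q2 (by positivity : 0 ≤ 2000 * c ^ 4)
    linarith
  have h3 : (t - t₀) * y t ≤ _ := key.trans key2
  simp only [hy] at h3
  linarith

end DiscreteLLG

namespace DiscreteLLG

open Filter Topology

/-! ### Reduction to unit mesh size -/

lemma forwardDiff_eq (h : ℝ) (k : Fin 2) (u : GridFun) (j : Grid) :
    forwardDiff h k u j = h⁻¹ • fd k u j := rfl

lemma backwardDiff_eq (h : ℝ) (k : Fin 2) (u : GridFun) (j : Grid) :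
    backwardDiff h k u j = h⁻¹ • fd k u (j - stp k) := by
  simp [backwardDiff, fd, stp]

lemma fd_smul (a : ℝ) (k : Fin 2) (f : GridFun) (j : Grid) :
    fd k (fun i => a • f i) j = a • fd k f j := by
  simp [fd, smul_sub]

lemma laplacian_eq (h : ℝ) (u : GridFun) (j : Grid) : laplacian h u j = (h ^ 2)⁻¹ • lap u j := by
  unfold laplacian lap
  rw [Finset.smul_sum]
  refine Finset.sum_congr rfl fun k _ => ?_
  rw [forwardDiff_eq]
  simp only [funext (backwardDiff_eq h k u), fd_smul, smul_smul, ← sq, inv_pow]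
  simp [fd]

lemma llgField_eq (ν : Space → Space) (α h : ℝ) (u : GridFun) (j : Grid) :
    llgField ν α h u j = (h ^ 2)⁻¹ • fld ν α u j := by
  have h1 : ∀ (a : ℝ) (p q : Space), cross p (a • q) = a • cross p q := fun a p q => by
    simp [cross]
  simp only [llgField, multiplier, laplacian_eq, h1, fld, inner_smul_left, conj_trivial]
  module

/-- Parabolic scaling: the field with mesh size `h` is `(h ^ 2)⁻¹` times the unit one. -/
lemma IsSolution.isUnitSolution {N : Set Space} {ν : Space → Space} {α h : ℝ} (hh : 0 < h)
    {u : ℝ → GridFun} (hu : IsSolution N ν α h u) :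
    IsUnitSolution N ν α (fun s => u (h ^ 2 * s)) where
  mem t ht j := hu.mem _ (by positivity) j
  hasDeriv t ht j := by
    have h1 := hu.hasDeriv (h ^ 2 * t) (by positivity) j
    have h2 : HasDerivWithinAt (fun s => h ^ 2 * s) (h ^ 2) (Set.Ici 0) t := by
      simpa using ((hasDerivAt_id t).const_mul (h ^ 2)).hasDerivWithinAt
    have h3 := h1.scomp t h2 (fun s hs => mul_nonneg (sq_nonneg h) hs)
    rw [llgField_eq, smul_smul, mul_inv_cancel₀ (by positivity), one_smul] at h3
    exact h3

/-- The powers of `h` cancel in two dimensions; the factor `4` comes from the two halves in the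
energy. -/
lemma sum_en_le_of_energy_le {h : ℝ} (hh : 0 < h) {u : GridFun} {S : Set Plane} {E : ℝ}
    (hE0 : 0 ≤ E) (hE : energy h u S ≤ ENNReal.ofReal E) {F : Finset Grid}
    (hF : ∀ j ∈ F, gridPoint h j ∈ S) : ∑ j ∈ F, en u j ≤ 4 * E := by
  have hterm : ∀ j, 1 / 2 * h ^ 2 * (1 / 2 * ∑ k : Fin 2,
      (‖forwardDiff h k u j‖ ^ 2 + ‖backwardDiff h k u j‖ ^ 2)) = 1 / 4 * en u j := by
    intro j
    simp only [forwardDiff_eq, backwardDiff_eq, norm_smul, mul_pow, en, Fin.sum_univ_two, norm_inv,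
      Real.norm_eq_abs, inv_pow, sq_abs]
    field_simp
    ring
  unfold energy at hE
  simp only [hterm] at hE
  replace hE := (tsum_subtype {j : Grid | gridPoint h j ∈ S}
    (fun j => ENNReal.ofReal (1 / 4 * en u j))).symm.le.trans hE
  have h1 := (ENNReal.sum_le_tsum F).trans hE
  have h2 : ∑ j ∈ F, {j : Grid | gridPoint h j ∈ S}.indicator
      (fun j => ENNReal.ofReal (1 / 4 * en u j)) j = ENNReal.ofReal (1 / 4 * ∑ j ∈ F, en u j) := by
    rw [Finset.mul_sum, ENNReal.ofReal_sum_of_nonneg fun j _ => mul_nonneg (by norm_num) (en_nonneg u j)]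
    exact Finset.sum_congr rfl fun j hj => Set.indicator_of_mem (s := {j : Grid | gridPoint h j ∈ S}) (hF j hj) _
  rw [h2, ENNReal.ofReal_le_ofReal_iff hE0] at h1
  linarith

/-! ### Second differences -/

lemma norm_fd_fd_sq_le (k l : Fin 2) (u : GridFun) (j : Grid) :
    ‖fd k (fd l u) j‖ ^ 2 ≤ hess u (j + if k = l then stp k else 0) := by
  have h01 : ‖fd 1 (fd 0 u) j‖ ^ 2 ≤ hess u j := by
    unfold hess
    linarith [sq_nonneg ‖pureDiff 0 u j‖, sq_nonneg ‖pureDiff 1 u j‖, sq_nonneg ‖fd 1 (fd 0 u) j‖]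
  have hkk : ∀ k, ‖fd k (fd k u) j‖ ^ 2 ≤ hess u (j + stp k) := by
    intro k
    rw [fd_fd_self]
    unfold hess
    fin_cases k
    · simp only [Fin.zero_eta]
      linarith [sq_nonneg ‖pureDiff 1 u (j + stp 0)‖, sq_nonneg ‖fd 1 (fd 0 u) (j + stp 0)‖]
    · simp only [Fin.mk_one]
      linarith [sq_nonneg ‖pureDiff 0 u (j + stp 1)‖, sq_nonneg ‖fd 1 (fd 0 u) (j + stp 1)‖]
  fin_cases k <;> fin_cases l
  · simpa using hkk 0
  · simpa [fd_comm 0 1] using h01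
  · simpa using h01
  · simpa using hkk 1

/-- The forward or the backward difference in direction `k`. -/
noncomputable def oneDiff (h : ℝ) (p : Fin 2 × Bool) (u : GridFun) : GridFun :=
  if p.2 then forwardDiff h p.1 u else backwardDiff h p.1 u

/-- Backward differences are translated forward differences. The shift depends only on the two
operators, so a sum over sites can be reindexed. -/
lemma exists_norm_oneDiff_oneDiff_le (p q : Fin 2 × Bool) :
    ∃ s : Grid, (∀ k, |s k| ≤ 1) ∧ ∀ (h : ℝ) (u : GridFun) (j : Grid),
      ‖oneDiff h p (oneDiff h q u) j‖ ^ 2 ≤ (h ^ 4)⁻¹ * hess u (j + s) := by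
  obtain ⟨k, b⟩ := p
  obtain ⟨l, b'⟩ := q
  have key : ∀ (h : ℝ) (u : GridFun) (i j : Grid),
      ‖oneDiff h (k, b) (oneDiff h (l, b') u) j‖ ^ 2 = (h ^ 4)⁻¹ * ‖fd k (fd l u)
        (j - (if b then 0 else stp k) - (if b' then 0 else stp l))‖ ^ 2 := by
    intro h u i j
    have e : (h ^ 4)⁻¹ = ‖h⁻¹ * h⁻¹‖ ^ 2 := by
      rw [Real.norm_eq_abs, sq_abs]; ring
    rw [e, ← mul_pow, ← norm_smul]
    congr 2
    have e2 : ∀ p q : Grid, j + p - (p + q) = j - q := fun p q => by abel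
    cases b <;> cases b' <;>
      simp [e2, oneDiff, forwardDiff, backwardDiff, fd, ← smul_sub, smul_smul, stp, sub_add_eq_add_sub,
        sub_sub]
  refine ⟨(if k = l then stp k else 0) - (if b then 0 else stp k) - (if b' then 0 else stp l),
    ?_, fun h u j => ?_⟩
  · fin_cases k <;> fin_cases l <;> cases b <;> cases b' <;> simp [Fin.forall_fin_two, stp]
  · rw [key h u j j]
    refine mul_le_mul_of_nonneg_left ?_ (by positivity)
    refine (norm_fd_fd_sq_le k l u _).trans_eq ?_
    congr 1
    abel

lemma exists_norm_multiDiff_le {a : Fin 2 × Bool → ℕ}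
    (ha : a ∈ Finset.piAntidiag (Finset.univ : Finset (Fin 2 × Bool)) 2) :
    ∃ s : Grid, (∀ k, |s k| ≤ 1) ∧ ∀ (h : ℝ) (u : GridFun) (j : Grid),
      ‖multiDiff h a u j‖ ^ 2 ≤ (h ^ 4)⁻¹ * hess u (j + s) := by
  rw [Finset.mem_piAntidiag] at ha
  have h1 := ha.1
  simp only [Fintype.sum_prod_type, Fin.sum_univ_two, Fintype.sum_bool] at h1
  obtain ⟨p, q, hpq⟩ : ∃ p q : Fin 2 × Bool, ∀ (h : ℝ) (u : GridFun),
      multiDiff h a u = oneDiff h p (oneDiff h q u) := by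
    unfold multiDiff
    generalize a (0, true) = n₁ at *
    generalize a (0, false) = n₂ at *
    generalize a (1, true) = n₃ at *
    generalize a (1, false) = n₄ at *
    have b₁ : n₁ ≤ 2 := by omega
    have b₂ : n₂ ≤ 2 - n₁ := by omega
    have b₃ : n₃ ≤ 2 - n₁ - n₂ := by omega
    obtain rfl : n₄ = 2 - n₁ - n₂ - n₃ := by omega
    -- The ten multi-indices of order two, each written as a composition of two single differences.
    interval_cases n₁
    · interval_cases n₂
      · interval_cases n₃
        · exact ⟨(1, false), (1, false), fun h u => by simp [oneDiff]⟩
        · exact ⟨(1, true), (1, false), fun h u => by simp [oneDiff]⟩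
        · exact ⟨(1, true), (1, true), fun h u => by simp [oneDiff]⟩
      · interval_cases n₃
        · exact ⟨(0, false), (1, false), fun h u => by simp [oneDiff]⟩
        · exact ⟨(0, false), (1, true), fun h u => by simp [oneDiff]⟩
      · interval_cases n₃
        exact ⟨(0, false), (0, false), fun h u => by simp [oneDiff]⟩
    · interval_cases n₂
      · interval_cases n₃
        · exact ⟨(0, true), (1, false), fun h u => by simp [oneDiff]⟩
        · exact ⟨(0, true), (1, true), fun h u => by simp [oneDiff]⟩
      · interval_cases n₃
        exact ⟨(0, true), (0, false), fun h u => by simp [oneDiff]⟩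
    · interval_cases n₂
      interval_cases n₃
      exact ⟨(0, true), (0, true), fun h u => by simp [oneDiff]⟩
  obtain ⟨s, hs, hle⟩ := exists_norm_oneDiff_oneDiff_le p q
  exact ⟨s, hs, fun h u j => by rw [hpq]; exact hle h u j⟩

lemma gdist_add_le {x : Fin 2 → ℝ} {j s : Grid} (hs : ∀ k, |s k| ≤ 1) :
    gdist x (j + s) ≤ gdist x j + 1 := by
  refine gdist_le_add zero_le_one fun k => ?_
  have : ((|s k| : ℤ) : ℝ) ≤ 1 := by exact_mod_cast hs k
  simpa using this

/-- The number of multi-indices of order two. -/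
noncomputable def numDiff : ℝ :=
  ((Finset.piAntidiag (Finset.univ : Finset (Fin 2 × Bool)) 2).card : ℝ)

lemma sum_diffNormSq_le {h : ℝ} (u : GridFun) (x : Fin 2 → ℝ) {ρ H : ℝ} (hρ : 0 ≤ ρ)
    (hH : ∑ j ∈ box x (ρ + 1), hess u j ≤ H) {F : Finset Grid} (hF : ∀ j ∈ F, gdist x j ≤ ρ) :
    ∑ j ∈ F, diffNormSq h 2 u j ≤ numDiff * ((h ^ 4)⁻¹ * H) := by
  unfold diffNormSq
  rw [Finset.sum_comm]
  refine (Finset.sum_le_card_nsmul _ _ ((h ^ 4)⁻¹ * H) fun a ha => ?_).trans_eq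
    (by rw [nsmul_eq_mul]; rfl)
  obtain ⟨s, hs, hle⟩ := exists_norm_multiDiff_le ha
  refine (Finset.sum_le_sum fun j _ => hle h u j).trans ?_
  rw [← Finset.mul_sum]
  refine mul_le_mul_of_nonneg_left (le_trans ?_ hH) (by positivity)
  have h2 := Finset.sum_map F (addRightEmbedding s) (hess u)
  simp only [addRightEmbedding_apply] at h2
  rw [← h2]
  refine Finset.sum_le_sum_of_subset_of_nonneg (fun i hi => ?_) (fun j _ _ => hess_nonneg u j)
  simp only [Finset.mem_map, addRightEmbedding_apply] at hi
  obtain ⟨j, hj, rfl⟩ := hi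
  rw [mem_box (by linarith)]
  linarith [hF j hj, gdist_add_le (x := x) (j := j) hs]

lemma diffL2Norm_le {h : ℝ} {m : ℕ} {u : GridFun} {S : Set Plane} {B : ℝ} (hB : 0 ≤ B)
    (hF : ∀ F : Finset Grid, (∀ j ∈ F, gridPoint h j ∈ S) →
      h ^ 2 * ∑ j ∈ F, diffNormSq h m u j ≤ B) :
    diffL2Norm h m u S ≤ ENNReal.ofReal (B ^ (1 / 2 : ℝ)) := by
  unfold diffL2Norm
  rw [← ENNReal.ofReal_rpow_of_nonneg hB (by norm_num)]
  refine ENNReal.rpow_le_rpow ?_ (by norm_num)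
  rw [ENNReal.tsum_eq_iSup_sum]
  refine iSup_le fun F => ?_
  have h0 : ∀ j, 0 ≤ h ^ 2 * diffNormSq h m u j := fun j => by unfold diffNormSq; positivity
  refine (ENNReal.ofReal_sum_of_nonneg (s := F) (f := fun j => h ^ 2 * diffNormSq h m u j.1)
    fun j _ => h0 _).symm.le.trans ?_
  refine ENNReal.ofReal_le_ofReal ?_
  have h1 := hF (F.map (Function.Embedding.subtype _)) (fun j hj => by
    simp only [Finset.mem_map, Function.Embedding.subtype_apply] at hj
    obtain ⟨i, -, rfl⟩ := hj
    exact i.2)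
  rw [Finset.sum_map, Finset.mul_sum] at h1
  exact h1

lemma NormalBounds.hess_le {N : Set Space} {ν : Space → Space} {c : ℝ} (hb : NormalBounds N ν c)
    {u : GridFun} (hu : ∀ j, u j ∈ N) (j : Grid) : hess u j ≤ 24 * c ^ 2 := by
  have h0 := norm_pureDiff_sq_le 0 u j
  have h1 := norm_pureDiff_sq_le 1 u j
  have h2 : ‖fd 1 (fd 0 u) j‖ ^ 2 ≤ 2 * (‖fd 0 u (j + stp 1)‖ ^ 2 + ‖fd 0 u j‖ ^ 2) :=
    norm_sub_sq_le_two_mul _ _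
  have h3 : ∀ i, ‖fd 0 u i‖ ^ 2 ≤ c ^ 2 := fun i =>
    pow_le_pow_left₀ (norm_nonneg _) (hb.dist_le _ (hu _) _ (hu _)) 2
  have h4 := hb.en_le hu j
  unfold hess
  linarith [h3 j, h3 (j + stp 1)]

/-! ### Grid points in balls -/

lemma gdist_le_of_mem_ball {h : ℝ} (hh : 0 < h) {x₀ : Plane} {R : ℝ} {j : Grid}
    (hj : gridPoint h j ∈ Metric.ball x₀ R) : gdist (fun k => x₀ k / h) j ≤ R / h := by
  have hR : 0 < R := Metric.pos_of_mem_ball hj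
  rw [gdist_le_iff (by positivity)]
  intro k
  rw [Metric.mem_ball, dist_eq_norm] at hj
  have h1 := (PiLp.norm_apply_le (gridPoint h j - x₀) k).trans hj.le
  have h2 : (j k : ℝ) - x₀ k / h = (gridPoint h j - x₀) k / h := by
    simp only [gridPoint, PiLp.sub_apply]
    field_simp
  rw [h2, abs_div, abs_of_pos hh]
  exact div_le_div_of_nonneg_right h1 hh.le

/-- A square of half-side `11` fits into a disc of radius `16` because `2 * 11 ^ 2 < 16 ^ 2`. -/
lemma mem_ball_of_gdist_le {h : ℝ} (hh : 0 < h) {x₀ : Plane} {R : ℝ} (hR : 0 < R) {j : Grid}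
    (hj : gdist (fun k => x₀ k / h) j ≤ 11 * (R / (16 * h))) :
    gridPoint h j ∈ Metric.ball x₀ R := by
  rw [gdist_le_iff (by positivity)] at hj
  rw [Metric.mem_ball, dist_eq_norm]
  have h1 : ∀ k, |(gridPoint h j - x₀) k| ≤ 11 / 16 * R := by
    intro k
    have h2 : (gridPoint h j - x₀) k = ((j k : ℝ) - x₀ k / h) * h := by
      simp only [gridPoint, PiLp.sub_apply]
      field_simp
    rw [h2, abs_mul, abs_of_pos hh]
    refine (mul_le_mul_of_nonneg_right (hj k) hh.le).trans_eq ?_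
    field_simp
  refine lt_of_pow_lt_pow_left₀ 2 hR.le ?_
  rw [EuclideanSpace.norm_sq_eq, Fin.sum_univ_two]
  have h3 := fun k => pow_le_pow_left₀ (abs_nonneg _) (h1 k) 2
  simp only [Real.norm_eq_abs]
  nlinarith [h3 0, h3 1, pow_pos hR 2]

/-- The bound for the second differences when the mesh is coarse. -/
lemma NormalBounds.coarse_bound {N : Set Space} {ν : Space → Space} {c : ℝ}
    (hb : NormalBounds N ν c) {u : GridFun} (hu : ∀ j, u j ∈ N) {h r : ℝ} (hh : 0 < h) (hr0 : 0 < r)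
    (hr4 : r < 4) (x : Fin 2 → ℝ) {F : Finset Grid} (hF : ∀ j ∈ F, gdist x j ≤ 2 * r) :
    h ^ 2 * ∑ j ∈ F, diffNormSq h 2 u j ≤
      numDiff * (361 * (24 * c ^ 2) * 4096 / (16 * h * r) ^ 2) := by
  -- For `r < 4` the box has fewer than `19 ^ 2 = 361` sites.
  have hHess : ∑ j ∈ box x (2 * r + 1), hess u j ≤ 361 * (24 * c ^ 2) := by
    refine (Finset.sum_le_card_nsmul _ _ _ fun j _ => hb.hess_le hu j).trans ?_
    rw [nsmul_eq_mul]
    refine mul_le_mul_of_nonneg_right ((card_box_le x (by positivity)).trans ?_) (by positivity)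
    nlinarith
  have hsum := sum_diffNormSq_le (h := h) u x (by positivity) hHess hF
  have h5 := mul_le_mul_of_nonneg_left hsum (sq_nonneg h)
  have h6 : h ^ 2 * (numDiff * ((h ^ 4)⁻¹ * (361 * (24 * c ^ 2)))) =
      numDiff * (361 * (24 * c ^ 2) / h ^ 2) := by
    field_simp
  have h7 : 361 * (24 * c ^ 2) / h ^ 2 ≤ 361 * (24 * c ^ 2) * 4096 / (16 * h * r) ^ 2 := by
    rw [div_le_div_iff₀ (by positivity) (by positivity)]
    have h8 : (16 * h * r) ^ 2 ≤ 4096 * h ^ 2 := by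
      have h9 : r ^ 2 ≤ 16 := by nlinarith
      have := mul_le_mul_of_nonneg_left h9 (by positivity : 0 ≤ 256 * h ^ 2)
      linarith
    have h9 := mul_le_mul_of_nonneg_left h8 (by positivity : 0 ≤ 361 * (24 * c ^ 2))
    linarith
  have hM0 : 0 ≤ numDiff := Nat.cast_nonneg _
  have h10 := mul_le_mul_of_nonneg_left h7 hM0
  linarith

end DiscreteLLG

/-! ### Choice of constants and assembly -/

theorem mainTheorem5 (N : Set DiscreteLLG.Space) (ν : DiscreteLLG.Space → DiscreteLLG.Space)
    (hN : DiscreteLLG.IsCompactHypersurface N ν) (α : ℝ) (hα : 0 < α) :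
    ∃ ε₀ : ℝ, 0 < ε₀ ∧ ∀ E₀ : ℝ, ∃ δ : ℝ, 0 < δ ∧
      ∀ R : ℝ, 0 < R → ∀ σ : ℝ, 0 < σ → σ ≤ δ * R ^ 2 → ∃ C : ℝ,
        ∀ h : ℝ, 0 < h → ∀ u : ℝ → DiscreteLLG.GridFun, DiscreteLLG.IsSolution N ν α h u →
          DiscreteLLG.energy h (u 0) Set.univ ≤ ENNReal.ofReal E₀ →
          ∀ (x₀ : DiscreteLLG.Plane) (t₀ : ℝ), 0 ≤ t₀ →
            DiscreteLLG.energy h (u t₀) (Metric.ball x₀ R) ≤ ENNReal.ofReal ε₀ →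
            ∀ t : ℝ, t₀ + σ ≤ t → t ≤ t₀ + δ * R ^ 2 →
              DiscreteLLG.diffL2Norm h 2 (u t) (Metric.ball x₀ (R / 8)) ≤ ENNReal.ofReal C := by
  open DiscreteLLG in
  obtain ⟨c, hb⟩ := hN.exists_normalBounds
  obtain ⟨C, hC0, hint⟩ := hb.exists_interior_estimate hα
  have hc1 := hb.one_le
  have hM0 : 0 ≤ numDiff := Nat.cast_nonneg _
  set C₁ := 2 / (α / (1 + α ^ 2)) + 2 * (1 + α ^ 2) + 1 with hC₁
  have hC₁0 : 0 < C₁ := by positivity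
  -- Local energy sums may double to `2 * ε`, exactly the threshold `2000 * c ^ 2 * (2 * ε) = 1` of
  -- the interior estimate. The witness is `ε / 4` because `en` sums to four times the energy.
  set ε := 1 / (4000 * c ^ 2) with hε
  have hε0 : 0 < ε := by positivity
  refine ⟨ε / 4, by positivity, fun E₀ => ?_⟩
  set E := 4 * max E₀ 0 with hE
  have hE0 : 0 ≤ E := mul_nonneg (by norm_num) (le_max_right _ _)
  -- Since `256 * r ^ 2 * h ^ 2 = R ^ 2`, the persistence condition reads `4 * C₁ * E * 256 * δ ≤
  -- ε`; `E + 1` avoids division by zero, and the cap `1` gives the time limit of the interior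
  -- estimate.
  refine ⟨min 1 (ε / (1024 * C₁ * (E + 1))), by positivity, fun R hR σ hσ _ => ?_⟩
  set δ := min 1 (ε / (1024 * C₁ * (E + 1))) with hδ
  have hδ0 : 0 < δ := by positivity
  have hδ1 : δ ≤ 1 := min_le_left _ _
  have hδ2 : 1024 * C₁ * E * δ ≤ ε := by
    have h1 : δ ≤ ε / (1024 * C₁ * (E + 1)) := min_le_right _ _
    rw [le_div_iff₀ (by positivity)] at h1
    have h2 : 0 ≤ 1024 * C₁ * δ := by positivity
    linarith
  -- The first summand serves fine meshes (`4 ≤ r`), the second coarse ones.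
  set B := numDiff * (C / σ) + numDiff * (361 * (24 * c ^ 2) * 4096 / R ^ 2) with hB
  have hB1 : 0 ≤ numDiff * (C / σ) := by positivity
  have hB2 : 0 ≤ numDiff * (361 * (24 * c ^ 2) * 4096 / R ^ 2) := by positivity
  refine ⟨B ^ (1 / 2 : ℝ), fun h hh u hu hEu x₀ t₀ ht₀ hloc t hσt htδ => ?_⟩
  set r := R / (16 * h) with hr
  have hr0 : 0 < r := by positivity
  have hrR : 16 * h * r = R := by rw [hr]; field_simp
  set x : Fin 2 → ℝ := fun k => x₀ k / h with hx
  have ht : 0 ≤ t := by linarith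
  refine diffL2Norm_le (by positivity) fun F hF => ?_
  have hF2 : ∀ j ∈ F, gdist x j ≤ 2 * r := fun j hj => by
    refine (gdist_le_of_mem_ball hh (hF j hj)).trans_eq ?_
    rw [hr]; field_simp; norm_num
  by_cases hr4 : 4 ≤ r
  · have hw := hu.isUnitSolution hh
    have ht₀' : h ^ 2 * (t₀ / h ^ 2) = t₀ := by field_simp
    have ht' : h ^ 2 * (t / h ^ 2) = t := by field_simp
    have hle : t₀ / h ^ 2 ≤ t / h ^ 2 := div_le_div_of_nonneg_right (by linarith) (by positivity)
    have hdt : t / h ^ 2 - t₀ / h ^ 2 ≤ δ * 256 * r ^ 2 := by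
      rw [← sub_div, div_le_iff₀ (by positivity)]
      have : δ * 256 * r ^ 2 * h ^ 2 = δ * R ^ 2 := by rw [← hrR]; ring
      linarith
    have hEw : ∀ F : Finset Grid, ∑ j ∈ F, en (u (h ^ 2 * 0)) j ≤ E := fun F => by
      rw [mul_zero]
      exact sum_en_le_of_energy_le hh (le_max_right E₀ 0)
        (hEu.trans (ENNReal.ofReal_le_ofReal (le_max_left _ _))) (fun _ _ => Set.mem_univ _)
    have hεw : ∀ F : Finset Grid, (∀ j ∈ F, gdist x j ≤ 11 * r) →
        ∑ j ∈ F, en (u (h ^ 2 * (t₀ / h ^ 2))) j ≤ ε := fun F hF => by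
      rw [ht₀']
      refine (sum_en_le_of_energy_le hh (by positivity) hloc fun j hj =>
        mem_ball_of_gdist_le hh hR (hF j hj)).trans_eq (by ring)
    have hmain := hint _ hw x r (t₀ / h ^ 2) (t / h ^ 2) hr4 (by positivity) hle
      (hdt.trans (by nlinarith [sq_nonneg r])) (fun s hs G hG => by
        have h1 := hw.sum_en_le_of_small hα hb hEw hr4 (t := s) (by positivity) hs.1 hεw ?_ hG
        · have h2 := mul_le_mul_of_nonneg_left h1 (by positivity : 0 ≤ 2000 * c ^ 2)
          refine h2.trans_eq ?_
          rw [hε]; field_simp; norm_num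
        · rw [← hC₁]
          have h3 : 4 * C₁ * E * (s - t₀ / h ^ 2) ≤ 4 * C₁ * E * (δ * 256 * r ^ 2) :=
            mul_le_mul_of_nonneg_left (by linarith [hs.2]) (by positivity)
          have h4 := mul_le_mul_of_nonneg_right hδ2 (sq_nonneg r)
          linarith)
    simp only [ht'] at hmain
    have hHess : ∑ j ∈ box x (2 * r + 1), hess (u t) j ≤ C * h ^ 2 / σ := by
      have h1 : ∑ j ∈ box x (2 * r + 1), hess (u t) j ≤ ∑ j ∈ box x (3 * r), hess (u t) j := by
        refine Finset.sum_le_sum_of_subset_of_nonneg (fun j hj => ?_) (fun j _ _ => hess_nonneg _ j)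
        rw [mem_box (by positivity)] at hj ⊢
        linarith
      have h2 : 0 ≤ ∑ j ∈ box x (3 * r), hess (u t) j :=
        Finset.sum_nonneg fun j _ => hess_nonneg _ j
      have h3 : σ / h ^ 2 ≤ t / h ^ 2 - t₀ / h ^ 2 := by
        rw [← sub_div]
        exact div_le_div_of_nonneg_right (by linarith) (by positivity)
      have h4 := (mul_le_mul_of_nonneg_right h3 h2).trans hmain
      rw [div_mul_eq_mul_div, div_le_iff₀ (by positivity)] at h4
      rw [le_div_iff₀ hσ]
      nlinarith
    have hsum := sum_diffNormSq_le (h := h) (u t) x (by positivity) hHess hF2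
    have h5 := mul_le_mul_of_nonneg_left hsum (sq_nonneg h)
    have h6 : h ^ 2 * (numDiff * ((h ^ 4)⁻¹ * (C * h ^ 2 / σ))) = numDiff * (C / σ) := by
      field_simp
    linarith
  · push Not at hr4
    have h7 := hb.coarse_bound (hu.mem t ht) hh hr0 hr4 x hF2
    rw [hrR] at h7
    linarith
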